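/- **Setting.** Let $Q$ be a smooth $D$-dimensional manifold, $\mathbb P\subseteq TQ$ an open set (for instance $TQ$ itself), $\tau:TQ\to Q$ the projection, and $L:\mathbb P\to\mathbb R$ a smooth Lagrangian. In coordinates $(q^a,v^a)$ put $M_{ab}=\partial^2L/\partial v^a\partial v^b$, $E=v^a\,\partial L/\partial v^a-L$, $\Omega_L=-d\big(\tfrac{\partial L}{\partial v^a}dq^a\big)$. Assume that $M_{ab}$ has constant rank on $\mathbb P$ (as it has for almost regular $L$) and that $\Omega_L$ has constant rank on $\mathbb P$. Define: * $\mathcal G(u)=\ker\Omega_L(u)\cap\ker T_u\tau$ (in coordinates, the vectors $z^a\partial/\partial v^a$ with $M_{ab}z^b=0$); $\overline{\mathcal F}$ is the algebra of smooth functions $f$ on $\mathbb P$ with $Gf=0$ for all smooth sections $G$ of $\mathcal G$. * $\overline{\ker\Omega_L}$ is the space of smooth sections $X$ of $\ker\Omega_L$ such that $[G,X]$ is vertical for all sections $G$ of $\mathcal G$. * $\mathrm{Sym}\mathcal L=\{S\in\overline{\ker\Omega_L} : S E=0 \text{ on } \mathbb P\}$, the generators of the symmetries of the action, taken modulo $\mathcal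 G$. Let $\mathrm{Sym}\mathcal L(u)=\{S(u):S\in\mathrm{Sym}\mathcal L\}\supseteq\mathcal G(u)$ and $N_{\mathrm{Sym}\mathcal L}(u)=\dim\big(\mathrm{Sym}\mathcal L(u)/\mathcal G(u)\big)$; if this does not depend on $u\in\mathbb P$, the common value is denoted $N_{\mathrm{Sym}\mathcal L}$. * With $\mathbb P^{[1]}\subseteq\mathbb P$ as below, $\overline{\mathrm{Sol}}$ is the set of second-order Euler–Lagrange vector fields (SOELVFs): the smooth vector fields $X$ on $\mathbb P$ with $i_X\Omega_L=dE$ on $\mathbb P^{[1]}$ and $[G,X]$ vertical for all sections $G$ of $\mathcal G$. Let $\beta[X]=dE-i_X\Omega_L$. **The constraint algorithm.** Start with $P^{[1]}_{(1)},\dots,P^{[1]}_{(N^{[1]}_0)}\in\overline{\ker\Omega_L}$ which form a basis of $\ker\Omega_L(u)/\mathcal G(u)$ at every $u\in\mathbb P$, the constraint functions $\gamma^{[1]}_n=P^{[1]}_{(n)}E$ with generators $Q^{[1]}_{(n)}=P^{[1]}_{(n)}$, and some $X^{[1]}\in\overline{\mathrm{Sol}}$. Write $\mathbb P^{[0]}=\mathbb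 P$ and let $\mathbb P^{[l]}$ be the set of common zeros in $\mathbb P$ of all $\gamma^{[k]}_n$, $1\le k\le l$. At iteration $l$ let $\Gamma^{[l]}_{nm}=P^{[l]}_{(m)}\gamma^{[l]}_n$ ($1\le n,m\le N_0^{[l]}$), which is assumed to have constant rank $N_0^{[l]}-N_0^{[l+1]}$ on $\mathbb P^{[l]}$. Choose coefficients $A^k_j,B^k_j\in\overline{\mathcal F}$ ($1\le j\le N_0^{[l+1]}$) which on $\mathbb P^{[l]}$ form bases of the right and of the left kernel of $\Gamma^{[l]}$, and put $P^{[l+1]}_{(j)}=A_j^kP^{[l]}_{(k)}$, $Q^{[l+1]}_{(j)}=B_j^kQ^{[l]}_{(k)}$, $\gamma^{[l+1]}_j=X^{[l]}\big(B^k_j\gamma^{[l]}_k\big)$. Then choose $w^k\in\overline{\mathcal F}$ with $\Gamma^{[l]}_{nk}w^k=-X^{[l]}\gamma^{[l]}_n$ for all $n$ on $\mathbb P^{[l+1]}$, and put $X^{[l+1]}=X^{[l]}+w^kP^{[l]}_{(k)}$. It is assumed that $\mathbb P^{[l]}$ is a submanifold of dimension $2D-I_{[l]}$, where $I_{[l]}$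 is the rank, constant on $\mathbb P^{[l]}$, of the differentials $d\gamma^{[k]}_n$, $k\le l$. The algorithm stops at the first $n_F\ge2$ with $I_{[n_F]}=I_{[n_F-1]}$ or $I_{[n_F]}=2D$; it is assumed that $\mathbb P^{[n_F]}\neq\emptyset$. Let $\overline{\mathrm{Sol}}_{\mathbb P^{[n_F]}}$ be the set of $X\in\overline{\mathrm{Sol}}$ with $\mathfrak L_X\beta[X]=0$ on $\mathbb P^{[n_F]}$ which are tangent to $\mathbb P^{[n_F]}$ (i.e. $X\gamma^{[l]}_n=0$ on $\mathbb P^{[n_F]}$ for all $l\le n_F$ and all $n$). Its dimension at $u$ is the dimension of the span of $\{X(u)-Y(u): X,Y\in\overline{\mathrm{Sol}}_{\mathbb P^{[n_F]}}\}$ modulo $\mathcal G(u)$. **Theorem.** For every run of the constraint algorithm: 1. For $1\le l\le n_F$ and $u\in\mathbb P^{[l]}$: $\mathrm{Sym}\mathcal L(u)\subseteq\mathrm{span}\{P^{[l]}_{(m)}(u)\}+\mathcal G(u)$, so $N_{\mathrm{Sym}\mathcal L}(u)\le N_0^{[l]}$; if $a^mP^{[l]}_{(m)}(u)\in\mathrm{Sym}\mathcal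 L(u)$, then $\Gamma^{[l]}(u)a=0$; and if $c^nQ^{[l]}_{(n)}(u)\in\mathrm{Sym}\mathcal L(u)$, then $c^n\Gamma^{[l]}_{nm}(u)=0$ for all $m$ and $c^n\,(X^{[l]}\gamma^{[l]}_n)(u)=0$. Thus no iteration determines the functions that multiply generators in $\mathrm{Sym}\mathcal L$. 2. $X^{[n_F]}+\sum_{m=1}^{N_0^{[n_F]}}f^mP^{[n_F]}_{(m)}\in\overline{\mathrm{Sol}}_{\mathbb P^{[n_F]}}$ for arbitrary $f^m\in\overline{\mathcal F}$. 3. Each generator contributes an arbitrary function: if $X\in\overline{\mathrm{Sol}}_{\mathbb P^{[n_F]}}$, $S_1,\dots,S_k\in\mathrm{Sym}\mathcal L$ and $f^1,\dots,f^k\in\overline{\mathcal F}$, then $X+\sum_if^iS_i\in\overline{\mathrm{Sol}}_{\mathbb P^{[n_F]}}$. 4. At every $u\in\mathbb P^{[n_F]}$, $\dim\overline{\mathrm{Sol}}_{\mathbb P^{[n_F]}}=N_0^{[n_F]}\ge N_{\mathrm{Sym}\mathcal L}(u)$. In particular, if $\mathrm{Sym}\mathcal L$ has constant dimension $N_{\mathrm{Sym}\mathcal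 L}$ on $\mathbb P$, then $N_0^{[n_F]}\ge N_{\mathrm{Sym}\mathcal L}$ and $\dim\overline{\mathrm{Sol}}_{\mathbb P^{[n_F]}}\ge N_{\mathrm{Sym}\mathcal L}$. 5. No Lagrangian constraint, of second or higher order in particular, arises from $\mathrm{Sym}\mathcal L$: for $1\le l\le n_F$ and $u\in\mathbb P^{[l-1]}$, $\mathrm{Sym}\mathcal L(u)\subseteq\mathrm{span}\{Q^{[l]}_{(n)}(u)\}+\mathcal G(u)$, and whenever $c^nQ^{[l]}_{(n)}(u)\in\mathrm{Sym}\mathcal L(u)$, then $c^n\gamma^{[l]}_n(u)=0$; so the constraint functions of order $l$ generated by $\mathrm{Sym}\mathcal L$ vanish already on $\mathbb P^{[l-1]}$. -/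

import Mathlib

open Set Filter Topology Manifold VectorField
open scoped ContDiff

noncomputable section

namespace LagMech

/-! ### The velocity phase space of a configuration manifold

The configuration space `Q` is a smooth manifold of dimension `D`; the Lagrangian phase space is an
open subset `P` of `TQ` (all of `TQ` being allowed).  Functions, vector fields and one-forms are
given on `TQ`, and only their restrictions to `P` matter. -/

/-- The model space `ℝ^D`. -/
abbrev Model (D : ℕ) := EuclideanSpace ℝ (Fin D)

/-- The model with corners of the manifold `TQ`. -/
abbrev TModel (D : ℕ) := (𝓘(ℝ, Model D)).tangent

/-- The tangent bundle `TQ`; a point is a pair `⟨q, v⟩`. -/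
abbrev TQ (D : ℕ) (Q : Type*) [TopologicalSpace Q] [ChartedSpace (Model D) Q]
    [IsManifold 𝓘(ℝ, Model D) ∞ Q] := TangentBundle 𝓘(ℝ, Model D) Q

section

variable {D : ℕ} {Q : Type*} [TopologicalSpace Q] [ChartedSpace (Model D) Q]
  [IsManifold 𝓘(ℝ, Model D) ∞ Q]

/-- The tangent space of `TQ` at `u`. -/
abbrev T (u : TQ D Q) := TangentSpace (TModel D) u

/-- Vector fields on `TQ`. -/
abbrev VField (D : ℕ) (Q : Type*) [TopologicalSpace Q] [ChartedSpace (Model D) Q]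
    [IsManifold 𝓘(ℝ, Model D) ∞ Q] := (u : TQ D Q) → T u

/-- One-forms on `TQ`. -/
abbrev OneForm (D : ℕ) (Q : Type*) [TopologicalSpace Q] [ChartedSpace (Model D) Q]
    [IsManifold 𝓘(ℝ, Model D) ∞ Q] := (u : TQ D Q) → (T u →L[ℝ] ℝ)

/-- `f` is smooth on `P`. -/
def SmoothFun (P : Set (TQ D Q)) (f : TQ D Q → ℝ) : Prop :=
  ContMDiffOn (TModel D) 𝓘(ℝ, ℝ) ∞ f P

/-- `X` is a smooth vector field on `P`. -/
def SmoothField (P : Set (TQ D Q)) (X : VField D Q) : Prop :=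
  ContMDiffOn (TModel D) (TModel D).tangent ∞
    (fun u => (⟨u, X u⟩ : TangentBundle (TModel D) (TQ D Q))) P

/-- The differential `d f`. -/
def diff (f : TQ D Q → ℝ) : OneForm D Q := fun u =>
  mfderiv (TModel D) 𝓘(ℝ, ℝ) f u

/-- The action `X f = ⟨d f | X⟩` of a vector field on a function. -/
def act (X : VField D Q) (f : TQ D Q → ℝ) : TQ D Q → ℝ := fun u => diff f u (X u)

/-- The Lie bracket of vector fields on `TQ`. -/
def bracket (X Y : VField D Q) : VField D Q := mlieBracket (TModel D) X Y

/-- The Lie derivative of a one-form, `(𝔏_X β)(Z) = X (β Z) - β [X, Z]`. -/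
def lieDeriv (X : VField D Q) (β : (u : TQ D Q) → T u → ℝ) (Z : VField D Q) : TQ D Q → ℝ :=
  fun u => act X (fun w => β w (Z w)) u - β u (bracket X Z u)

/-- The tangent map `Tτ` of the projection `τ : TQ → Q`. -/
def tangentProj (u : TQ D Q) : T u →L[ℝ] TangentSpace 𝓘(ℝ, Model D) u.proj :=
  mfderiv (TModel D) 𝓘(ℝ, Model D) (fun w : TQ D Q => w.proj) u

/-- The vertical subspace `ker Tτ` of the tangent space of `TQ` at `u`. -/
def vertical (u : TQ D Q) : Submodule ℝ (T u) :=
  LinearMap.ker (tangentProj u : T u →ₗ[ℝ] TangentSpace 𝓘(ℝ, Model D) u.proj)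

/-! ### Structures defined by a Lagrangian -/

/-- The fibre derivative of `L`, in coordinates `∂L/∂v^a`. -/
def fibreDeriv (L : TQ D Q → ℝ) (u : TQ D Q) : Model D →L[ℝ] ℝ :=
  fderiv ℝ (fun w : Model D => L ⟨u.proj, w⟩) u.snd

/-- The fibre Hessian of `L`, in coordinates `M_{ab} = ∂²L/∂v^a∂v^b`. -/
def fibreHessian (L : TQ D Q → ℝ) (u : TQ D Q) : Model D →L[ℝ] Model D →L[ℝ] ℝ :=
  fderiv ℝ (fderiv ℝ (fun w : Model D => L ⟨u.proj, w⟩)) u.snd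

/-- The energy `E = v^a ∂L/∂v^a - L`. -/
def energy (L : TQ D Q → ℝ) (u : TQ D Q) : ℝ := fibreDeriv L u u.snd - L u

/-- The Cartan one-form `θ_L = d_J L`, in coordinates `(∂L/∂v^a) dq^a`. -/
def theta (L : TQ D Q → ℝ) : OneForm D Q := fun u => (fibreDeriv L u).comp (tangentProj u)

/-- The coefficients of a one-form in the preferred chart of `TQ` at `u₀`. -/
def coeffs (α : OneForm D Q) (u₀ : TQ D Q) (z : Model D × Model D) :
    (Model D × Model D) →L[ℝ] ℝ :=
  (α ((extChartAt (TModel D) u₀).symm z)).comp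
    (mfderiv 𝓘(ℝ, Model D × Model D) (TModel D) (extChartAt (TModel D) u₀).symm z)

/-- The differential at `u` of the preferred chart of `TQ` at `u`. -/
def chartDiff (u : TQ D Q) : T u →L[ℝ] (Model D × Model D) :=
  mfderiv (TModel D) 𝓘(ℝ, Model D × Model D) (extChartAt (TModel D) u) u

/-- The exterior derivative of a one-form at `u`, computed in the preferred chart at `u`:
`dα (x, y) = D_x α (y) - D_y α (x)`. -/
def extDer (α : OneForm D Q) (u : TQ D Q) (x y : T u) : ℝ :=
  fderiv ℝ (coeffs α u) (extChartAt (TModel D) u u) (chartDiff u x) (chartDiff u y) -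
    fderiv ℝ (coeffs α u) (extChartAt (TModel D) u u) (chartDiff u y) (chartDiff u x)

/-- The Lagrangian two-form `Ω_L = -d θ_L`. -/
def Omega (L : TQ D Q → ℝ) (u : TQ D Q) (x y : T u) : ℝ := - extDer (theta L) u x y

theorem Omega_add_left (L : TQ D Q → ℝ) (u : TQ D Q) (x x' y : T u) :
    Omega L u (x + x') y = Omega L u x y + Omega L u x' y := by
  simp only [Omega, extDer, map_add, add_apply]
  ring

theorem Omega_smul_left (L : TQ D Q → ℝ) (u : TQ D Q) (c : ℝ) (x y : T u) :
    Omega L u (c • x) y = c * Omega L u x y := by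
  simp only [Omega, extDer, map_smul, smul_apply, smul_eq_mul]
  ring

/-- `ker Ω_L(u)`. -/
def kerOmega (L : TQ D Q → ℝ) (u : TQ D Q) : Submodule ℝ (T u) where
  carrier := {x | ∀ y, Omega L u x y = 0}
  zero_mem' y := by
    have h := Omega_smul_left L u 0 0 y
    rwa [zero_smul, zero_mul] at h
  add_mem' hx hx' y := by rw [Omega_add_left, hx y, hx' y, add_zero]
  smul_mem' c x hx y := by rw [Omega_smul_left, hx y, mul_zero]

/-- The subspace `𝒢(u)` of vertical vectors `G` with `i_G Ω_M = 0`.  For a vertical `G` one has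
`i_G Ω_F = 0`, hence `i_G Ω_M = i_G Ω_L`; in coordinates `G = z^a ∂/∂v^a` with `M_{ab} z^b = 0`. -/
def calG (L : TQ D Q → ℝ) (u : TQ D Q) : Submodule ℝ (T u) := vertical u ⊓ kerOmega L u

/-- Smooth sections of `𝒢` over `P`. -/
def IsSectionG (L : TQ D Q → ℝ) (P : Set (TQ D Q)) (G : VField D Q) : Prop :=
  SmoothField P G ∧ ∀ u ∈ P, G u ∈ calG L u

/-- The algebra `F̄` of smooth functions on `P` annihilated by `𝒢`. -/
def Fbar (L : TQ D Q → ℝ) (P : Set (TQ D Q)) : Set (TQ D Q → ℝ) :=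
  {f | SmoothFun P f ∧ ∀ G, IsSectionG L P G → ∀ u ∈ P, act G f u = 0}

/-- The condition `[G, X] ∈ [TP]^v` for all sections `G` of `𝒢`. -/
def BracketVertical (L : TQ D Q → ℝ) (P : Set (TQ D Q)) (X : VField D Q) : Prop :=
  ∀ G, IsSectionG L P G → ∀ u ∈ P, bracket G X u ∈ vertical u

/-- The space of smooth sections `X` of `ker Ω_L` such that `[G, X]` is vertical for all sections
`G` of `𝒢` (written with an overline over `ker Ω_L`). -/
def kerBar (L : TQ D Q → ℝ) (P : Set (TQ D Q)) : Set (VField D Q) :=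
  {X | SmoothField P X ∧ (∀ u ∈ P, X u ∈ kerOmega L u) ∧ BracketVertical L P X}

/-- The constraint one-form `β[X] = d E - i_X Ω_L`. -/
def beta (L : TQ D Q → ℝ) (X : VField D Q) (u : TQ D Q) (y : T u) : ℝ :=
  diff (energy L) u y - Omega L u (X u) y

/-- The generators `Sym𝓛` of the symmetries of the action, as a space of vector fields containing
the sections of `𝒢`: the `S` in `kerBar` whose first-order constraint function
`γ_S = ⟨β | S⟩ = S E` vanishes on all of `P`.  (As `i_S Ω_L = 0`, `⟨β[X] | S⟩ = S E` for all `X`.) -/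
def SymL (L : TQ D Q → ℝ) (P : Set (TQ D Q)) : Set (VField D Q) :=
  {S | S ∈ kerBar L P ∧ ∀ u ∈ P, act S (energy L) u = 0}

/-- The subspace of the tangent space at `u` formed by the values `S(u)`, `S ∈ Sym𝓛`. -/
def symSpace (L : TQ D Q → ℝ) (P : Set (TQ D Q)) (u : TQ D Q) : Submodule ℝ (T u) :=
  Submodule.span ℝ {x | ∃ S ∈ SymL L P, x = S u}

/-- `N_{Sym𝓛}` at `u`: the dimension at `u` of `Sym𝓛` modulo `𝒢`. -/
def symDim (L : TQ D Q → ℝ) (P : Set (TQ D Q)) (u : TQ D Q) : ℕ :=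
  Module.finrank ℝ ((symSpace L P u).map (calG L u).mkQ)

/-- Second-order Euler-Lagrange vector fields, for the first-order constraint set `P₁`: solutions
of the energy equation on `P₁` with `[G, X]` vertical for all sections `G` of `𝒢`. -/
def SolBar (L : TQ D Q → ℝ) (P P₁ : Set (TQ D Q)) : Set (VField D Q) :=
  {X | SmoothField P X ∧ (∀ u ∈ P₁, ∀ y, Omega L u (X u) y = diff (energy L) u y) ∧
    BracketVertical L P X}

/-! ### The constraint algorithm -/

/-- `M` is, near its point `u`, a smooth submanifold of codimension `k`. -/
def IsSubmanifoldAt (M : Set (TQ D Q)) (k : ℕ) (u : TQ D Q) : Prop :=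
  ∃ f : TQ D Q → (Fin k → ℝ), ContMDiffAt (TModel D) 𝓘(ℝ, Fin k → ℝ) ∞ f u ∧
    Function.Surjective (mfderiv (TModel D) 𝓘(ℝ, Fin k → ℝ) f u) ∧
    ∀ᶠ w in 𝓝 u, (w ∈ M ↔ f w = 0)

/-- The constraint set of order `l`: the common zeros in `P` of the constraint functions `γ k n` of
orders `1 ≤ k ≤ l`.  For `l = 0` it is `P`. -/
def constraintSet (P : Set (TQ D Q)) {N : ℕ → ℕ} (γ : (l : ℕ) → Fin (N l) → TQ D Q → ℝ)
    (l : ℕ) : Set (TQ D Q) :=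
  {u | u ∈ P ∧ ∀ k, 1 ≤ k → k ≤ l → ∀ n, γ k n u = 0}

/-- The rank at `u` of the differentials of the constraint functions of orders `1, …, l`. -/
def constraintRank {N : ℕ → ℕ} (γ : (l : ℕ) → Fin (N l) → TQ D Q → ℝ) (l : ℕ) (u : TQ D Q) : ℕ :=
  Module.finrank ℝ (Submodule.span ℝ
    {α : T u →L[ℝ] ℝ | ∃ k, 1 ≤ k ∧ k ≤ l ∧ ∃ n : Fin (N k), α = diff (γ k n) u})

/-- The matrix `Γ_{nm} = ⟨d γ_n | P_m⟩` at `u`. -/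
def GammaMat {N : ℕ} (frame : Fin N → VField D Q) (γ : Fin N → TQ D Q → ℝ) (u : TQ D Q) :
    Matrix (Fin N) (Fin N) ℝ :=
  Matrix.of fun n m => act (frame m) (γ n) u

/-- A complete run of the Lagrangian constraint algorithm for second-order Euler-Lagrange vector
fields, in `nF` iterations.  The superscript `[l]` is the argument `l`; only `1 ≤ l ≤ nF` matter. -/
structure ConstraintAlgorithm (L : TQ D Q → ℝ) (P : Set (TQ D Q)) where
  /-- the final iteration -/
  nF : ℕ
  two_le : 2 ≤ nF
  /-- `N₀^[l]`, the number of still undetermined functions and of constraint functions -/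
  N : ℕ → ℕ
  /-- the vector fields `P^[l]_(m)`, which the undetermined functions multiply -/
  frame : (l : ℕ) → Fin (N l) → VField D Q
  /-- the determined part `X_L^[l]` of the SOELVF -/
  X : ℕ → VField D Q
  /-- the constraint functions of order `l` -/
  γ : (l : ℕ) → Fin (N l) → TQ D Q → ℝ
  /-- the generators from which the constraint functions of order `l` are obtained -/
  gen : (l : ℕ) → Fin (N l) → VField D Q
  /-- a basis of the right kernel of `Γ^[l]` -/
  A : (l : ℕ) → Fin (N (l + 1)) → Fin (N l) → TQ D Q → ℝ
  /-- a basis of the left kernel of `Γ^[l]` -/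
  B : (l : ℕ) → Fin (N (l + 1)) → Fin (N l) → TQ D Q → ℝ
  /-- the coefficients determined at the iteration `l` -/
  w : (l : ℕ) → Fin (N l) → TQ D Q → ℝ
  /-- `I_[l]`, the number of independent constraint functions of orders up to `l` -/
  I : ℕ → ℕ
  -- Start: a basis of `kerBar / 𝒢`, a SOELVF, and the first-order constraint functions.
  frame_one_mem : ∀ n, frame 1 n ∈ kerBar L P
  frame_one_indep : ∀ u ∈ P, LinearIndependent ℝ fun n => (calG L u).mkQ (frame 1 n u)
  frame_one_span : ∀ u ∈ P,
    kerOmega L u = Submodule.span ℝ (range fun n => frame 1 n u) ⊔ calG L u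
  γ_one : ∀ n, ∀ u ∈ P, γ 1 n u = act (frame 1 n) (energy L) u
  gen_one : ∀ n, ∀ u ∈ P, gen 1 n u = frame 1 n u
  X_one : X 1 ∈ SolBar L P (constraintSet P γ 1)
  -- The matrix `Γ^[l]` has constant rank `N₀^[l] - N₀^[l+1]`; `A` and `B` are bases of its kernels.
  rank_eq : ∀ l, 1 ≤ l → l < nF → ∀ u ∈ constraintSet P γ l,
    (GammaMat (frame l) (γ l) u).rank + N (l + 1) = N l
  A_mem : ∀ l, 1 ≤ l → l < nF → ∀ j k, A l j k ∈ Fbar L P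
  A_indep : ∀ l, 1 ≤ l → l < nF → ∀ u ∈ constraintSet P γ l,
    LinearIndependent ℝ fun j => fun k => A l j k u
  A_ker : ∀ l, 1 ≤ l → l < nF → ∀ u ∈ constraintSet P γ l, ∀ j,
    (GammaMat (frame l) (γ l) u).mulVec (fun k => A l j k u) = 0
  B_mem : ∀ l, 1 ≤ l → l < nF → ∀ j k, B l j k ∈ Fbar L P
  B_indep : ∀ l, 1 ≤ l → l < nF → ∀ u ∈ constraintSet P γ l,
    LinearIndependent ℝ fun j => fun k => B l j k u
  B_ker : ∀ l, 1 ≤ l → l < nF → ∀ u ∈ constraintSet P γ l, ∀ j,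
    Matrix.vecMul (fun k => B l j k u) (GammaMat (frame l) (γ l) u) = 0
  -- Passage from `l` to `l + 1`: the recombined undetermined directions, and the new constraint
  -- functions `⟨d γ' | X_L^[l]⟩`, with `γ'` the combinations of the `γ^[l]` by the left kernel.
  frame_succ : ∀ l, 1 ≤ l → l < nF → ∀ j, ∀ u ∈ P,
    frame (l + 1) j u = ∑ k, A l j k u • frame l k u
  gen_succ : ∀ l, 1 ≤ l → l < nF → ∀ j, ∀ u ∈ P,
    gen (l + 1) j u = ∑ k, B l j k u • gen l k u
  γ_succ : ∀ l, 1 ≤ l → l < nF → ∀ j, ∀ u ∈ P,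
    γ (l + 1) j u = act (X l) (fun z => ∑ k, B l j k z * γ l k z) u
  -- The determined part of the functions solves `Γ^[l] w = - ⟨d γ^[l] | X_L^[l]⟩` wherever the new
  -- constraints hold.
  w_mem : ∀ l, 1 ≤ l → l < nF → ∀ k, w l k ∈ Fbar L P
  w_eq : ∀ l, 1 ≤ l → l < nF → ∀ u ∈ constraintSet P γ (l + 1), ∀ n,
    (GammaMat (frame l) (γ l) u).mulVec (fun k => w l k u) n = - act (X l) (γ l n) u
  X_succ : ∀ l, 1 ≤ l → l < nF → ∀ u ∈ P,
    X (l + 1) u = X l u + ∑ k, w l k u • frame l k u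
  -- The constraint sets are submanifolds of dimension `2 D - I_[l]`.
  rank_I : ∀ l, 1 ≤ l → l ≤ nF → ∀ u ∈ constraintSet P γ l, constraintRank γ l u = I l
  submanifold : ∀ l, 1 ≤ l → l ≤ nF → ∀ u ∈ constraintSet P γ l,
    IsSubmanifoldAt (constraintSet P γ l) (I l) u
  -- The stopping rule, and the consistency of the final constraints.
  continues : ∀ l, 2 ≤ l → l < nF → I (l - 1) < I l ∧ I l < 2 * D
  stops : I nF = I (nF - 1) ∨ I nF = 2 * D
  nonempty : (constraintSet P γ nF).Nonempty

namespace ConstraintAlgorithm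

variable {L : TQ D Q → ℝ} {P : Set (TQ D Q)}

/-- The constraint submanifold `P_L^[l]`. -/
def cSet (R : ConstraintAlgorithm L P) (l : ℕ) : Set (TQ D Q) := constraintSet P R.γ l

/-- The matrix `Γ^[l]` at `u`. -/
def Gam (R : ConstraintAlgorithm L P) (l : ℕ) (u : TQ D Q) : Matrix (Fin (R.N l)) (Fin (R.N l)) ℝ :=
  GammaMat (R.frame l) (R.γ l) u

/-- The final SOELVFs: the `X` in `SolBar` with `𝔏_X β[X] = 0` on the final constraint submanifold,
to which they are moreover tangent, so that their integral flow stays on it. -/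
def finalSol (R : ConstraintAlgorithm L P) : Set (VField D Q) :=
  {X | X ∈ SolBar L P (R.cSet 1) ∧
    (∀ Z, SmoothField P Z → ∀ u ∈ R.cSet R.nF, lieDeriv X (beta L X) Z u = 0) ∧
    ∀ l, 1 ≤ l → l ≤ R.nF → ∀ n, ∀ u ∈ R.cSet R.nF, act X (R.γ l n) u = 0}

/-- The dimension at `u` of the affine space of final SOELVFs modulo `𝒢`: that of the space of
differences of two of them. -/
def finalSolDim (R : ConstraintAlgorithm L P) (u : TQ D Q) : ℕ :=
  Module.finrank ℝ (Submodule.span ℝ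
    {x : T u ⧸ calG L u | ∃ X ∈ R.finalSol, ∃ Y ∈ R.finalSol, x = (calG L u).mkQ (X u - Y u)})

end ConstraintAlgorithm

end

end LagMech

end

/-!
The argument is about tangency. Let `T_l(u)` (`tan l u`) be the space of vectors annihilated by the
differentials of the constraint functions of orders up to `l`. The following three facts hold at
every order (`tangency`), by a simultaneous induction on `l`:

* the undetermined directions `P^[l+1]` and `𝒢` together span `ker Ω_L ∩ T_l` on `ℙ^[l]`;
* the field `X^[l+1]` is in `T_l` on `ℙ^[l+1]`;
* every `S ∈ Sym𝓛` is in `T_l` on `ℙ^[l]`.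

The first two restate the linear algebra of the algorithm: the vectors `A_j` span the right kernel of
`Γ`, and `w` is chosen to make `X` tangent. The third is the essential one. Since
`i_S Ω_L = 0` and `Ω_L` is closed, `𝔏_S Ω_L = 0`; with `S E = 0` it follows that `[S, X]` is in
`ker Ω_L` if `X` solves the energy equation on a set to which `S` is tangent
(`negCurl_lieBracket_eq_zero`, `bracket_mem_kerOmega`). A constraint function of the next order is
`X g`, where `g` is a combination of constraint functions by the left kernel of `Γ`, and
`S (X g) = X (S g) + [S, X] g`. Here `[S, X] ∈ ker Ω_L ∩ T_l` is an undetermined direction, so it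
annihilates `g`. The function `S g` vanishes on the constraint submanifold, and the next field of
the algorithm, which is tangent to it and differs from `X` by undetermined directions, annihilates
`S g`; the undetermined directions annihilate it as well (`symL_mem_tan_succ`).

Functions vanishing on a constraint submanifold are killed by its tangent vectors because the
submanifold has the codimension given by the rank of the differentials of the constraint functions,
so that these differentials span its conormal space (`IsSubmanifoldAt.diff_eq_zero`). The rank
condition on the fibre Hessian makes `𝒢` a smooth distribution spanned by its sections
(`exists_isSectionG`); these are symmetries, so `𝒢` is tangent too.

For the generators `Q^[l]` the induction runs as follows (`symSpace_le_span_gen`). If, on `ℙ^[l]`,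
symmetries are combinations `∑ s_n Q_n` modulo `𝒢` whose constraint functions `∑ s_n γ_n` vanish,
then the coefficients `s_n` may be chosen differentiable (`exists_coeff_modulo_calG`), and
differentiation along tangent vectors at a zero of the `γ_n` gives `∑ s_n dγ_n = 0` on `T_l`
(`sum_mul_diff_γ_eq_zero`). Applied to the undetermined directions this puts `s` in the left kernel
of `Γ`, which is spanned by the vectors `B_j`; applied to `X` it says that the constraint function of
the next order vanishes.

At the end, the stopping rule makes the tangent spaces of the last two constraint submanifolds equal
(`tan_pred_le_tan`): either the conormal spaces have the same dimension, or the last one is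
everything, and then `𝒢 = 0`, so `ker Ω_L = 0`, and there are no undetermined directions at all. So
`X^[n_F]` and the last undetermined directions are tangent to the final constraint submanifold, and
the differences of final solutions fill exactly the span of the latter modulo `𝒢`
(`finalSolDim_eq`).
-/

noncomputable section

namespace LagMech

/-! ### Brackets, two-forms and level sets in a vector space -/

section Calculus

variable {E : Type*} [NormedAddCommGroup E] [NormedSpace ℝ E]

/-- Minus the exterior derivative of a one-form on a vector space. -/
def negCurl (a : E → E →L[ℝ] ℝ) (z x y : E) : ℝ := -(fderiv ℝ a z x y - fderiv ℝ a z y x)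

/-- The Lie bracket acts on functions as the commutator; the second derivative cancels. -/
theorem fderiv_lieBracket {f : E → ℝ} {X Y : E → E} {z : E} (hf : ContDiffAt ℝ 2 f z)
    (hX : DifferentiableAt ℝ X z) (hY : DifferentiableAt ℝ Y z) :
    fderiv ℝ f z (lieBracket ℝ X Y z) =
      fderiv ℝ (fun w => fderiv ℝ f w (Y w)) z (X z) -
        fderiv ℝ (fun w => fderiv ℝ f w (X w)) z (Y z) := by
  have hf' : DifferentiableAt ℝ (fderiv ℝ f) z :=
    (hf.fderiv_right (m := 1) (by norm_num)).differentiableAt (by norm_num)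
  have hsymm : IsSymmSndFDerivAt ℝ f z := hf.isSymmSndFDerivAt (by simp)
  rw [fderiv_clm_apply hf' hY, fderiv_clm_apply hf' hX]
  simp only [lieBracket, map_sub, add_apply, ContinuousLinearMap.comp_apply,
    ContinuousLinearMap.flip_apply]
  rw [hsymm.eq (X z) (Y z)]
  ring

/-- If `i_S Ω = 0` and `S e = 0` near `z`, and the one-form `i_X Ω - de` vanishes at `z` together with
the derivatives of its components along `S`, then `i_{[S, X]} Ω = 0` at `z`, where `Ω = -da`. As
`Ω` is closed, `𝔏_S Ω = d (i_S Ω) = 0` and `𝔏_S (de) = d (S e) = 0`, while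
`i_{[S, X]} Ω = 𝔏_S (i_X Ω) - i_X 𝔏_S Ω`. -/
theorem negCurl_lieBracket_eq_zero {a : E → E →L[ℝ] ℝ} {e : E → ℝ} {S X : E → E} {z : E}
    (ha : ContDiffAt ℝ 2 a z) (he : ContDiffAt ℝ 2 e z)
    (hS : DifferentiableAt ℝ S z) (hX : DifferentiableAt ℝ X z)
    (hker : ∀ᶠ w in 𝓝 z, ∀ y, negCurl a w (S w) y = 0)
    (hSe : ∀ᶠ w in 𝓝 z, fderiv ℝ e w (S w) = 0)
    (hXz : ∀ y, negCurl a z (X z) y = fderiv ℝ e z y)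
    (hder : ∀ y, fderiv ℝ (fun w => negCurl a w (X w) y - fderiv ℝ e w y) z (S z) = 0) (y : E) :
    negCurl a z (lieBracket ℝ S X z) y = 0 := by
  have ha' : DifferentiableAt ℝ (fderiv ℝ a) z :=
    (ha.fderiv_right (m := 1) (by norm_num)).differentiableAt (by norm_num)
  have he' : DifferentiableAt ℝ (fderiv ℝ e) z :=
    (he.fderiv_right (m := 1) (by norm_num)).differentiableAt (by norm_num)
  have hsymm : IsSymmSndFDerivAt ℝ a z := ha.isSymmSndFDerivAt (by simp)
  have hesymm : IsSymmSndFDerivAt ℝ e z := he.isSymmSndFDerivAt (by simp)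
  have key : ∀ (Z : E → E) (_ : DifferentiableAt ℝ Z z) (y : E),
      HasFDerivAt (fun w => negCurl a w (Z w) y)
        (-(((ContinuousLinearMap.apply ℝ ℝ y).comp ((fderiv ℝ a z).comp (fderiv ℝ Z z) +
          (fderiv ℝ (fderiv ℝ a) z).flip (Z z))) -
          ((fderiv ℝ a z y).comp (fderiv ℝ Z z) +
          ((((ContinuousLinearMap.apply ℝ (E →L[ℝ] ℝ) y).comp
            (fderiv ℝ (fderiv ℝ a) z))).flip (Z z))))) z := by
    intro Z hZ y
    have h1 : HasFDerivAt (fun w => fderiv ℝ a w (Z w)) _ z :=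
      ha'.hasFDerivAt.clm_apply hZ.hasFDerivAt
    have h2 : HasFDerivAt (fun w => fderiv ℝ a w y)
        ((ContinuousLinearMap.apply ℝ (E →L[ℝ] ℝ) y).comp (fderiv ℝ (fderiv ℝ a) z)) z := by
      have h := ha'.hasFDerivAt.clm_apply (hasFDerivAt_const y z)
      refine h.congr_fderiv ?_
      ext x
      simp
    have h3 := (ContinuousLinearMap.apply ℝ ℝ y).hasFDerivAt.comp z h1
    exact (h3.sub (h2.clm_apply hZ.hasFDerivAt)).neg
  have hD : ∀ (Z : E → E) (_ : DifferentiableAt ℝ Z z) (y x : E),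
      fderiv ℝ (fun w => negCurl a w (Z w) y) z x =
      negCurl a z (fderiv ℝ Z z x) y -
        (fderiv ℝ (fderiv ℝ a) z x (Z z) y - fderiv ℝ (fderiv ℝ a) z x y (Z z)) := by
    intro Z hZ y x
    rw [(key Z hZ y).fderiv]
    simp [negCurl]
    ring
  have hneg : ∀ x y, negCurl a z x y = - negCurl a z y x := by
    intro x y; simp only [negCurl]; ring
  have hz : ∀ y, negCurl a z (S z) y = 0 := hker.self_of_nhds
  have e1 : ∀ y x, fderiv ℝ (fun w => negCurl a w (S w) y) z x = 0 := by
    intro y x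
    have : (fun w => negCurl a w (S w) y) =ᶠ[𝓝 z] fun _ => 0 := by
      filter_upwards [hker] with w hw using hw y
    rw [this.fderiv_eq]; simp
  have e2 := hder y
  have e2' : DifferentiableAt ℝ (fun w => negCurl a w (X w) y) z :=
    (key X hX y).differentiableAt
  have e2'' : HasFDerivAt (fun w => fderiv ℝ e w y)
      ((ContinuousLinearMap.apply ℝ ℝ y).comp (fderiv ℝ (fderiv ℝ e) z)) z :=
    (ContinuousLinearMap.apply ℝ ℝ y).hasFDerivAt.comp z he'.hasFDerivAt
  rw [fderiv_fun_sub e2' e2''.differentiableAt, e2''.fderiv, sub_apply, hD X hX] at e2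
  have e3 : fderiv ℝ (fun w => fderiv ℝ e w (S w)) z y = 0 := by
    have : (fun w => fderiv ℝ e w (S w)) =ᶠ[𝓝 z] fun _ => 0 := hSe
    rw [this.fderiv_eq]; simp
  rw [fderiv_clm_apply he' hS] at e3
  have e4 := e1 y (X z)
  have e5 := e1 (X z) y
  rw [hD S hS] at e4 e5
  have e6 := hXz (fderiv ℝ S z y)
  rw [hneg] at e6
  have c1 := hsymm.eq (S z) (X z)
  have c2 := hsymm.eq (S z) y
  have c3 := hsymm.eq (X z) y
  have c4 := hesymm.eq (S z) y
  have hlin : negCurl a z (lieBracket ℝ S X z) y =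
      negCurl a z (fderiv ℝ X z (S z)) y - negCurl a z (fderiv ℝ S z (X z)) y := by
    simp only [negCurl, lieBracket, map_sub, sub_apply]; ring
  rw [hlin]
  simp only [ContinuousLinearMap.comp_apply, ContinuousLinearMap.apply_apply, add_apply,
    ContinuousLinearMap.flip_apply] at e2 e3
  rw [c1, c2] at e2
  rw [c3] at e4
  rw [c4] at e2
  linarith

/-- The exterior derivative commutes with pull-backs; the second derivative of `ψ` cancels. -/
theorem negCurl_pullback {F : Type*} [NormedAddCommGroup F] [NormedSpace ℝ F]
    {a : F → F →L[ℝ] ℝ} {ψ : E → F} {z : E} (ha : DifferentiableAt ℝ a (ψ z))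
    (hψ : ContDiffAt ℝ 2 ψ z) (x y : E) :
    negCurl (fun w => (a (ψ w)).comp (fderiv ℝ ψ w)) z x y =
      negCurl a (ψ z) (fderiv ℝ ψ z x) (fderiv ℝ ψ z y) := by
  have hψ' : DifferentiableAt ℝ (fderiv ℝ ψ) z :=
    (hψ.fderiv_right (m := 1) (by norm_num)).differentiableAt (by norm_num)
  have hd : DifferentiableAt ℝ ψ z := hψ.differentiableAt (by norm_num)
  have hsymm : IsSymmSndFDerivAt ℝ ψ z := hψ.isSymmSndFDerivAt (by simp)
  have h : HasFDerivAt (fun w => (a (ψ w)).comp (fderiv ℝ ψ w)) _ z :=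
    (ha.hasFDerivAt.comp z hd.hasFDerivAt).clm_comp hψ'.hasFDerivAt
  simp only [negCurl, h.fderiv]
  simp
  rw [hsymm.eq x y]
  ring

/-- A function that vanishes on a smooth level set has vanishing derivative along it. If `g` is not
differentiable at `z`, its derivative is `0` by convention. -/
theorem fderiv_eq_zero_of_vanishing_on_level [CompleteSpace E] [FiniteDimensional ℝ E] {k : ℕ}
    {F : E → Fin k → ℝ} {g : E → ℝ} {z v : E} (hF : ContDiffAt ℝ 1 F z)
    (hsurj : Function.Surjective (fderiv ℝ F z)) (hF0 : F z = 0)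
    (hg : ∀ᶠ w in 𝓝 z, F w = 0 → g w = 0) (hv : fderiv ℝ F z v = 0) : fderiv ℝ g z v = 0 := by
  by_cases hgd : DifferentiableAt ℝ g z
  swap
  · rw [fderiv_zero_of_not_differentiableAt hgd]; rfl
  have hs : HasStrictFDerivAt F (fderiv ℝ F z) z := hF.hasStrictFDerivAt (by norm_num)
  have hr : (fderiv ℝ F z).range = ⊤ := LinearMap.range_eq_top.2 hsurj
  have hi := hs.to_implicitFunction hr
  set i := hs.implicitFunction F (fderiv ℝ F z) hr (F z) with hidef
  have hi0 : i 0 = z := hs.implicitFunction_apply_image hr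
  have hd := hi.hasFDerivAt
  have hgd' : HasFDerivAt g (fderiv ℝ g z) (i 0) := by rw [hi0]; exact hgd.hasFDerivAt
  have hc := hgd'.comp (0 : (fderiv ℝ F z).ker) hd
  have hev : (g ∘ i) =ᶠ[𝓝 0] fun _ => 0 := by
    have h1 : ∀ᶠ y in 𝓝 (0 : (fderiv ℝ F z).ker), F (i y) = F z := by
      have := hs.map_implicitFunction_eq hr
      have t : Tendsto (fun y : (fderiv ℝ F z).ker => (F z, y)) (𝓝 0) (𝓝 (F z, 0)) := by
        exact (continuous_const.prodMk continuous_id).tendsto 0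
      exact t.eventually this
    have h2 : ∀ᶠ y in 𝓝 (0 : (fderiv ℝ F z).ker), F (i y) = 0 → g (i y) = 0 := by
      have : Tendsto i (𝓝 0) (𝓝 z) := by
        have := hd.continuousAt.tendsto
        rwa [hi0] at this
      exact this.eventually hg
    filter_upwards [h1, h2] with y h1 h2
    exact h2 (by rw [h1, hF0])
  have hzero := hc.fderiv.symm.trans hev.fderiv_eq
  have := DFunLike.congr_fun hzero (⟨v, hv⟩ : (fderiv ℝ F z).ker)
  simpa using this

/-- The coefficients of `x` with respect to a family `b` that is independent at `z` may be chosen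
as functions differentiable at `z`. -/
theorem exists_differentiableAt_coeff [FiniteDimensional ℝ E] {F : Type*} [NormedAddCommGroup F]
    [NormedSpace ℝ F] [FiniteDimensional ℝ F] {N : ℕ} {b : Fin N → E → F} {x : E → F} {z : E}
    (hb : ∀ n, DifferentiableAt ℝ (b n) z) (hx : DifferentiableAt ℝ x z)
    (hind : LinearIndependent ℝ fun n => b n z) :
    ∃ s : Fin N → E → ℝ, (∀ n, DifferentiableAt ℝ (s n) z) ∧
      ∀ᶠ w in 𝓝 z, x w ∈ Submodule.span ℝ (range fun n => b n w) →
        x w = ∑ n, s n w • b n w := by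
  -- `T w` is the linear map with values `b n w` on the standard basis
  let T : E → (Fin N → ℝ) →L[ℝ] F := fun w =>
    ∑ n, (ContinuousLinearMap.proj (R := ℝ) (φ := fun _ : Fin N => ℝ) n).smulRight (b n w)
  have hT : ∀ w c, T w c = ∑ n, c n • b n w := by
    intro w c
    simp [T]
  have hTd : DifferentiableAt ℝ T z := by
    refine DifferentiableAt.fun_sum fun n _ => ?_
    exact ((ContinuousLinearMap.smulRightL ℝ (Fin N → ℝ) F
      (ContinuousLinearMap.proj n)).differentiableAt).comp z (hb n)
  have hinj : LinearMap.ker (T z : (Fin N → ℝ) →ₗ[ℝ] F) = ⊥ := by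
    rw [LinearMap.ker_eq_bot']
    intro c hc
    have hc' : T z c = 0 := hc
    rw [hT] at hc'
    exact funext fun n => Fintype.linearIndependent_iff.1 hind c hc' n
  obtain ⟨g, hg⟩ := (T z : (Fin N → ℝ) →ₗ[ℝ] F).exists_leftInverse_of_injective hinj
  let Λ : F →L[ℝ] (Fin N → ℝ) := LinearMap.toContinuousLinearMap g
  let M : E → (Fin N → ℝ) →L[ℝ] (Fin N → ℝ) := fun w => Λ.comp (T w)
  have hM1 : M z = 1 := by
    ext1 c
    exact DFunLike.congr_fun hg c
  have hMd : DifferentiableAt ℝ M z :=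
    (((ContinuousLinearMap.compL ℝ (Fin N → ℝ) F (Fin N → ℝ)) Λ).differentiableAt).comp z hTd
  have hunit : IsUnit (M z) := by rw [hM1]; exact isUnit_one
  have hinv : DifferentiableAt ℝ (fun w => Ring.inverse (M w)) z :=
    (differentiableAt_inverse hunit).comp z hMd
  have hev : ∀ᶠ w in 𝓝 z, IsUnit (M w) :=
    hMd.continuousAt.eventually (Units.isOpen.mem_nhds hunit)
  have hs : DifferentiableAt ℝ (fun w => Ring.inverse (M w) (Λ (x w))) z :=
    hinv.clm_apply (Λ.differentiableAt.comp z hx)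
  refine ⟨fun n w => Ring.inverse (M w) (Λ (x w)) n, fun n => differentiableAt_pi.1 hs n, ?_⟩
  filter_upwards [hev] with w hw hxw
  obtain ⟨c, hc⟩ := (Submodule.mem_span_range_iff_exists_fun ℝ).1 hxw
  have hx' : x w = T w c := by rw [hT, hc]
  have : Ring.inverse (M w) (Λ (x w)) = c := by
    rw [hx']
    have h1 : Ring.inverse (M w) * M w = 1 := Ring.inverse_mul_cancel _ hw
    exact DFunLike.congr_fun h1 c
  rw [this, hc]

/-- The kernel of a family of linear maps of constant rank has a local section through each of its
points. -/
theorem exists_contDiffOn_kernel_section {n : WithTop ℕ∞} {V W : Type*} [NormedAddCommGroup V]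
    [NormedSpace ℝ V]
    [FiniteDimensional ℝ V] [NormedAddCommGroup W] [NormedSpace ℝ W] [FiniteDimensional ℝ W]
    {m : E → V →L[ℝ] W} {U : Set E} {z : E} {r : ℕ} (hU : IsOpen U) (hz : z ∈ U)
    (hm : ContDiffOn ℝ n m U)
    (hr : ∀ w ∈ U, Module.finrank ℝ (LinearMap.range (m w : V →ₗ[ℝ] W)) = r) {x : V}
    (hx : m z x = 0) :
    ∃ U' ⊆ U, IsOpen U' ∧ z ∈ U' ∧ ∃ k : E → V, ContDiffOn ℝ n k U' ∧ k z = x ∧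
      ∀ w ∈ U', m w (k w) = 0 := by
  set K : Submodule ℝ V := LinearMap.ker (m z : V →ₗ[ℝ] W) with hK
  set Rg : Submodule ℝ W := LinearMap.range (m z : V →ₗ[ℝ] W) with hRg
  obtain ⟨C, hC⟩ := K.exists_isCompl
  obtain ⟨C', hC'⟩ := Rg.exists_isCompl
  let π : W →L[ℝ] Rg := LinearMap.toContinuousLinearMap (Rg.projectionOnto C' hC')
  let ι : C →L[ℝ] V := C.subtypeL
  let A : E → C →L[ℝ] Rg := fun w => (π.comp (m w)).comp ι
  have hA : ContDiffOn ℝ n A U :=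
    (contDiffOn_const.clm_comp hm).clm_comp contDiffOn_const
  have hinj : Function.Injective (A z) := by
    rw [injective_iff_map_eq_zero]
    intro c hc
    have h1 : π (m z c) = ⟨m z c, LinearMap.mem_range_self _ _⟩ :=
      Submodule.projectionOnto_apply_left hC' ⟨m z c, LinearMap.mem_range_self _ _⟩
    have h2 : m z c = 0 := by
      have : π (m z c) = 0 := hc
      rw [h1] at this
      exact congrArg Subtype.val this
    have h3 : (c : V) ∈ K ⊓ C := ⟨h2, c.2⟩
    rw [hC.inf_eq_bot] at h3
    exact Subtype.ext h3
  have hdim : Module.finrank ℝ C = Module.finrank ℝ Rg := by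
    have h1 := Submodule.finrank_add_eq_of_isCompl hC
    have h2 := LinearMap.finrank_range_add_finrank_ker (m z : V →ₗ[ℝ] W)
    rw [← hK, ← hRg] at h2
    omega
  let e : C ≃L[ℝ] Rg := (LinearEquiv.ofInjectiveOfFinrankEq (A z : C →ₗ[ℝ] Rg) hinj
    hdim).toContinuousLinearEquiv
  have he : (e : C →L[ℝ] Rg) = A z := by ext1 c; rfl
  let U' : Set E := U ∩ A ⁻¹' (range ((↑) : (C ≃L[ℝ] Rg) → C →L[ℝ] Rg))
  have hU' : IsOpen U' := hA.continuousOn.isOpen_inter_preimage hU ContinuousLinearEquiv.isOpen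
  have hsub : U' ⊆ U := inter_subset_left
  refine ⟨U', hsub, hU', ⟨hz, e, he⟩,
    fun w => x - ι ((A w).inverse (π (m w x))), ?_, ?_, ?_⟩
  · have hinv : ContDiffOn ℝ n (fun w => (A w).inverse) U' := by
      rintro w ⟨hw, e', he'⟩
      have : ContDiffAt ℝ n (ContinuousLinearMap.inverse) (A w) := by
        rw [← he']; exact contDiffAt_map_inverse e'
      exact this.comp_contDiffWithinAt w ((hA w hw).mono hsub)
    exact contDiffOn_const.sub (ι.contDiff.comp_contDiffOn
      (hinv.clm_apply (π.contDiff.comp_contDiffOn ((hm.mono hsub).clm_apply contDiffOn_const))))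
  · simp [hx]
  · rintro w ⟨hw, e', he'⟩
    have hAinj : Function.Injective (A w) := by rw [← he']; exact e'.injective
    -- the kernel of `π ∘ m w` contains that of `m w` and has the same dimension
    have hker : LinearMap.ker (m w : V →ₗ[ℝ] W) = LinearMap.ker (π.comp (m w) : V →ₗ[ℝ] Rg) := by
      refine Submodule.eq_of_le_of_finrank_le ?_ ?_
      · intro v hv
        have : m w v = 0 := hv
        simp [this]
      · have h1 := LinearMap.finrank_range_add_finrank_ker (m w : V →ₗ[ℝ] W)
        have h2 := LinearMap.finrank_range_add_finrank_ker (π.comp (m w) : V →ₗ[ℝ] Rg)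
        have h3 : Module.finrank ℝ C ≤
            Module.finrank ℝ (LinearMap.range (π.comp (m w) : V →ₗ[ℝ] Rg)) := by
          rw [← LinearMap.finrank_range_of_inj (f := (A w : C →ₗ[ℝ] Rg)) hAinj]
          apply Submodule.finrank_mono
          rintro _ ⟨c, rfl⟩
          exact ⟨c, rfl⟩
        have h4 := hr w hw
        have h5 := hr z hz
        rw [← hRg] at h5
        omega
    have hmem : x - ι ((A w).inverse (π (m w x))) ∈ LinearMap.ker (π.comp (m w) : V →ₗ[ℝ] Rg) := by
      have h1 : A w ((A w).inverse (π (m w x))) = π (m w x) := by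
        rw [← he', ContinuousLinearMap.inverse_equiv]; simp
      have h2 : π (m w (ι ((A w).inverse (π (m w x))))) = π (m w x) := h1
      simp only [LinearMap.mem_ker, ContinuousLinearMap.coe_coe, ContinuousLinearMap.comp_apply,
        map_sub, h2, sub_self]
    rw [← hker] at hmem
    exact hmem

end Calculus

/-! ### Charts of the tangent bundle -/

section Charts

variable {D : ℕ} {Q : Type*} [TopologicalSpace Q] [ChartedSpace (Model D) Q]
  [IsManifold 𝓘(ℝ, Model D) ∞ Q]

/-- The preferred chart of `TQ` at `u₀`. -/
abbrev ch (u₀ : TQ D Q) : PartialEquiv (TQ D Q) (Model D × Model D) := extChartAt (TModel D) u₀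

/-- The preferred chart of `Q` below `u₀`. -/
abbrev chQ (u₀ : TQ D Q) : PartialEquiv Q (Model D) := extChartAt 𝓘(ℝ, Model D) u₀.proj

/-- The differential at `w` of the preferred chart of `TQ` at `u₀`. -/
def toModel (u₀ w : TQ D Q) : T w →L[ℝ] (Model D × Model D) :=
  mfderiv (TModel D) 𝓘(ℝ, Model D × Model D) (ch u₀) w

/-- The differential at `z` of the inverse of the preferred chart of `TQ` at `u₀`. -/
def ofModel (u₀ : TQ D Q) (z : Model D × Model D) : (Model D × Model D) →L[ℝ] T ((ch u₀).symm z) :=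
  mfderiv 𝓘(ℝ, Model D × Model D) (TModel D) (ch u₀).symm z

/-- The differential at `p` of the preferred chart of `Q` below `u₀`. -/
def toModelQ (u₀ : TQ D Q) (p : Q) : TangentSpace 𝓘(ℝ, Model D) p →L[ℝ] Model D :=
  mfderiv 𝓘(ℝ, Model D) 𝓘(ℝ, Model D) (chQ u₀) p

/-- The components of a vector field in the preferred chart at `u₀`. -/
def rep (u₀ : TQ D Q) (X : VField D Q) (z : Model D × Model D) : Model D × Model D :=
  toModel u₀ ((ch u₀).symm z) (X ((ch u₀).symm z))

variable {u₀ : TQ D Q} {z : Model D × Model D} {P : Set (TQ D Q)}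

theorem exists_chart_symm_eq {w : TQ D Q} (hw : w ∈ (ch u₀).source) :
    ∃ z ∈ (ch u₀).target, (ch u₀).symm z = w :=
  ⟨ch u₀ w, (ch u₀).map_source hw, (ch u₀).left_inv hw⟩

theorem toModel_ofModel (hz : z ∈ (ch u₀).target) (x : Model D × Model D) :
    toModel u₀ ((ch u₀).symm z) (ofModel u₀ z x) = x := by
  have h := mfderiv_extChartAt_comp_mfderivWithin_extChartAt_symm (I := TModel D) hz
  rw [ModelWithCorners.Boundaryless.range_eq_univ, mfderivWithin_univ] at h
  exact DFunLike.congr_fun h x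

theorem ofModel_toModel (hz : z ∈ (ch u₀).target) (x : T ((ch u₀).symm z)) :
    ofModel u₀ z (toModel u₀ ((ch u₀).symm z) x) = x := by
  have h := mfderivWithin_extChartAt_symm_comp_mfderiv_extChartAt (I := TModel D) hz
  rw [ModelWithCorners.Boundaryless.range_eq_univ, mfderivWithin_univ] at h
  exact DFunLike.congr_fun h x

theorem isInvertible_ofModel (hz : z ∈ (ch u₀).target) : (ofModel u₀ z).IsInvertible := by
  have h := isInvertible_mfderivWithin_extChartAt_symm (I := TModel D) hz
  rwa [ModelWithCorners.Boundaryless.range_eq_univ, mfderivWithin_univ] at h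

theorem isInvertible_toModel {w : TQ D Q} (hw : w ∈ (ch u₀).source) :
    (toModel u₀ w).IsInvertible :=
  isInvertible_mfderiv_extChartAt (I := TModel D) hw

theorem rep_eq_mpullback (hz : z ∈ (ch u₀).target) (X : VField D Q) :
    rep u₀ X z = mpullback 𝓘(ℝ, Model D × Model D) (TModel D) (ch u₀).symm X z := by
  obtain ⟨e, he⟩ := isInvertible_ofModel hz
  have h1 : mpullback 𝓘(ℝ, Model D × Model D) (TModel D) (ch u₀).symm X z =
      (ofModel u₀ z).inverse (X ((ch u₀).symm z)) := rfl
  rw [h1, ← he, ContinuousLinearMap.inverse_equiv, rep]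
  have h2 := ofModel_toModel hz (X ((ch u₀).symm z))
  rw [← he] at h2
  exact (e.eq_symm_apply.2 h2)

theorem contMDiffAt_chart_symm {n : WithTop ℕ∞} [IsManifold (TModel D) n (TQ D Q)]
    (hz : z ∈ (ch u₀).target) :
    ContMDiffAt 𝓘(ℝ, Model D × Model D) (TModel D) n (ch u₀).symm z :=
  (contMDiffOn_extChartAt_symm u₀).contMDiffAt ((isOpen_extChartAt_target u₀).mem_nhds hz)

theorem target_eventually (hz : z ∈ (ch u₀).target) : ∀ᶠ y in 𝓝 z, y ∈ (ch u₀).target :=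
  (isOpen_extChartAt_target u₀).mem_nhds hz

theorem tendsto_chart_symm (hz : z ∈ (ch u₀).target) :
    Tendsto (ch u₀).symm (𝓝 z) (𝓝 ((ch u₀).symm z)) :=
  continuousAt_extChartAt_symm'' hz

/-- The part of the chart domain at `u₀` that is mapped into `P`. -/
def dom (u₀ : TQ D Q) (P : Set (TQ D Q)) : Set (Model D × Model D) :=
  (ch u₀).target ∩ (ch u₀).symm ⁻¹' P

theorem isOpen_dom (hP : IsOpen P) : IsOpen (dom u₀ P) :=
  (continuousOn_extChartAt_symm u₀).isOpen_inter_preimage (isOpen_extChartAt_target u₀) hP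

theorem dom_eventually (hP : IsOpen P) (hz : z ∈ dom u₀ P) : ∀ᶠ y in 𝓝 z, y ∈ dom u₀ P :=
  (isOpen_dom hP).mem_nhds hz

theorem mem_dom_self {u : TQ D Q} (hu : u ∈ P) : ch u u ∈ dom u P :=
  ⟨mem_extChartAt_target u, by rwa [mem_preimage, extChartAt_to_inv]⟩

theorem SmoothField.contMDiffAt {X : VField D Q} (hX : SmoothField P X) (hP : IsOpen P)
    {u : TQ D Q} (hu : u ∈ P) :
    ContMDiffAt (TModel D) (TModel D).tangent ∞
      (fun u => (⟨u, X u⟩ : TangentBundle (TModel D) (TQ D Q))) u :=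
  ContMDiffOn.contMDiffAt hX (hP.mem_nhds hu)

theorem SmoothField.mdifferentiableAt {X : VField D Q} (hX : SmoothField P X) (hP : IsOpen P)
    {u : TQ D Q} (hu : u ∈ P) :
    MDifferentiableAt (TModel D) (TModel D).tangent
      (fun u => (⟨u, X u⟩ : TangentBundle (TModel D) (TQ D Q))) u :=
  (hX.contMDiffAt hP hu).mdifferentiableAt (by simp)

theorem contDiffAt_rep {X : VField D Q} (hP : IsOpen P) (hX : SmoothField P X)
    (hz : z ∈ dom u₀ P) : ContDiffAt ℝ ∞ (rep u₀ X) z := by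
  have h := ContMDiffAt.mpullback_vectorField_preimage (m := ∞) (n := ∞)
    (hX.contMDiffAt hP hz.2) (contMDiffAt_chart_symm hz.1) (isInvertible_ofModel hz.1) (by simp)
  have h2 := contMDiffAt_vectorSpace_iff_contDiffAt.1 h
  refine h2.congr_of_eventuallyEq ?_
  filter_upwards [target_eventually hz.1] with y hy using rep_eq_mpullback hy X

theorem contDiffAt_comp_chart_symm {F : Type*} [NormedAddCommGroup F] [NormedSpace ℝ F]
    {f : TQ D Q → F} (hz : z ∈ (ch u₀).target)
    (hf : ContMDiffAt (TModel D) 𝓘(ℝ, F) ∞ f ((ch u₀).symm z)) :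
    ContDiffAt ℝ ∞ (f ∘ (ch u₀).symm) z :=
  contMDiffAt_iff_contDiffAt.1 (hf.comp z (contMDiffAt_chart_symm hz))

theorem SmoothFun.contDiffAt {f : TQ D Q → ℝ} (hf : SmoothFun P f) (hP : IsOpen P)
    (hz : z ∈ dom u₀ P) : ContDiffAt ℝ ∞ (f ∘ (ch u₀).symm) z :=
  contDiffAt_comp_chart_symm hz.1 (ContMDiffOn.contMDiffAt hf (hP.mem_nhds hz.2))

theorem mdifferentiableAt_chart (hz : z ∈ (ch u₀).target) :
    MDifferentiableAt (TModel D) 𝓘(ℝ, Model D × Model D) (ch u₀) ((ch u₀).symm z) := by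
  apply mdifferentiableAt_extChartAt
  have := (ch u₀).map_target hz
  rwa [extChartAt_source] at this

/-- No differentiability is assumed: both sides have the value `0` at the points where `f` is not
differentiable. -/
theorem mfderiv_eq_fderiv_chart {F : Type*} [NormedAddCommGroup F] [NormedSpace ℝ F]
    (f : TQ D Q → F) (hz : z ∈ (ch u₀).target) (x : T ((ch u₀).symm z)) :
    mfderiv (TModel D) 𝓘(ℝ, F) f ((ch u₀).symm z) x =
      fderiv ℝ (f ∘ (ch u₀).symm) z (toModel u₀ _ x) := by
  by_cases hf : MDifferentiableAt (TModel D) 𝓘(ℝ, F) f ((ch u₀).symm z)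
  · rw [← mfderiv_eq_fderiv, mfderiv_comp z hf
      ((contMDiffAt_chart_symm (n := 1) hz).mdifferentiableAt (by simp))]
    conv_lhs => rw [← ofModel_toModel hz x]
    rfl
  · have hf' : ¬ DifferentiableAt ℝ (f ∘ (ch u₀).symm) z := by
      intro h
      apply hf
      have h1 : MDifferentiableAt 𝓘(ℝ, Model D × Model D) 𝓘(ℝ, F) (f ∘ (ch u₀).symm)
          (ch u₀ ((ch u₀).symm z)) := by
        rw [(ch u₀).right_inv hz]; exact mdifferentiableAt_iff_differentiableAt.2 h
      refine (h1.comp _ (mdifferentiableAt_chart hz)).congr_of_eventuallyEq ?_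
      filter_upwards [extChartAt_source_mem_nhds' (I := TModel D) ((ch u₀).map_target hz)] with w hw
      simp only [Function.comp_apply]
      rw [(ch u₀).left_inv hw]
    rw [mfderiv_zero_of_not_mdifferentiableAt hf, fderiv_zero_of_not_differentiableAt hf']
    rfl

theorem diff_chart (f : TQ D Q → ℝ) (hz : z ∈ (ch u₀).target) (x : T ((ch u₀).symm z)) :
    diff f ((ch u₀).symm z) x = fderiv ℝ (f ∘ (ch u₀).symm) z (toModel u₀ _ x) :=
  mfderiv_eq_fderiv_chart f hz x

theorem act_chart (X : VField D Q) (f : TQ D Q → ℝ) (hz : z ∈ (ch u₀).target) :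
    act X f ((ch u₀).symm z) = fderiv ℝ (f ∘ (ch u₀).symm) z (rep u₀ X z) :=
  diff_chart f hz _

theorem bracket_chart {X Y : VField D Q} (hP : IsOpen P) (hX : SmoothField P X)
    (hY : SmoothField P Y) (hz : z ∈ dom u₀ P) :
    rep u₀ (bracket X Y) z = lieBracket ℝ (rep u₀ X) (rep u₀ Y) z := by
  rw [rep_eq_mpullback hz.1]
  have : IsManifold (TModel D) (minSmoothness ℝ 2) (TQ D Q) := by
    rw [minSmoothness_of_isRCLikeNormedField]; infer_instance
  have h := mpullback_mlieBracket (n := 2) (hX.mdifferentiableAt hP hz.2)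
    (hY.mdifferentiableAt hP hz.2) (contMDiffAt_chart_symm hz.1) (by simp)
  refine h.trans ?_
  rw [← mlieBracketWithin_univ, mlieBracketWithin_eq_lieBracketWithin]
  refine (congrFun lieBracketWithin_univ z).trans ?_
  have e : ∀ X : VField D Q, rep u₀ X =ᶠ[𝓝 z]
      mpullback 𝓘(ℝ, Model D × Model D) (TModel D) (ch u₀).symm X := fun X => by
    filter_upwards [target_eventually hz.1] with y hy using rep_eq_mpullback hy X
  exact ((e X).symm.lieBracket_vectorField_eq (e Y).symm)

/-! ### The structure of the tangent bundle in a chart -/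

theorem mem_source_iff {w : TQ D Q} : w ∈ (ch u₀).source ↔ w.proj ∈ (chQ u₀).source := by
  rw [extChartAt_source, extChartAt_source]
  exact TangentBundle.mem_chart_source_iff _ _

theorem chart_apply {w : TQ D Q} (hw : w ∈ (ch u₀).source) :
    ch u₀ w = (chQ u₀ w.proj, toModelQ u₀ w.proj w.snd) := by
  have hw' : w.proj ∈ (chartAt (Model D) u₀.proj).source := by
    have := mem_source_iff.1 hw
    rwa [extChartAt_source] at this
  have h := TangentBundle.continuousLinearMapAt_trivializationAt (I := 𝓘(ℝ, Model D)) hw'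
  rw [TangentBundle.continuousLinearMapAt_trivializationAt_eq_core hw'] at h
  have h2 : toModelQ u₀ w.proj w.snd = (tangentBundleCore 𝓘(ℝ, Model D) Q).coordChange
      (achart (Model D) w.proj) (achart (Model D) u₀.proj) w.proj w.snd :=
    (DFunLike.congr_fun h w.snd).symm
  rw [h2]
  rfl

/-- The projection `τ` is the first projection in the charts. -/
theorem toModel_fst (hz : z ∈ (ch u₀).target) (x : T ((ch u₀).symm z)) :
    (toModel u₀ _ x).1 = toModelQ u₀ _ (tangentProj _ x) := by
  have hs : (ch u₀).symm z ∈ (ch u₀).source := (ch u₀).map_target hz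
  have hp : ((ch u₀).symm z).proj ∈ (chartAt (Model D) u₀.proj).source := by
    have := mem_source_iff.1 hs
    rwa [extChartAt_source] at this
  have h1 : HasMFDerivAt (TModel D) 𝓘(ℝ, Model D) (Prod.fst ∘ ch u₀) ((ch u₀).symm z)
      ((ContinuousLinearMap.fst ℝ (Model D) (Model D)).comp (toModel u₀ _)) :=
    HasMFDerivAt.comp ((ch u₀).symm z) (I' := 𝓘(ℝ, Model D × Model D)) (g := Prod.fst)
      (ContinuousLinearMap.fst ℝ (Model D) (Model D)).hasFDerivAt.hasMFDerivAt
      (mdifferentiableAt_chart hz).hasMFDerivAt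
  have h2 : HasMFDerivAt (TModel D) 𝓘(ℝ, Model D) (chQ u₀ ∘ fun w : TQ D Q => w.proj)
      ((ch u₀).symm z) ((toModelQ u₀ _).comp (tangentProj _)) :=
    (mdifferentiableAt_extChartAt hp).hasMFDerivAt.comp ((ch u₀).symm z)
      ((Bundle.contMDiff_proj (n := 1) (TangentSpace 𝓘(ℝ, Model D))).mdifferentiableAt
        (by simp)).hasMFDerivAt
  have h3 : (Prod.fst ∘ ch u₀) =ᶠ[𝓝 ((ch u₀).symm z)] (chQ u₀ ∘ fun w : TQ D Q => w.proj) := by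
    filter_upwards [extChartAt_source_mem_nhds' (I := TModel D) hs] with w hw
    rw [Function.comp_apply, chart_apply hw]
    rfl
  have h4 := h2.congr_of_eventuallyEq h3
  exact DFunLike.congr_fun (hasMFDerivAt_unique h1 h4) x

theorem toModelQ_bijective {p : Q} (hp : p ∈ (chQ u₀).source) :
    Function.Bijective (toModelQ u₀ p) := by
  obtain ⟨e, he⟩ := isInvertible_mfderiv_extChartAt (I := 𝓘(ℝ, Model D)) hp
  have : ∀ v, toModelQ u₀ p v = e v := fun v => (DFunLike.congr_fun he v).symm
  exact (funext this : (toModelQ u₀ p : _ → Model D) = e) ▸ e.bijective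

theorem mem_vertical_iff (hz : z ∈ (ch u₀).target) (x : T ((ch u₀).symm z)) :
    x ∈ vertical ((ch u₀).symm z) ↔ (toModel u₀ _ x).1 = 0 := by
  rw [toModel_fst hz]
  have hp : ((ch u₀).symm z).proj ∈ (chQ u₀).source := mem_source_iff.1 ((ch u₀).map_target hz)
  constructor
  · intro h
    have : tangentProj _ x = 0 := h
    rw [this, map_zero]
  · intro h
    have : tangentProj _ x = 0 := (toModelQ_bijective hp).1 (by rw [h, map_zero])
    exact this

end Charts

/-! ### The Lagrangian structures in a chart -/

section LagrangianCharts

variable {D : ℕ} {Q : Type*} [TopologicalSpace Q] [ChartedSpace (Model D) Q]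
  [IsManifold 𝓘(ℝ, Model D) ∞ Q]

/-- The Cartan one-form `(∂ℓ/∂v^a) dq^a` of a function `ℓ(q, v)`. -/
def thetaM {D : ℕ} (ℓ : Model D × Model D → ℝ) (z : Model D × Model D) :
    (Model D × Model D) →L[ℝ] ℝ :=
  ((fderiv ℝ ℓ z).comp (ContinuousLinearMap.inr ℝ (Model D) (Model D))).comp
    (ContinuousLinearMap.fst ℝ (Model D) (Model D))

theorem thetaM_apply {ℓ : Model D × Model D → ℝ} {z x : Model D × Model D} :
    thetaM ℓ z x = fderiv ℝ ℓ z (0, x.1) := rfl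

theorem contDiffAt_thetaM {ℓ : Model D × Model D → ℝ} {z : Model D × Model D}
    (h : ContDiffAt ℝ ∞ ℓ z) : ContDiffAt ℝ ∞ (thetaM ℓ) z :=
  ((h.fderiv_right (m := ∞) (by simp)).clm_comp contDiffAt_const).clm_comp contDiffAt_const

theorem negCurl_thetaM {ℓ : Model D × Model D → ℝ} {z : Model D × Model D}
    (h : ContDiffAt ℝ ∞ ℓ z) (x y : Model D × Model D) :
    negCurl (thetaM ℓ) z x y =
      fderiv ℝ (fderiv ℝ ℓ) z y (0, x.1) - fderiv ℝ (fderiv ℝ ℓ) z x (0, y.1) := by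
  have h1 : DifferentiableAt ℝ (fderiv ℝ ℓ) z :=
    (h.fderiv_right (m := ∞) (by simp)).differentiableAt (by simp)
  have key : ∀ x y : Model D × Model D,
      fderiv ℝ (thetaM ℓ) z x y = fderiv ℝ (fderiv ℝ ℓ) z x (0, y.1) := by
    intro x y
    have h2 := ((h1.hasFDerivAt.clm_comp (hasFDerivAt_const
      (ContinuousLinearMap.inr ℝ (Model D) (Model D)) z)).clm_comp (hasFDerivAt_const
      (ContinuousLinearMap.fst ℝ (Model D) (Model D)) z))
    have h3 : fderiv ℝ (thetaM ℓ) z = _ := h2.fderiv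
    rw [h3]
    simp
  rw [negCurl, key, key]
  ring

variable {u₀ : TQ D Q} {z : Model D × Model D} {P : Set (TQ D Q)} {L : TQ D Q → ℝ}

/-- The restriction of `L` to a fibre of `TQ`, in the chart: the fibre coordinate is changed by the
linear map `toModelQ`. -/
theorem lagrangian_fibre_eq {p : Q} (hp : p ∈ (chQ u₀).source) (w : Model D) :
    L ⟨p, w⟩ = (L ∘ (ch u₀).symm) (chQ u₀ p, toModelQ u₀ p w) := by
  have hs : (⟨p, w⟩ : TQ D Q) ∈ (ch u₀).source := mem_source_iff.2 hp
  have h := chart_apply hs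
  rw [Function.comp_apply, ← (ch u₀).left_inv hs, h, ← h, (ch u₀).left_inv hs]

theorem chart_apply_symm (hz : z ∈ (ch u₀).target) :
    z = (chQ u₀ ((ch u₀).symm z).proj, toModelQ u₀ _ ((ch u₀).symm z).snd) := by
  rw [← chart_apply ((ch u₀).map_target hz), (ch u₀).right_inv hz]

theorem fderiv_comp_affine {ℓ : Model D × Model D → ℝ} {C : Model D →L[ℝ] Model D}
    {q v : Model D} (h : DifferentiableAt ℝ ℓ (q, C v)) :
    fderiv ℝ (fun w => ℓ (q, C w)) v =
      (fderiv ℝ ℓ (q, C v)).comp ((ContinuousLinearMap.inr ℝ (Model D) (Model D)).comp C) := by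
  have h1 : HasFDerivAt (fun w => (q, C w))
      ((ContinuousLinearMap.inr ℝ (Model D) (Model D)).comp C) v :=
    (hasFDerivAt_const q v).prodMk C.hasFDerivAt
  exact (HasFDerivAt.comp (f := fun w => (q, C w)) v h.hasFDerivAt h1).fderiv

theorem fderiv_fderiv_comp_affine {ℓ : Model D × Model D → ℝ} {C : Model D →L[ℝ] Model D}
    {q v : Model D} (h : ContDiffAt ℝ ∞ ℓ (q, C v)) (x y : Model D) :
    fderiv ℝ (fderiv ℝ (fun w => ℓ (q, C w))) v x y =
      fderiv ℝ (fderiv ℝ ℓ) (q, C v) (0, C x) (0, C y) := by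
  have h1 : HasFDerivAt (fun w => (q, C w))
      ((ContinuousLinearMap.inr ℝ (Model D) (Model D)).comp C) v :=
    (hasFDerivAt_const q v).prodMk C.hasFDerivAt
  have hev : fderiv ℝ (fun w => ℓ (q, C w)) =ᶠ[𝓝 v] fun w =>
      (fderiv ℝ ℓ (q, C w)).comp ((ContinuousLinearMap.inr ℝ (Model D) (Model D)).comp C) := by
    have h2 : ∀ᶠ w in 𝓝 (q, C v), DifferentiableAt ℝ ℓ w := by
      filter_upwards [(h.of_le (m := 1) ENat.LEInfty.out).eventually (by simp)] with w hw
      exact hw.differentiableAt (by simp)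
    filter_upwards [h1.continuousAt.eventually h2] with w hw using fderiv_comp_affine hw
  have h3 : HasFDerivAt (fderiv ℝ ℓ) (fderiv ℝ (fderiv ℝ ℓ) (q, C v)) (q, C v) :=
    ((h.fderiv_right (m := ∞) (by simp)).differentiableAt (by simp)).hasFDerivAt
  have h4 := (HasFDerivAt.comp (f := fun w => (q, C w)) v h3 h1).clm_comp
    (hasFDerivAt_const ((ContinuousLinearMap.inr ℝ (Model D) (Model D)).comp C) v)
  rw [hev.fderiv_eq]
  refine (congrArg (fun T : Model D →L[ℝ] Model D →L[ℝ] ℝ => T x y) h4.fderiv).trans ?_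
  simp

theorem fibreDeriv_chart (hP : IsOpen P) (hL : SmoothFun P L) (hz : z ∈ dom u₀ P) (y : Model D) :
    fibreDeriv L ((ch u₀).symm z) y =
      fderiv ℝ (L ∘ (ch u₀).symm) z (0, toModelQ u₀ ((ch u₀).symm z).proj y) := by
  set p := ((ch u₀).symm z).proj with hpdef
  let C : Model D →L[ℝ] Model D := toModelQ u₀ p
  let v : Model D := ((ch u₀).symm z).snd
  have hp : p ∈ (chQ u₀).source := mem_source_iff.1 ((ch u₀).map_target hz.1)
  have hzeq : z = (chQ u₀ p, C v) := chart_apply_symm hz.1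
  have h1 : (fun w : Model D => L ⟨p, w⟩) =
      fun w => (L ∘ (ch u₀).symm) (chQ u₀ p, C w) := funext fun w => lagrangian_fibre_eq hp w
  have h2 := (hL.contDiffAt hP hz).differentiableAt (by simp)
  rw [hzeq] at h2
  have h3 := fderiv_comp_affine h2
  rw [← h1, ← hzeq] at h3
  exact DFunLike.congr_fun h3 y

theorem fibreHessian_chart (hP : IsOpen P) (hL : SmoothFun P L) (hz : z ∈ dom u₀ P)
    (x y : Model D) :
    fibreHessian L ((ch u₀).symm z) x y =
      fderiv ℝ (fderiv ℝ (L ∘ (ch u₀).symm)) z (0, toModelQ u₀ ((ch u₀).symm z).proj x)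
        (0, toModelQ u₀ ((ch u₀).symm z).proj y) := by
  set p := ((ch u₀).symm z).proj with hpdef
  let C : Model D →L[ℝ] Model D := toModelQ u₀ p
  let v : Model D := ((ch u₀).symm z).snd
  have hp : p ∈ (chQ u₀).source := mem_source_iff.1 ((ch u₀).map_target hz.1)
  have hzeq : z = (chQ u₀ p, C v) := chart_apply_symm hz.1
  have h1 : (fun w : Model D => L ⟨p, w⟩) =
      fun w => (L ∘ (ch u₀).symm) (chQ u₀ p, C w) := funext fun w => lagrangian_fibre_eq hp w
  have h2 := hL.contDiffAt hP hz
  rw [hzeq] at h2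
  have h3 := fderiv_fderiv_comp_affine h2 x y
  rw [← h1, ← hzeq] at h3
  exact h3

theorem theta_chart (hP : IsOpen P) (hL : SmoothFun P L) (hz : z ∈ dom u₀ P)
    (x : T ((ch u₀).symm z)) :
    theta L ((ch u₀).symm z) x = thetaM (L ∘ (ch u₀).symm) z (toModel u₀ _ x) := by
  rw [thetaM_apply, toModel_fst hz.1]
  exact fibreDeriv_chart hP hL hz _

theorem energy_chart (hP : IsOpen P) (hL : SmoothFun P L) (hz : z ∈ dom u₀ P) :
    energy L ((ch u₀).symm z) =
      fderiv ℝ (L ∘ (ch u₀).symm) z (0, z.2) - (L ∘ (ch u₀).symm) z := by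
  have h : z.2 = toModelQ u₀ ((ch u₀).symm z).proj ((ch u₀).symm z).snd :=
    congrArg Prod.snd (chart_apply_symm hz.1)
  rw [h]
  exact congrArg (· - L ((ch u₀).symm z)) (fibreDeriv_chart hP hL hz _)

/-- `Ω_L` in an arbitrary preferred chart: the exterior derivative commutes with the change of
charts. -/
theorem Omega_eq_negCurl (hP : IsOpen P) (hL : SmoothFun P L) {w : TQ D Q}
    (hws : w ∈ (ch u₀).source) (hwP : w ∈ P) (x y : T w) :
    Omega L w x y =
      negCurl (thetaM (L ∘ (ch u₀).symm)) (ch u₀ w) (toModel u₀ w x) (toModel u₀ w y) := by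
  set ψ : Model D × Model D → Model D × Model D := ch u₀ ∘ (ch w).symm with hψ
  have ht : ch w w ∈ dom w P := mem_dom_self hwP
  have hinv : (ch w).symm (ch w w) = w := extChartAt_to_inv w
  have hψw : ψ (ch w w) = ch u₀ w := by rw [hψ, Function.comp_apply, hinv]
  have hz : ch u₀ w ∈ dom u₀ P :=
    ⟨(ch u₀).map_source hws, by rwa [mem_preimage, (ch u₀).left_inv hws]⟩
  -- near `w` both charts are defined
  have hev : ∀ᶠ y in 𝓝 (ch w w), y ∈ dom w P ∧ (ch w).symm y ∈ (ch u₀).source := by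
    refine (dom_eventually hP ht).and ?_
    have := (tendsto_chart_symm ht.1)
    rw [hinv] at this
    exact this.eventually (extChartAt_source_mem_nhds' (I := TModel D) hws)
  have hψd : ContDiffAt ℝ ∞ ψ (ch w w) := by
    refine contDiffAt_comp_chart_symm ht.1 ?_
    rw [hinv]
    exact contMDiffAt_extChartAt' (by rwa [extChartAt_source] at hws)
  have hco : coeffs (theta L) w =ᶠ[𝓝 (ch w w)]
      fun y => (thetaM (L ∘ (ch u₀).symm) (ψ y)).comp (fderiv ℝ ψ y) := by
    filter_upwards [hev] with y ⟨hy, hys⟩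
    refine ContinuousLinearMap.ext fun v => ?_
    have h1 : fderiv ℝ ψ y v = toModel u₀ _ (ofModel w y v) := by
      have := mfderiv_eq_fderiv_chart (ch u₀) hy.1 (ofModel w y v)
      rw [toModel_ofModel hy.1] at this
      exact this.symm
    have h2 : ∀ q : TQ D Q, q ∈ (ch u₀).source → q ∈ P → ∀ v : T q,
        theta L q v = thetaM (L ∘ (ch u₀).symm) (ch u₀ q) (toModel u₀ q v) := by
      intro q hq hqP v
      obtain ⟨y', hy', rfl⟩ := exists_chart_symm_eq hq
      rw [(ch u₀).right_inv hy']
      exact theta_chart hP hL ⟨hy', hqP⟩ v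
    rw [ContinuousLinearMap.comp_apply, h1]
    exact h2 _ hys hy.2 _
  have hfd : ∀ v : T w, fderiv ℝ ψ (ch w w) (toModel w w v) = toModel u₀ w v := by
    intro v
    have h3 : ∀ q : TQ D Q, q ∈ (ch w).source → ∀ v : T q,
        mfderiv (TModel D) 𝓘(ℝ, Model D × Model D) (ch u₀) q v =
          fderiv ℝ ψ (ch w q) (toModel w q v) := by
      intro q hq v
      obtain ⟨y', hy', rfl⟩ := exists_chart_symm_eq hq
      rw [(ch w).right_inv hy']
      exact mfderiv_eq_fderiv_chart (ch u₀) hy' v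
    exact (h3 w (mem_extChartAt_source w) v).symm
  have ha : DifferentiableAt ℝ (thetaM (L ∘ (ch u₀).symm)) (ψ (ch w w)) := by
    rw [hψw]
    exact (contDiffAt_thetaM (hL.contDiffAt hP hz)).differentiableAt (by simp)
  have hp := negCurl_pullback ha (hψd.of_le ENat.LEInfty.out) (toModel w w x) (toModel w w y)
  rw [hfd, hfd, hψw] at hp
  rw [← hp, Omega, extDer, negCurl, hco.fderiv_eq]
  rfl

theorem Omega_chart (hP : IsOpen P) (hL : SmoothFun P L) (hz : z ∈ dom u₀ P)
    (x y : T ((ch u₀).symm z)) :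
    Omega L ((ch u₀).symm z) x y =
      negCurl (thetaM (L ∘ (ch u₀).symm)) z (toModel u₀ _ x) (toModel u₀ _ y) := by
  have h := Omega_eq_negCurl hP hL ((ch u₀).map_target hz.1) hz.2 x y
  rwa [(ch u₀).right_inv hz.1] at h

theorem mem_kerOmega_iff (hP : IsOpen P) (hL : SmoothFun P L) (hz : z ∈ dom u₀ P)
    (x : T ((ch u₀).symm z)) :
    x ∈ kerOmega L ((ch u₀).symm z) ↔
      ∀ y, negCurl (thetaM (L ∘ (ch u₀).symm)) z (toModel u₀ _ x) y = 0 := by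
  constructor
  · intro h y
    have := h (ofModel u₀ z y)
    rwa [Omega_chart hP hL hz, toModel_ofModel hz.1] at this
  · intro h y
    rw [Omega_chart hP hL hz]
    exact h _

end LagrangianCharts

/-! ### Derivations, brackets and the kernel of the Lagrangian two-form -/

section Geometry

variable {D : ℕ} {Q : Type*} [TopologicalSpace Q] [ChartedSpace (Model D) Q]
  [IsManifold 𝓘(ℝ, Model D) ∞ Q]
variable {P : Set (TQ D Q)} {L : TQ D Q → ℝ} {u : TQ D Q}

theorem exists_dom (hu : u ∈ P) : ∃ u₀ : TQ D Q, ∃ z ∈ dom u₀ P, (ch u₀).symm z = u :=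
  ⟨u, ch u u, mem_dom_self hu, extChartAt_to_inv u⟩

/-! ### Functions and fields on `P` -/

theorem SmoothFun.mdifferentiableAt {f : TQ D Q → ℝ} (hf : SmoothFun P f) (hP : IsOpen P)
    (hu : u ∈ P) : MDifferentiableAt (TModel D) 𝓘(ℝ, ℝ) f u :=
  (ContMDiffOn.contMDiffAt hf (hP.mem_nhds hu)).mdifferentiableAt (by simp)

theorem smoothFun_of_chart {f : TQ D Q → ℝ}
    (h : ∀ u₀ : TQ D Q, ∀ z ∈ dom u₀ P, ContDiffAt ℝ ∞ (f ∘ (ch u₀).symm) z) : SmoothFun P f := by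
  intro u hu
  have h1 := (h u _ (mem_dom_self hu)).contMDiffAt.comp u (contMDiffAt_extChartAt (I := TModel D))
  refine ContMDiffAt.contMDiffWithinAt (h1.congr_of_eventuallyEq ?_)
  filter_upwards [extChartAt_source_mem_nhds (I := TModel D) u] with w hw
  simp only [Function.comp_apply]
  rw [(ch u).left_inv hw]

theorem SmoothFun.act {f : TQ D Q → ℝ} {X : VField D Q} (hP : IsOpen P) (hX : SmoothField P X)
    (hf : SmoothFun P f) : SmoothFun P (act X f) := by
  refine smoothFun_of_chart fun u₀ z hz => ?_
  have h : ContDiffAt ℝ ∞ (fun y => fderiv ℝ (f ∘ (ch u₀).symm) y (rep u₀ X y)) z :=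
    ((hf.contDiffAt hP hz).fderiv_right (m := ∞) (by simp)).clm_apply (contDiffAt_rep hP hX hz)
  refine h.congr_of_eventuallyEq ?_
  filter_upwards [target_eventually hz.1] with y hy using act_chart X f hy

theorem SmoothFun.sum_mul {N : ℕ} {f g : Fin N → TQ D Q → ℝ} (hf : ∀ n, SmoothFun P (f n))
    (hg : ∀ n, SmoothFun P (g n)) : SmoothFun P (fun w => ∑ n, f n w * g n w) := by
  exact contMDiffOn_finsetSum (t := Finset.univ) fun n _ => ContMDiffOn.mul (hf n) (hg n)

theorem SmoothFun.congr {f g : TQ D Q → ℝ} (hf : SmoothFun P f) (h : ∀ w ∈ P, g w = f w) :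
    SmoothFun P g :=
  ContMDiffOn.congr hf h

theorem SmoothField.congr {X Y : VField D Q} (hX : SmoothField P X) (h : ∀ w ∈ P, Y w = X w) :
    SmoothField P Y :=
  ContMDiffOn.congr hX fun w hw => by rw [h w hw]

theorem SmoothField.add {X Y : VField D Q} (hX : SmoothField P X) (hY : SmoothField P Y) :
    SmoothField P (fun w => X w + Y w) :=
  ContMDiffOn.add_section hX hY

theorem SmoothField.smul {f : TQ D Q → ℝ} {X : VField D Q} (hf : SmoothFun P f)
    (hX : SmoothField P X) : SmoothField P (fun w => f w • X w) :=
  ContMDiffOn.smul_section hf hX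

theorem SmoothField.sum_smul {N : ℕ} {f : Fin N → TQ D Q → ℝ} {X : Fin N → VField D Q}
    (hf : ∀ n, SmoothFun P (f n)) (hX : ∀ n, SmoothField P (X n)) :
    SmoothField P (fun w => ∑ n, f n w • X n w) :=
  ContMDiffOn.sum_section fun n _ => SmoothField.smul (hf n) (hX n)

theorem eventuallyEq_of_eqOn {α : TQ D Q → Type*} {f g : (w : TQ D Q) → α w} (hP : IsOpen P)
    (hu : u ∈ P) (h : ∀ w ∈ P, f w = g w) : ∀ᶠ w in 𝓝 u, f w = g w := by
  filter_upwards [hP.mem_nhds hu] with w hw using h w hw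

theorem diff_congr {f g : TQ D Q → ℝ} (hP : IsOpen P) (hu : u ∈ P) (h : ∀ w ∈ P, f w = g w) :
    diff f u = diff g u :=
  Filter.EventuallyEq.mfderiv_eq (eventuallyEq_of_eqOn hP hu h)

theorem bracket_congr {X X' Y Y' : VField D Q} (hP : IsOpen P) (hu : u ∈ P)
    (h : ∀ w ∈ P, X w = X' w) (h' : ∀ w ∈ P, Y w = Y' w) : bracket X Y u = bracket X' Y' u :=
  Filter.EventuallyEq.mlieBracket_vectorField_eq (eventuallyEq_of_eqOn hP hu h)
    (eventuallyEq_of_eqOn hP hu h')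

theorem diff_sum_mul {N : ℕ} {f g : Fin N → TQ D Q → ℝ}
    (hf : ∀ n, MDifferentiableAt (TModel D) 𝓘(ℝ, ℝ) (f n) u)
    (hg : ∀ n, MDifferentiableAt (TModel D) 𝓘(ℝ, ℝ) (g n) u) (v : T u) :
    diff (fun w => ∑ n, f n w * g n w) u v =
      ∑ n, (f n u * diff (g n) u v + g n u * diff (f n) u v) := by
  have h1 := HasMFDerivAt.sum (t := Finset.univ) (z := u) fun n _ =>
    (hf n).hasMFDerivAt.mul (hg n).hasMFDerivAt
  have h2 : (fun w => ∑ n, f n w * g n w) = ∑ n, f n * g n := by ext w; simp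
  rw [diff, h2, h1.mfderiv]
  rw [sum_apply]
  rfl

/-- The bracket acts on functions as the commutator, by passage to a chart. -/
theorem act_bracket {X Y : VField D Q} {f : TQ D Q → ℝ} (hP : IsOpen P) (hX : SmoothField P X)
    (hY : SmoothField P Y) (hf : SmoothFun P f) (hu : u ∈ P) :
    act (bracket X Y) f u = act X (act Y f) u - act Y (act X f) u := by
  obtain ⟨u₀, z, hz, rfl⟩ := exists_dom hu
  have e : ∀ X : VField D Q, (act X f ∘ (ch u₀).symm) =ᶠ[𝓝 z]
      fun y => fderiv ℝ (f ∘ (ch u₀).symm) y (rep u₀ X y) := fun X => by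
    filter_upwards [target_eventually hz.1] with y hy using act_chart X f hy
  rw [act_chart _ _ hz.1, act_chart _ _ hz.1, act_chart _ _ hz.1, bracket_chart hP hX hY hz,
    (e X).fderiv_eq, (e Y).fderiv_eq]
  exact fderiv_lieBracket ((hf.contDiffAt hP hz).of_le ENat.LEInfty.out)
    ((contDiffAt_rep hP hX hz).differentiableAt (by simp))
    ((contDiffAt_rep hP hY hz).differentiableAt (by simp))

/-! ### Brackets and `ker Ω_L` -/

/-- If `S` is a section of `ker Ω_L` with `S e = 0`, and `X` solves `i_X Ω_L = de` on a set to which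
`S` is tangent at `u`, then `[S, X]` is in `ker Ω_L` at `u`.  This is `𝔏_S Ω_L = 0`, which holds
since `Ω_L` is closed. -/
theorem bracket_mem_kerOmega {S X : VField D Q} {e : TQ D Q → ℝ} {C : Set (TQ D Q)}
    (hP : IsOpen P) (hL : SmoothFun P L) (hS : SmoothField P S) (hX : SmoothField P X)
    (he : SmoothFun P e) (hSk : ∀ w ∈ P, S w ∈ kerOmega L w) (hSe : ∀ w ∈ P, act S e w = 0)
    (hC : C ⊆ P) (hXC : ∀ w ∈ C, ∀ y, Omega L w (X w) y = diff e w y) (hu : u ∈ C)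
    (hT : ∀ f : TQ D Q → ℝ, (∀ w ∈ C, f w = 0) → diff f u (S u) = 0) :
    bracket S X u ∈ kerOmega L u := by
  obtain ⟨u₀, z, hz, rfl⟩ := exists_dom (hC hu)
  rw [mem_kerOmega_iff hP hL hz]
  intro y
  have h1 : toModel u₀ ((ch u₀).symm z) (bracket S X ((ch u₀).symm z)) =
      lieBracket ℝ (rep u₀ S) (rep u₀ X) z := bracket_chart hP hS hX hz
  rw [h1]
  refine negCurl_lieBracket_eq_zero (e := e ∘ (ch u₀).symm)
    ((contDiffAt_thetaM (hL.contDiffAt hP hz)).of_le ENat.LEInfty.out)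
    ((he.contDiffAt hP hz).of_le ENat.LEInfty.out)
    ((contDiffAt_rep hP hS hz).differentiableAt (by simp))
    ((contDiffAt_rep hP hX hz).differentiableAt (by simp)) ?_ ?_ ?_ ?_ y
  · filter_upwards [dom_eventually hP hz] with w hw
    exact (mem_kerOmega_iff hP hL hw _).1 (hSk _ hw.2)
  · filter_upwards [dom_eventually hP hz] with w hw
    rw [← act_chart S e hw.1]
    exact hSe _ hw.2
  · intro y
    have h2 := hXC _ hu (ofModel u₀ z y)
    rwa [Omega_chart hP hL hz, toModel_ofModel hz.1, diff_chart e hz.1, toModel_ofModel hz.1] at h2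
  · intro y
    -- the components of `i_X Ω_L - de` along the coordinate field `y` vanish on `C`
    set h : Model D × Model D → ℝ := fun w =>
      negCurl (thetaM (L ∘ (ch u₀).symm)) w (rep u₀ X w) y - fderiv ℝ (e ∘ (ch u₀).symm) w y
    classical
    let f : TQ D Q → ℝ := fun w => if w ∈ (ch u₀).source then h (ch u₀ w) else 0
    have hf : ∀ w ∈ C, f w = 0 := by
      intro w hw
      by_cases hws : w ∈ (ch u₀).source
      · obtain ⟨z', hz', rfl⟩ := exists_chart_symm_eq hws
        simp only [f, if_pos hws]
        rw [(ch u₀).right_inv hz']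
        have h2 := hXC _ hw (ofModel u₀ z' y)
        rw [Omega_chart hP hL ⟨hz', hC hw⟩, toModel_ofModel hz', diff_chart e hz',
          toModel_ofModel hz'] at h2
        exact sub_eq_zero.2 h2
      · simp only [f, if_neg hws]
    have h3 := hT f hf
    rw [diff_chart f hz.1] at h3
    have h4 : (f ∘ (ch u₀).symm) =ᶠ[𝓝 z] h := by
      filter_upwards [target_eventually hz.1] with w hw
      simp only [f, Function.comp_apply, if_pos ((ch u₀).map_target hw)]
      rw [(ch u₀).right_inv hw]
    rw [h4.fderiv_eq] at h3
    exact h3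

theorem bracket_mem_kerOmega_of_mem_kerOmega {S X : VField D Q} (hP : IsOpen P)
    (hL : SmoothFun P L) (hS : SmoothField P S) (hX : SmoothField P X)
    (hSk : ∀ w ∈ P, S w ∈ kerOmega L w) (hXk : ∀ w ∈ P, X w ∈ kerOmega L w) (hu : u ∈ P) :
    bracket S X u ∈ kerOmega L u := by
  have hd : ∀ (w : TQ D Q) (y : T w), diff (fun _ : TQ D Q => (0 : ℝ)) w y = 0 := by
    intro w y
    rw [diff, mfderiv_const]
    rfl
  refine bracket_mem_kerOmega (e := fun _ => 0) (C := P) hP hL hS hX contMDiffOn_const hSk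
    (fun w _ => hd w _) subset_rfl (fun w hw y => ?_) hu fun f hf => ?_
  · rw [hXk w hw y, hd]
  · rw [diff_congr hP hu (g := fun _ => 0) hf, hd]

/-! ### The distribution `𝒢` -/

/-- In a chart, `𝒢` consists of the vectors `z^a ∂/∂v^a` with `M_{ab} z^b = 0`. -/
theorem mem_calG_iff (hP : IsOpen P) (hL : SmoothFun P L) {u₀ : TQ D Q} {z : Model D × Model D}
    (hz : z ∈ dom u₀ P) (x : T ((ch u₀).symm z)) :
    x ∈ calG L ((ch u₀).symm z) ↔ (toModel u₀ _ x).1 = 0 ∧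
      ∀ b, fderiv ℝ (fderiv ℝ (L ∘ (ch u₀).symm)) z (0, (toModel u₀ _ x).2) (0, b) = 0 := by
  rw [calG, Submodule.mem_inf, mem_vertical_iff hz.1, mem_kerOmega_iff hP hL hz]
  refine and_congr_right fun h => ?_
  have hx : toModel u₀ _ x = (0, (toModel u₀ _ x).2) := Prod.ext h rfl
  constructor
  · intro h2 b
    have := h2 (b, 0)
    rw [negCurl_thetaM (hL.contDiffAt hP hz), h] at this
    rw [hx] at this
    have h0 : ((0 : Model D), (0 : Model D)) = 0 := rfl
    rw [h0, map_zero, zero_sub, neg_eq_zero] at this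
    exact this
  · intro h2 y
    have h0 : ((0 : Model D), (0 : Model D)) = 0 := rfl
    rw [negCurl_thetaM (hL.contDiffAt hP hz), h, hx, h2, h0, map_zero, sub_zero]

theorem calG_le_kerOmega : calG L u ≤ kerOmega L u := inf_le_right

theorem energy_chart_eventually (hP : IsOpen P) (hL : SmoothFun P L) {u₀ : TQ D Q}
    {z : Model D × Model D} (hz : z ∈ dom u₀ P) :
    (energy L ∘ (ch u₀).symm) =ᶠ[𝓝 z]
      fun y => fderiv ℝ (L ∘ (ch u₀).symm) y (0, y.2) - (L ∘ (ch u₀).symm) y := by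
  filter_upwards [dom_eventually hP hz] with y hy using energy_chart hP hL hy

theorem smoothFun_energy (hP : IsOpen P) (hL : SmoothFun P L) : SmoothFun P (energy L) := by
  refine smoothFun_of_chart fun u₀ z hz => ?_
  have h := hL.contDiffAt hP hz
  refine ContDiffAt.congr_of_eventuallyEq ?_ (energy_chart_eventually hP hL hz)
  exact ((h.fderiv_right (m := ∞) (by simp)).clm_apply
    (contDiffAt_const.prodMk contDiffAt_snd)).sub h

/-- In a chart, `∂E/∂v^b = v^a M_{ab}`. -/
theorem diff_energy_of_mem_calG (hP : IsOpen P) (hL : SmoothFun P L) (hu : u ∈ P) {x : T u}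
    (hx : x ∈ calG L u) : diff (energy L) u x = 0 := by
  obtain ⟨u₀, z, hz, rfl⟩ := exists_dom hu
  have h := hL.contDiffAt hP hz
  obtain ⟨h1, h2⟩ := (mem_calG_iff hP hL hz x).1 hx
  have hx' : toModel u₀ _ x = (0, (toModel u₀ _ x).2) := Prod.ext h1 rfl
  have h3 : HasFDerivAt (fderiv ℝ (L ∘ (ch u₀).symm)) _ z :=
    ((h.fderiv_right (m := ∞) (by simp)).differentiableAt (by simp)).hasFDerivAt
  have h4 : HasFDerivAt (fun y : Model D × Model D => ((0 : Model D), y.2))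
      (((0 : (Model D × Model D) →L[ℝ] Model D)).prod
        (ContinuousLinearMap.snd ℝ (Model D) (Model D))) z :=
    (hasFDerivAt_const (0 : Model D) z).prodMk hasFDerivAt_snd
  have h5 := (h3.clm_apply h4).sub (h.differentiableAt (by simp)).hasFDerivAt
  rw [diff_chart _ hz.1, (energy_chart_eventually hP hL hz).fderiv_eq]
  refine (DFunLike.congr_fun h5.fderiv _).trans ?_
  rw [hx']
  have h6 := h2 z.2
  simp only [sub_apply, add_apply, ContinuousLinearMap.comp_apply, ContinuousLinearMap.flip_apply,
    ContinuousLinearMap.prod_apply, zero_apply, ContinuousLinearMap.coe_snd', h6]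
  ring

/-- The vertical lift of the horizontal part of a vector in `ker Ω_L` is in `𝒢`. So a regular
Hessian makes `ker Ω_L` vertical, hence equal to `𝒢`. -/
theorem kerOmega_eq_bot_of_calG_eq_bot (hP : IsOpen P) (hL : SmoothFun P L) (hu : u ∈ P)
    (h : calG L u = ⊥) : kerOmega L u = ⊥ := by
  obtain ⟨u₀, z, hz, rfl⟩ := exists_dom hu
  rw [eq_bot_iff]
  intro x hx
  have hx' := (mem_kerOmega_iff hP hL hz x).1 hx
  have hsymm : IsSymmSndFDerivAt ℝ (L ∘ (ch u₀).symm) z :=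
    (hL.contDiffAt hP hz).isSymmSndFDerivAt (by simpa using ENat.LEInfty.out)
  -- the vertical lift of the horizontal part of `x` is in `𝒢`
  have h1 : ofModel u₀ z (0, (toModel u₀ _ x).1) ∈ calG L ((ch u₀).symm z) := by
    rw [mem_calG_iff hP hL hz, toModel_ofModel hz.1]
    refine ⟨rfl, fun b => ?_⟩
    have h2 := hx' (0, b)
    rw [negCurl_thetaM (hL.contDiffAt hP hz)] at h2
    have h0 : ((0 : Model D), (0 : Model D)) = 0 := rfl
    rw [h0, map_zero, sub_zero] at h2
    rw [hsymm.eq]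
    exact h2
  rw [h, Submodule.mem_bot] at h1
  have h2 : (toModel u₀ _ x).1 = 0 := by
    have := congrArg (toModel u₀ _) h1
    rw [toModel_ofModel hz.1, map_zero] at this
    exact congrArg Prod.snd this
  rw [← h]
  exact ⟨(mem_vertical_iff hz.1 x).2 h2, hx⟩

theorem bracket_vertical {X Y : VField D Q} (hP : IsOpen P) (hX : SmoothField P X)
    (hY : SmoothField P Y) (hXv : ∀ w ∈ P, X w ∈ vertical w) (hYv : ∀ w ∈ P, Y w ∈ vertical w)
    (hu : u ∈ P) : bracket X Y u ∈ vertical u := by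
  obtain ⟨u₀, z, hz, rfl⟩ := exists_dom hu
  rw [mem_vertical_iff hz.1]
  have h1 : toModel u₀ ((ch u₀).symm z) (bracket X Y ((ch u₀).symm z)) =
      lieBracket ℝ (rep u₀ X) (rep u₀ Y) z := bracket_chart hP hX hY hz
  rw [h1]
  have key : ∀ X : VField D Q, SmoothField P X → (∀ w ∈ P, X w ∈ vertical w) →
      ∀ v, (fderiv ℝ (rep u₀ X) z v).1 = 0 := by
    intro X hX hXv v
    have h2 : HasFDerivAt (fun y => (rep u₀ X y).1)
        ((ContinuousLinearMap.fst ℝ (Model D) (Model D)).comp (fderiv ℝ (rep u₀ X) z)) z :=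
      (ContinuousLinearMap.fst ℝ (Model D) (Model D)).hasFDerivAt.comp z
        ((contDiffAt_rep hP hX hz).differentiableAt (by simp)).hasFDerivAt
    have h3 : (fun y => (rep u₀ X y).1) =ᶠ[𝓝 z] fun _ => 0 := by
      filter_upwards [dom_eventually hP hz] with w hw
      exact (mem_vertical_iff hw.1 _).1 (hXv _ hw.2)
    have h4 := h2.fderiv
    rw [h3.fderiv_eq] at h4
    have h5 := DFunLike.congr_fun h4 v
    simpa using h5.symm
  rw [lieBracket, Prod.fst_sub, key X hX hXv, key Y hY hYv, sub_zero]

/-- The Leibniz rule for `[G, X]`, up to vertical vectors. -/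
theorem BracketVertical.add_sum_smul {N : ℕ} {X : VField D Q} {Y : Fin N → VField D Q}
    {f : Fin N → TQ D Q → ℝ} (hP : IsOpen P) (hX : SmoothField P X)
    (hY : ∀ n, SmoothField P (Y n)) (hf : ∀ n, f n ∈ Fbar L P) (hXv : BracketVertical L P X)
    (hYv : ∀ n, BracketVertical L P (Y n)) :
    BracketVertical L P (fun w => X w + ∑ n, f n w • Y n w) := by
  intro G hG u hu
  have hsm : ∀ n, bracket G (fun w => f n w • Y n w) u ∈ vertical u := by
    intro n
    have h := mlieBracket_smul_right (I := TModel D) (V := G)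
      ((hf n).1.mdifferentiableAt hP hu) ((hY n).mdifferentiableAt hP hu)
    have h0 : act G (f n) u = 0 := (hf n).2 G hG u hu
    have h1 : bracket G (fun w => f n w • Y n w) u =
        act G (f n) u • Y n u + f n u • bracket G (Y n) u := h
    rw [h1, h0, zero_smul, zero_add]
    exact Submodule.smul_mem _ _ (hYv n G hG u hu)
  have hsum : ∀ s : Finset (Fin N), SmoothField P (fun w => X w + ∑ n ∈ s, f n w • Y n w) ∧
      bracket G (fun w => X w + ∑ n ∈ s, f n w • Y n w) u ∈ vertical u := by
    classical
    intro s
    induction s using Finset.induction_on with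
    | empty => simpa using ⟨hX, hXv G hG u hu⟩
    | insert n s hn ih =>
      have e : ∀ w : TQ D Q, X w + ∑ i ∈ insert n s, f i w • Y i w =
          f n w • Y n w + (X w + ∑ i ∈ s, f i w • Y i w) := fun w => by
        rw [Finset.sum_insert hn]; abel
      simp only [e]
      have hs := SmoothField.smul (hf n).1 (hY n)
      refine ⟨hs.add ih.1, ?_⟩
      have h := mlieBracket_add_right (I := TModel D) (V := G)
        (hs.mdifferentiableAt hP hu) (ih.1.mdifferentiableAt hP hu)
      refine (show bracket G (fun w => f n w • Y n w + (X w + ∑ i ∈ s, f i w • Y i w)) u =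
        bracket G (fun w => f n w • Y n w) u +
          bracket G (fun w => X w + ∑ i ∈ s, f i w • Y i w) u from h) ▸ ?_
      exact Submodule.add_mem _ (hsm n) ih.2
  exact (hsum Finset.univ).2

theorem const_mem_Fbar (c : ℝ) : (fun _ => c) ∈ Fbar L P := by
  refine ⟨contMDiffOn_const, fun G _ u _ => ?_⟩
  rw [act, diff, mfderiv_const]
  rfl

/-- Sections of `𝒢` are vertical, so that their brackets are, and they annihilate the energy. -/
theorem IsSectionG.mem_SymL (hP : IsOpen P) (hL : SmoothFun P L) {G : VField D Q}
    (hG : IsSectionG L P G) : G ∈ SymL L P :=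
  ⟨⟨hG.1, fun u hu => (hG.2 u hu).2, fun _ hG' _ hu => bracket_vertical hP hG'.1 hG.1
    (fun w hw => (hG'.2 w hw).1) (fun w hw => (hG.2 w hw).1) hu⟩,
    fun u hu => diff_energy_of_mem_calG hP hL hu (hG.2 u hu)⟩

end Geometry

/-! ### Sections of `𝒢` and smooth coefficients -/

section Sections

variable {D : ℕ} {Q : Type*} [TopologicalSpace Q] [ChartedSpace (Model D) Q]
  [IsManifold 𝓘(ℝ, Model D) ∞ Q]
variable {P : Set (TQ D Q)} {L : TQ D Q → ℝ} {u : TQ D Q}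

/-- Bump functions on `TQ` need the total space to be Hausdorff. -/
theorem t2Space_tangentBundle [T2Space Q] : T2Space (TQ D Q) := by
  refine ⟨fun x y hxy => ?_⟩
  have hc : Continuous (fun w : TQ D Q => w.proj) :=
    FiberBundle.continuous_proj (Model D) (TangentSpace 𝓘(ℝ, Model D))
  by_cases h : x.proj = y.proj
  · -- points of the same fibre are separated in a chart
    have hx : x ∈ (ch x).source := mem_extChartAt_source x
    have hy : y ∈ (ch x).source := by rw [mem_source_iff, ← h]; exact mem_source_iff.1 hx
    have hne : ch x x ≠ ch x y := fun he => hxy ((ch x).injOn hx hy he)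
    obtain ⟨U, V, hU, hV, hxU, hyV, hd⟩ := t2_separation hne
    have hcont : ContinuousOn (ch x) (ch x).source := continuousOn_extChartAt x
    have ho : IsOpen (ch x).source := isOpen_extChartAt_source x
    refine ⟨_, _, hcont.isOpen_inter_preimage ho hU, hcont.isOpen_inter_preimage ho hV,
      ⟨hx, hxU⟩, ⟨hy, hyV⟩, ?_⟩
    exact (hd.preimage (ch x)).mono inter_subset_right inter_subset_right
  · obtain ⟨U, V, hU, hV, hxU, hyV, hd⟩ := t2_separation h
    exact ⟨_, _, hU.preimage hc, hV.preimage hc, hxU, hyV, hd.preimage _⟩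

/-- The fibre Hessian of `ℓ(q, v)` as a family of linear maps. -/
def hessM {D : ℕ} (ℓ : Model D × Model D → ℝ) (z : Model D × Model D) :
    Model D →L[ℝ] Model D →L[ℝ] ℝ :=
  ((ContinuousLinearMap.compL ℝ (Model D) (Model D × Model D) ℝ).flip
    (ContinuousLinearMap.inr ℝ (Model D) (Model D))).comp
      ((fderiv ℝ (fderiv ℝ ℓ) z).comp (ContinuousLinearMap.inr ℝ (Model D) (Model D)))

theorem contDiffOn_hessM (hP : IsOpen P) (hL : SmoothFun P L) (u₀ : TQ D Q) :
    ContDiffOn ℝ ∞ (hessM (L ∘ (ch u₀).symm)) (dom u₀ P) := by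
  intro z hz
  have h := (((hL.contDiffAt hP hz).fderiv_right (m := ∞) (by simp)).fderiv_right
    (m := ∞) (by simp))
  exact (contDiffAt_const.clm_comp (h.clm_comp contDiffAt_const)).contDiffWithinAt

/-- The rank of the fibre Hessian may be computed in a chart. -/
theorem finrank_range_hessM (hP : IsOpen P) (hL : SmoothFun P L) {u₀ : TQ D Q}
    {z : Model D × Model D} (hz : z ∈ dom u₀ P) :
    Module.finrank ℝ (LinearMap.range
      (hessM (L ∘ (ch u₀).symm) z : Model D →ₗ[ℝ] (Model D →L[ℝ] ℝ))) =
    Module.finrank ℝ (LinearMap.range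
      (fibreHessian L ((ch u₀).symm z) : Model D →ₗ[ℝ] (Model D →L[ℝ] ℝ))) := by
  have hp : ((ch u₀).symm z).proj ∈ (chQ u₀).source := mem_source_iff.1 ((ch u₀).map_target hz.1)
  let C : Model D →L[ℝ] Model D := toModelQ u₀ ((ch u₀).symm z).proj
  have hC : Function.Bijective C := toModelQ_bijective hp
  let e : Model D ≃ₗ[ℝ] Model D := LinearEquiv.ofBijective (C : Model D →ₗ[ℝ] Model D) hC
  have hH : ∀ x y, fibreHessian L ((ch u₀).symm z) x y =
      hessM (L ∘ (ch u₀).symm) z (C x) (C y) := fun x y => fibreHessian_chart hP hL hz x y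
  set H : Model D →ₗ[ℝ] (Model D →L[ℝ] ℝ) := (fibreHessian L ((ch u₀).symm z) :)
  set m : Model D →ₗ[ℝ] (Model D →L[ℝ] ℝ) := (hessM (L ∘ (ch u₀).symm) z :)
  have hker : LinearMap.ker H = (LinearMap.ker m).comap (e : Model D →ₗ[ℝ] Model D) := by
    ext x
    simp only [LinearMap.mem_ker, Submodule.mem_comap]
    constructor
    · intro h
      refine ContinuousLinearMap.ext fun b => ?_
      obtain ⟨y, rfl⟩ := hC.2 b
      exact (hH x y).symm.trans (DFunLike.congr_fun h y)
    · intro h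
      refine ContinuousLinearMap.ext fun y => ?_
      exact (hH x y).trans (DFunLike.congr_fun h (C y))
  have h1 := (e.ofSubmodule' (LinearMap.ker m)).finrank_eq
  rw [← hker] at h1
  have h2 := LinearMap.finrank_range_add_finrank_ker H
  have h3 := LinearMap.finrank_range_add_finrank_ker m
  omega

/-- As the fibre Hessian has constant rank, `𝒢` is a smooth distribution: each of its vectors is
the value of a global section, a local section multiplied by a bump function. -/
theorem exists_isSectionG [T2Space Q] (hP : IsOpen P) (hL : SmoothFun P L) {r : ℕ}
    (hM : ∀ u ∈ P, Module.finrank ℝ (LinearMap.range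
      (fibreHessian L u : Model D →ₗ[ℝ] (Model D →L[ℝ] ℝ))) = r)
    (hu : u ∈ P) {x : T u} (hx : x ∈ calG L u) : ∃ G, IsSectionG L P G ∧ G u = x := by
  have : T2Space (TQ D Q) := t2Space_tangentBundle
  have hz : ch u u ∈ dom u P := mem_dom_self hu
  have huu : (ch u).symm (ch u u) = u := extChartAt_to_inv u
  -- membership in `𝒢` in the chart at `u`
  have hmem : ∀ w ∈ (ch u).source, w ∈ P → ∀ y : T w, y ∈ calG L w ↔
      (toModel u w y).1 = 0 ∧ hessM (L ∘ (ch u).symm) (ch u w) (toModel u w y).2 = 0 := by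
    intro w hw hwP y
    obtain ⟨z, hz, rfl⟩ := exists_chart_symm_eq hw
    rw [(ch u).right_inv hz, mem_calG_iff hP hL ⟨hz, hwP⟩]
    refine and_congr_right fun _ => ⟨fun h => ContinuousLinearMap.ext h,
      fun h b => DFunLike.congr_fun h b⟩
  have hus : u ∈ (ch u).source := mem_extChartAt_source u
  obtain ⟨hx1, hx2⟩ := (hmem u hus hu x).1 hx
  obtain ⟨U, hUd, hUo, hzU, k, hk, hkz, hmk⟩ := exists_contDiffOn_kernel_section
    (isOpen_dom hP) hz (contDiffOn_hessM hP hL u)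
    (fun z hz => (finrank_range_hessM hP hL hz).trans (hM _ hz.2)) hx2
  let V : Set (TQ D Q) := (ch u).source ∩ ch u ⁻¹' U
  have hVo : IsOpen V :=
    (continuousOn_extChartAt u).isOpen_inter_preimage (isOpen_extChartAt_source u) hUo
  have huV : u ∈ V := ⟨hus, hzU⟩
  let G₀ : VField D Q := fun w => (toModel u w).inverse (0, k (ch u w))
  have hG₀ : ∀ w ∈ (ch u).source, toModel u w (G₀ w) = (0, k (ch u w)) := by
    intro w hw
    obtain ⟨e, he⟩ := isInvertible_toModel hw
    have h1 : toModel u w = e := he.symm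
    have h2 : G₀ w = e.symm (0, k (ch u w)) := by
      simp only [G₀, h1, ContinuousLinearMap.inverse_equiv, ContinuousLinearEquiv.coe_coe]
    rw [h2, h1]
    exact e.apply_symm_apply _
  have hG₀s : SmoothField V G₀ := by
    intro w hw
    have hk' : ContDiffAt ℝ ∞ (fun z => ((0 : Model D), k z)) (ch u w) :=
      contDiffAt_const.prodMk (hk.contDiffAt (hUo.mem_nhds hw.2))
    have h := ContMDiffAt.mpullback_vectorField_preimage (m := ∞) (n := ∞)
      (I := TModel D) (I' := 𝓘(ℝ, Model D × Model D)) (f := ch u)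
      (contMDiffAt_vectorSpace_iff_contDiffAt.2 hk')
      (contMDiffAt_extChartAt' (by have := hw.1; rwa [extChartAt_source] at this))
      (isInvertible_mfderiv_extChartAt hw.1) (by simp)
    exact h.contMDiffWithinAt
  obtain ⟨ψ, -, hψ⟩ := (SmoothBumpFunction.nhds_basis_tsupport (I := TModel D) u).mem_iff.1
    (hVo.mem_nhds huV)
  refine ⟨(ψ : TQ D Q → ℝ) • G₀, ⟨?_, ?_⟩, ?_⟩
  · exact (ContMDiffOn.smul_section_of_tsupport (ψ.contMDiff.contMDiffOn) hVo hψ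
      hG₀s).contMDiffOn
  · intro w hw
    by_cases hwV : w ∈ V
    · refine Submodule.smul_mem _ _ ((hmem w hwV.1 hw _).2 ?_)
      rw [hG₀ w hwV.1]
      exact ⟨rfl, hmk _ hwV.2⟩
    · have h0 : ψ w = 0 := image_eq_zero_of_notMem_tsupport fun h => hwV (hψ h)
      have h1 : ((ψ : TQ D Q → ℝ) • G₀) w = 0 := by
        rw [Pi.smul_apply', h0, zero_smul]
      rw [h1]
      exact zero_mem _
  · rw [Pi.smul_apply', ψ.eq_one, one_smul]
    obtain ⟨e, he⟩ := isInvertible_toModel hus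
    have h1 : toModel u u = e := he.symm
    have h2 : toModel u u (G₀ u) = toModel u u x := by
      rw [hG₀ u hus, hkz]
      exact Prod.ext hx1.symm rfl
    rw [h1] at h2
    exact e.injective h2

/-- Vector fields independent modulo `𝒢` at `u` represent, modulo `𝒢`, every other field in their
span with coefficients differentiable at `u`: on `ker Ω_L` the quotient by `𝒢` is faithfully
represented by the horizontal components in a chart. -/
theorem exists_coeff_modulo_calG {N : ℕ} {b : Fin N → VField D Q} {S : VField D Q}
    (hP : IsOpen P) (hb : ∀ n, SmoothField P (b n)) (hS : SmoothField P S)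
    (hbk : ∀ n, ∀ w ∈ P, b n w ∈ kerOmega L w) (hSk : ∀ w ∈ P, S w ∈ kerOmega L w) (hu : u ∈ P)
    (hind : LinearIndependent ℝ fun n => (calG L u).mkQ (b n u)) :
    ∃ s : Fin N → TQ D Q → ℝ, (∀ n, MDifferentiableAt (TModel D) 𝓘(ℝ, ℝ) (s n) u) ∧
      ∀ᶠ w in 𝓝 u, S w ∈ Submodule.span ℝ (range fun n => b n w) ⊔ calG L w →
        S w - ∑ n, s n w • b n w ∈ calG L w := by
  obtain ⟨u₀, z, hz, rfl⟩ := exists_dom hu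
  have hfst : ∀ X : VField D Q, SmoothField P X →
      DifferentiableAt ℝ (fun y => (rep u₀ X y).1) z := fun X hX =>
    (ContinuousLinearMap.fst ℝ (Model D) (Model D)).differentiableAt.comp z
      ((contDiffAt_rep hP hX hz).differentiableAt (by simp))
  -- a combination that is vertical is in `𝒢`
  have hvert : ∀ y ∈ dom u₀ P, ∀ x : T ((ch u₀).symm y), x ∈ kerOmega L ((ch u₀).symm y) →
      (toModel u₀ _ x).1 = 0 → x ∈ calG L ((ch u₀).symm y) := fun y hy x hx h =>
    ⟨(mem_vertical_iff hy.1 x).2 h, hx⟩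
  have hsumfst : ∀ (y : Model D × Model D) (c : Fin N → ℝ),
      (toModel u₀ ((ch u₀).symm y) (∑ n, c n • b n ((ch u₀).symm y))).1 =
        ∑ n, c n • (rep u₀ (b n) y).1 := by
    intro y c
    rw [map_sum, Prod.fst_sum]
    refine Finset.sum_congr rfl fun n _ => ?_
    rw [map_smul]
    rfl
  have hind' : LinearIndependent ℝ fun n => (rep u₀ (b n) z).1 := by
    rw [Fintype.linearIndependent_iff] at hind ⊢
    intro c hc
    refine hind c ?_
    have h1 : ∑ n, c n • b n ((ch u₀).symm z) ∈ calG L ((ch u₀).symm z) := by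
      refine hvert z hz _ (Submodule.sum_mem _ fun n _ =>
        Submodule.smul_mem _ _ (hbk n _ hz.2)) ?_
      rw [hsumfst, hc]
    rw [← (Submodule.Quotient.mk_eq_zero _), ← Submodule.mkQ_apply, map_sum] at h1
    simpa only [map_smul] using h1
  obtain ⟨s, hs, hev⟩ := exists_differentiableAt_coeff (fun n => hfst _ (hb n)) (hfst S hS) hind'
  refine ⟨fun n => s n ∘ ch u₀, fun n => ?_, ?_⟩
  · refine MDifferentiableAt.comp _ (I' := 𝓘(ℝ, Model D × Model D)) ?_
      (mdifferentiableAt_chart hz.1)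
    rw [(ch u₀).right_inv hz.1]
    exact mdifferentiableAt_iff_differentiableAt.2 (hs n)
  · have hsrc := (ch u₀).map_target hz.1
    have htd : Tendsto (ch u₀) (𝓝 ((ch u₀).symm z)) (𝓝 z) := by
      have h := continuousAt_extChartAt' (I := TModel D) hsrc
      have h' : Tendsto (ch u₀) _ _ := h.tendsto
      rwa [(ch u₀).right_inv hz.1] at h'
    filter_upwards [htd.eventually hev, extChartAt_source_mem_nhds' (I := TModel D) hsrc,
      hP.mem_nhds hz.2] with w hw hws hwP hmem
    obtain ⟨y, hy, rfl⟩ := exists_chart_symm_eq hws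
    rw [(ch u₀).right_inv hy] at hw
    obtain ⟨a, ha, g, hg, hag⟩ := Submodule.mem_sup.1 hmem
    obtain ⟨c, rfl⟩ := (Submodule.mem_span_range_iff_exists_fun ℝ).1 ha
    have hg0 : (toModel u₀ _ g).1 = 0 := (mem_vertical_iff hy g).1 hg.1
    have hSy : (rep u₀ S y).1 = ∑ n, c n • (rep u₀ (b n) y).1 := by
      rw [rep, ← hag, map_add, Prod.fst_add, hsumfst, hg0, add_zero]
    have h1 := hw (by rw [hSy]; exact (Submodule.mem_span_range_iff_exists_fun ℝ).2 ⟨c, rfl⟩)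
    refine hvert y ⟨hy, hwP⟩ _ (Submodule.sub_mem _ (hSk _ hwP) (Submodule.sum_mem _ fun n _ =>
        Submodule.smul_mem _ _ (hbk n _ hwP))) ?_
    have h2 := hsumfst y (fun n => s n y)
    simp only [Function.comp_apply]
    rw [(ch u₀).right_inv hy, map_sub, Prod.fst_sub, h2, ← h1]
    exact sub_self _

/-- If differentials of functions vanishing on a submanifold span a space of dimension its
codimension, they span the conormal space. So a vector killed by them kills every function vanishing
on the submanifold. -/
theorem IsSubmanifoldAt.diff_eq_zero {M : Set (TQ D Q)} {k : ℕ} (h : IsSubmanifoldAt M k u)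
    (huM : u ∈ M) {A : Set (T u →L[ℝ] ℝ)}
    (hA : ∀ α ∈ A, ∃ g : TQ D Q → ℝ, (∀ w ∈ M, g w = 0) ∧ α = diff g u)
    (hrank : Module.finrank ℝ (Submodule.span ℝ A) = k) {f : TQ D Q → ℝ}
    (hf : ∀ w ∈ M, f w = 0) {v : T u} (hv : ∀ α ∈ A, α v = 0) : diff f u v = 0 := by
  obtain ⟨F, hF, hsurj, hFM⟩ := h
  set z := ch u u with hz
  have hzt : z ∈ (ch u).target := mem_extChartAt_target u
  have hzu : (ch u).symm z = u := extChartAt_to_inv u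
  have hFd : ContDiffAt ℝ ∞ (F ∘ (ch u).symm) z :=
    contDiffAt_comp_chart_symm hzt (by rw [hzu]; exact hF)
  have hchain : ∀ {W : Type} [NormedAddCommGroup W] [NormedSpace ℝ W] (f : TQ D Q → W) (v : T u),
      mfderiv (TModel D) 𝓘(ℝ, W) f u v = fderiv ℝ (f ∘ (ch u).symm) z (toModel u u v) := by
    intro W _ _ f v
    have h1 : ∀ q ∈ (ch u).source, ∀ v : T q, mfderiv (TModel D) 𝓘(ℝ, W) f q v =
        fderiv ℝ (f ∘ (ch u).symm) (ch u q) (toModel u q v) := by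
      intro q hq v
      obtain ⟨y, hy, rfl⟩ := exists_chart_symm_eq hq
      rw [(ch u).right_inv hy]
      exact mfderiv_eq_fderiv_chart f hy v
    exact h1 u (mem_extChartAt_source u) v
  let dF : T u →L[ℝ] (Fin k → ℝ) := mfderiv (TModel D) 𝓘(ℝ, Fin k → ℝ) F u
  let F' : T u →ₗ[ℝ] (Fin k → ℝ) := dF
  have hsurj' : Function.Surjective F' := hsurj
  -- functions vanishing on `M` have differentials in the annihilator of `ker dF`
  have hkill : ∀ g : TQ D Q → ℝ, (∀ w ∈ M, g w = 0) → ∀ v : T u, F' v = 0 → diff g u v = 0 := by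
    intro g hg v hv
    refine (hchain g v).trans ?_
    refine fderiv_eq_zero_of_vanishing_on_level (F := F ∘ (ch u).symm)
      (hFd.of_le ENat.LEInfty.out) ?_ ?_ ?_ ?_
    · intro y
      obtain ⟨x, hx⟩ := hsurj y
      exact ⟨toModel u u x, (hchain F x).symm.trans hx⟩
    · rw [Function.comp_apply, hzu]
      exact hFM.self_of_nhds.1 huM
    · have ht := tendsto_chart_symm hzt
      rw [hzu] at ht
      filter_upwards [ht.eventually hFM] with w hw h0
      exact hg _ (hw.2 h0)
    · exact (hchain F v).symm.trans hv
  -- the annihilator of `ker dF` has dimension `k`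
  have : FiniteDimensional ℝ (T u) := inferInstanceAs (FiniteDimensional ℝ (Model D × Model D))
  let ι : (T u →L[ℝ] ℝ) →ₗ[ℝ] Module.Dual ℝ (T u) := ContinuousLinearMap.coeLM ℝ
  have hι : Function.Injective ι := ContinuousLinearMap.coe_injective
  have hsub : (Submodule.span ℝ A).map ι ≤ (LinearMap.ker F').dualAnnihilator := by
    rw [Submodule.map_le_iff_le_comap, Submodule.span_le]
    intro α hα
    obtain ⟨g, hg, rfl⟩ := hA α hα
    refine (Submodule.mem_dualAnnihilator _).2 fun v hv => hkill g hg v hv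
  have hfin : Module.finrank ℝ ((LinearMap.ker F').dualAnnihilator) = k := by
    have h1 := Subspace.finrank_add_finrank_dualAnnihilator_eq (LinearMap.ker F')
    have h2 := LinearMap.finrank_range_add_finrank_ker F'
    rw [LinearMap.range_eq_top.2 hsurj', finrank_top, Module.finrank_fin_fun] at h2
    omega
  have heq : (Submodule.span ℝ A).map ι = (LinearMap.ker F').dualAnnihilator := by
    refine Submodule.eq_of_le_of_finrank_eq hsub ?_
    rw [hfin, ← hrank]
    exact (Submodule.equivMapOfInjective ι hι _).finrank_eq.symm
  have hfmem : ι (diff f u) ∈ (LinearMap.ker F').dualAnnihilator :=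
    (Submodule.mem_dualAnnihilator _).2 fun v hv => hkill f hf v hv
  rw [← heq] at hfmem
  obtain ⟨α, hα, hαf⟩ := hfmem
  have hαf' : α = diff f u := hι hαf
  rw [← hαf']
  refine Submodule.span_induction (p := fun α _ => α v = 0) hv (by simp) ?_ ?_ hα
  · intro a b _ _ ha hb
    rw [add_apply, ha, hb, add_zero]
  · intro c a _ ha
    rw [smul_apply, ha, smul_zero]

end Sections

/-! ### Tangency of the symmetries -/

section Algorithm

variable {D : ℕ} {Q : Type*} [TopologicalSpace Q] [ChartedSpace (Model D) Q]
  [IsManifold 𝓘(ℝ, Model D) ∞ Q]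
variable {P : Set (TQ D Q)} {L : TQ D Q → ℝ} {u : TQ D Q}

theorem BracketVertical.congr {X Y : VField D Q} (hP : IsOpen P) (hX : BracketVertical L P X)
    (h : ∀ w ∈ P, Y w = X w) : BracketVertical L P Y := by
  intro G hG u hu
  rw [bracket_congr hP hu (fun _ _ => rfl) h]
  exact hX G hG u hu

theorem zero_mem_kerBar : (fun _ => 0 : VField D Q) ∈ kerBar L P := by
  refine ⟨(Bundle.contMDiff_zeroSection ℝ (TangentSpace (TModel D))).contMDiffOn,
    fun u _ => zero_mem _, fun G _ u _ => ?_⟩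
  have h : bracket G (0 : VField D Q) = 0 := mlieBracket_zero_right
  have h' : bracket G (fun _ => 0 : VField D Q) u = 0 := congrFun h u
  rw [h']
  exact zero_mem _

theorem add_sum_smul_mem_kerBar {N : ℕ} {X : VField D Q} {Y : Fin N → VField D Q}
    {f : Fin N → TQ D Q → ℝ} (hP : IsOpen P) (hX : X ∈ kerBar L P) (hY : ∀ n, Y n ∈ kerBar L P)
    (hf : ∀ n, f n ∈ Fbar L P) : (fun w => X w + ∑ n, f n w • Y n w) ∈ kerBar L P :=
  ⟨hX.1.add (SmoothField.sum_smul (fun n => (hf n).1) fun n => (hY n).1),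
    fun w hw => add_mem (hX.2.1 w hw) (Submodule.sum_mem _ fun n _ =>
      Submodule.smul_mem _ _ ((hY n).2.1 w hw)),
    hX.2.2.add_sum_smul hP hX.1 (fun n => (hY n).1) hf fun n => (hY n).2.2⟩

theorem kerBar_congr {X Y : VField D Q} (hP : IsOpen P) (hX : X ∈ kerBar L P)
    (h : ∀ w ∈ P, Y w = X w) : Y ∈ kerBar L P :=
  ⟨hX.1.congr h, fun w hw => by rw [h w hw]; exact hX.2.1 w hw, hX.2.2.congr hP h⟩

theorem sum_smul_mem_kerBar {N : ℕ} {Y : Fin N → VField D Q}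
    {f : Fin N → TQ D Q → ℝ} (hP : IsOpen P) (hY : ∀ n, Y n ∈ kerBar L P)
    (hf : ∀ n, f n ∈ Fbar L P) : (fun w => ∑ n, f n w • Y n w) ∈ kerBar L P :=
  kerBar_congr hP (add_sum_smul_mem_kerBar hP zero_mem_kerBar hY hf) fun _ _ =>
    (zero_add _).symm

theorem Omega_add_of_mem_kerOmega {x x' : T u} (hx : x' ∈ kerOmega L u) (y : T u) :
    Omega L u (x + x') y = Omega L u x y := by
  rw [Omega_add_left, hx y, add_zero]

theorem add_sum_smul_mem_SolBar {N : ℕ} {X : VField D Q} {Y : Fin N → VField D Q}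
    {f : Fin N → TQ D Q → ℝ} {C : Set (TQ D Q)} (hP : IsOpen P) (hC : C ⊆ P)
    (hX : X ∈ SolBar L P C) (hY : ∀ n, Y n ∈ kerBar L P) (hf : ∀ n, f n ∈ Fbar L P) :
    (fun w => X w + ∑ n, f n w • Y n w) ∈ SolBar L P C :=
  ⟨hX.1.add (SmoothField.sum_smul (fun n => (hf n).1) fun n => (hY n).1),
    fun w hw y => by
      rw [Omega_add_of_mem_kerOmega (Submodule.sum_mem _ fun n _ =>
        Submodule.smul_mem _ _ ((hY n).2.1 w (hC hw)))]
      exact hX.2.1 w hw y,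
    hX.2.2.add_sum_smul hP hX.1 (fun n => (hY n).1) hf fun n => (hY n).2.2⟩

theorem SolBar_congr {X Y : VField D Q} {C : Set (TQ D Q)} (hP : IsOpen P) (hC : C ⊆ P)
    (hX : X ∈ SolBar L P C) (h : ∀ w ∈ P, Y w = X w) : Y ∈ SolBar L P C :=
  ⟨hX.1.congr h, fun w hw y => by rw [h w (hC hw)]; exact hX.2.1 w hw y, hX.2.2.congr hP h⟩

/-- Combinations of independent vectors with independent coefficients are independent. -/
theorem linearIndependent_sum_smul {V : Type*} [AddCommGroup V] [Module ℝ V] {N M : ℕ}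
    {v : Fin N → V} (hv : LinearIndependent ℝ v) {c : Fin M → Fin N → ℝ}
    (hc : LinearIndependent ℝ c) : LinearIndependent ℝ fun j => ∑ k, c j k • v k := by
  have h := hc.map' (Fintype.linearCombination ℝ v)
    (LinearMap.ker_eq_bot.2 hv.fintypeLinearCombination_injective)
  exact h

/-- If a family of kernel vectors is independent and has as many members as the corank, it spans
the kernel. -/
theorem exists_eq_sum_of_mulVec_eq_zero {N M : ℕ} {A : Matrix (Fin N) (Fin N) ℝ}
    (hr : A.rank + M = N) {c : Fin M → Fin N → ℝ} (hc : LinearIndependent ℝ c)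
    (hker : ∀ j, A.mulVec (c j) = 0) {a : Fin N → ℝ} (ha : A.mulVec a = 0) :
    ∃ b : Fin M → ℝ, a = ∑ j, b j • c j := by
  have h1 : Submodule.span ℝ (range c) = LinearMap.ker A.mulVecLin := by
    refine Submodule.eq_of_le_of_finrank_eq ?_ ?_
    · rw [Submodule.span_le]
      rintro _ ⟨j, rfl⟩
      exact hker j
    · rw [finrank_span_eq_card hc, Fintype.card_fin]
      have h2 := LinearMap.finrank_range_add_finrank_ker A.mulVecLin
      rw [Module.finrank_fin_fun] at h2
      have h3 : A.rank = Module.finrank ℝ (LinearMap.range A.mulVecLin) := rfl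
      omega
  have h2 : a ∈ Submodule.span ℝ (range c) := by rw [h1]; exact ha
  obtain ⟨b, hb⟩ := (Submodule.mem_span_range_iff_exists_fun ℝ).1 h2
  exact ⟨b, hb.symm⟩

theorem symSpace_le_iff {W : Submodule ℝ (T u)} :
    symSpace L P u ≤ W ↔ ∀ S ∈ SymL L P, S u ∈ W := by
  rw [symSpace, Submodule.span_le]
  constructor
  · exact fun h S hS => h ⟨S, hS, rfl⟩
  · rintro h _ ⟨S, hS, rfl⟩
    exact h S hS

theorem mem_symSpace {S : VField D Q} (hS : S ∈ SymL L P) : S u ∈ symSpace L P u :=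
  Submodule.subset_span ⟨S, hS, rfl⟩

namespace ConstraintAlgorithm

variable (R : ConstraintAlgorithm L P)

/-- The vectors annihilated by the differentials of the constraint functions of orders `1, …, l`;
on the constraint submanifold of order `l`, its tangent space. -/
def tan (l : ℕ) (u : TQ D Q) : Submodule ℝ (T u) where
  carrier := {v | ∀ k, 1 ≤ k → k ≤ l → ∀ n, diff (R.γ k n) u v = 0}
  zero_mem' := fun k _ _ n => map_zero _
  add_mem' := fun ha hb k h1 h2 n => by rw [map_add, ha k h1 h2 n, hb k h1 h2 n, add_zero]
  smul_mem' := fun c a ha k h1 h2 n => by rw [map_smul, ha k h1 h2 n, smul_zero]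

variable {R}

theorem mem_tan_zero (v : T u) : v ∈ R.tan 0 u := fun k h1 h2 => by omega

theorem mem_tan_succ {l : ℕ} {v : T u} :
    v ∈ R.tan (l + 1) u ↔ v ∈ R.tan l u ∧ ∀ n, diff (R.γ (l + 1) n) u v = 0 := by
  constructor
  · exact fun h => ⟨fun k h1 h2 => h k h1 (by omega), h (l + 1) (by omega) le_rfl⟩
  · rintro ⟨h, h'⟩ k h1 h2
    rcases Nat.lt_or_ge l k with h3 | h3
    · obtain rfl : k = l + 1 := by omega
      exact h'
    · exact h k h1 h3

theorem tan_anti {l m : ℕ} (h : l ≤ m) : R.tan m u ≤ R.tan l u :=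
  fun _ hv k h1 h2 => hv k h1 (h2.trans h)

theorem cSet_subset {l : ℕ} : R.cSet l ⊆ P := fun _ h => h.1

theorem cSet_anti {l m : ℕ} (h : l ≤ m) : R.cSet m ⊆ R.cSet l :=
  fun _ hu => ⟨hu.1, fun k h1 h2 => hu.2 k h1 (h2.trans h)⟩

theorem γ_eq_zero {l : ℕ} (hl : 1 ≤ l) (hu : u ∈ R.cSet l) (n : Fin (R.N l)) : R.γ l n u = 0 :=
  hu.2 l hl le_rfl n

/-! ### Regularity of the data of the algorithm -/

theorem frame_mem_kerBar (hP : IsOpen P) : ∀ {l : ℕ}, 1 ≤ l → l ≤ R.nF → ∀ m,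
    R.frame l m ∈ kerBar L P := by
  intro l h1
  induction l, h1 using Nat.le_induction with
  | base => exact fun _ => R.frame_one_mem
  | succ l h1 ih =>
    intro h2 j
    exact kerBar_congr hP (sum_smul_mem_kerBar hP (ih (by omega)) (R.A_mem l h1 (by omega) j))
      (R.frame_succ l h1 (by omega) j)

theorem X_mem_SolBar (hP : IsOpen P) : ∀ {l : ℕ}, 1 ≤ l → l ≤ R.nF →
    R.X l ∈ SolBar L P (R.cSet 1) := by
  intro l h1
  induction l, h1 using Nat.le_induction with
  | base => exact fun _ => R.X_one
  | succ l h1 ih =>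
    intro h2
    exact SolBar_congr hP cSet_subset (add_sum_smul_mem_SolBar hP cSet_subset (ih (by omega))
      (frame_mem_kerBar hP h1 (by omega)) (R.w_mem l h1 (by omega))) (R.X_succ l h1 (by omega))

/-- The constraint functions are smooth on `P`, since all fields of the algorithm are. -/
theorem smoothFun_γ (hP : IsOpen P) (hL : SmoothFun P L) : ∀ {l : ℕ}, 1 ≤ l → l ≤ R.nF → ∀ n,
    SmoothFun P (R.γ l n) := by
  intro l h1
  induction l, h1 using Nat.le_induction with
  | base =>
    exact fun _ n => ((smoothFun_energy hP hL).act hP (R.frame_one_mem n).1).congr (R.γ_one n)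
  | succ l h1 ih =>
    intro h2 j
    exact ((SmoothFun.sum_mul (fun k => (R.B_mem l h1 (by omega) j k).1)
      (ih (by omega))).act hP (X_mem_SolBar hP h1 (by omega)).1).congr (R.γ_succ l h1 (by omega) j)

theorem gen_regular : ∀ {l : ℕ}, 1 ≤ l → l ≤ R.nF → ∀ n,
    SmoothField P (R.gen l n) ∧ ∀ w ∈ P, R.gen l n w ∈ kerOmega L w := by
  intro l h1
  induction l, h1 using Nat.le_induction with
  | base =>
    refine fun _ n => ⟨(R.frame_one_mem n).1.congr (R.gen_one n), fun w hw => ?_⟩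
    rw [R.gen_one n w hw]
    exact (R.frame_one_mem n).2.1 w hw
  | succ l h1 ih =>
    intro h2 j
    refine ⟨(SmoothField.sum_smul (fun k => (R.B_mem l h1 (by omega) j k).1)
      fun k => (ih (by omega) k).1).congr (R.gen_succ l h1 (by omega) j), fun w hw => ?_⟩
    rw [R.gen_succ l h1 (by omega) j w hw]
    exact Submodule.sum_mem _ fun k _ => Submodule.smul_mem _ _ ((ih (by omega) k).2 w hw)

/-- Independence modulo `𝒢` is inherited by the recombined fields, since the vectors
`A_j` are independent. -/
theorem frame_indep : ∀ {l : ℕ}, l + 1 ≤ R.nF → ∀ {u}, u ∈ R.cSet l →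
    LinearIndependent ℝ fun m => (calG L u).mkQ (R.frame (l + 1) m u) := by
  intro l
  induction l with
  | zero => exact fun _ u hu => R.frame_one_indep u hu.1
  | succ l ih =>
    intro h2 u hu
    have h := linearIndependent_sum_smul (ih (by omega) (cSet_anti (Nat.le_succ l) hu))
      (R.A_indep (l + 1) (by omega) (by omega) u hu)
    have e : (fun j => (calG L u).mkQ (R.frame (l + 1 + 1) j u)) =
        fun j => ∑ k, R.A (l + 1) j k u • (calG L u).mkQ (R.frame (l + 1) k u) := by
      funext j
      rw [R.frame_succ (l + 1) (by omega) (by omega) j u hu.1, map_sum]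
      simp only [map_smul]
    rw [e]
    exact h

theorem gen_indep : ∀ {l : ℕ}, l + 1 ≤ R.nF → ∀ {u}, u ∈ R.cSet l →
    LinearIndependent ℝ fun m => (calG L u).mkQ (R.gen (l + 1) m u) := by
  intro l
  induction l with
  | zero =>
    intro _ u hu
    have h := R.frame_one_indep u hu.1
    convert h using 3 with m
    exact R.gen_one m u hu.1
  | succ l ih =>
    intro h2 u hu
    have h := linearIndependent_sum_smul (ih (by omega) (cSet_anti (Nat.le_succ l) hu))
      (R.B_indep (l + 1) (by omega) (by omega) u hu)
    have e : (fun j => (calG L u).mkQ (R.gen (l + 1 + 1) j u)) =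
        fun j => ∑ k, R.B (l + 1) j k u • (calG L u).mkQ (R.gen (l + 1) k u) := by
      funext j
      rw [R.gen_succ (l + 1) (by omega) (by omega) j u hu.1, map_sum]
      simp only [map_smul]
    rw [e]
    exact h

/-! ### Tangency to the constraint submanifolds -/

/-- Vectors tangent to the constraint submanifold of order `l` kill the functions vanishing on
it. -/
theorem diff_eq_zero (hP : IsOpen P) {l : ℕ} (hl : l ≤ R.nF) (hu : u ∈ R.cSet l)
    {f : TQ D Q → ℝ} (hf : ∀ w ∈ R.cSet l, f w = 0) {v : T u} (hv : v ∈ R.tan l u) :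
    diff f u v = 0 := by
  rcases Nat.eq_zero_or_pos l with rfl | h1
  · have h : ∀ w ∈ P, f w = 0 := fun w hw => hf w ⟨hw, fun k h1 h2 => by omega⟩
    rw [diff_congr hP hu.1 (g := fun _ => 0) h, diff, mfderiv_const]
    rfl
  · refine (R.submanifold l h1 hl u hu).diff_eq_zero hu ?_ (R.rank_I l h1 hl u hu) hf ?_
    · rintro _ ⟨k, hk1, hk2, n, rfl⟩
      exact ⟨_, fun w hw => γ_eq_zero hk1 (cSet_anti hk2 hw) n, rfl⟩
    · rintro _ ⟨k, hk1, hk2, n, rfl⟩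
      exact hv k hk1 hk2 n

/-- Brackets of tangent fields are tangent. -/
theorem bracket_mem_tan (hP : IsOpen P) (hL : SmoothFun P L) {S X : VField D Q}
    (hS : SmoothField P S) (hX : SmoothField P X) {l i : ℕ} (hli : l ≤ i) (hi : i ≤ R.nF)
    (hSl : ∀ w ∈ R.cSet l, S w ∈ R.tan l w) (hXi : ∀ w ∈ R.cSet i, X w ∈ R.tan l w)
    (hu : u ∈ R.cSet i) (hSu : S u ∈ R.tan i u) : bracket S X u ∈ R.tan l u := by
  intro k h1 h2 n
  have h := act_bracket hP hS hX (smoothFun_γ (R := R) hP hL h1 (by omega) n) hu.1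
  have h3 : act S (act X (R.γ k n)) u = 0 :=
    diff_eq_zero hP hi hu (fun w hw => hXi w hw k h1 h2 n) hSu
  have h4 : act X (act S (R.γ k n)) u = 0 :=
    diff_eq_zero hP (hli.trans hi) (cSet_anti hli hu) (fun w hw => hSl w hw k h1 h2 n) (hXi u hu)
  rw [h3, h4, sub_zero] at h
  exact h

theorem calG_le_tan {l : ℕ} (hsec : ∀ u ∈ P, ∀ x ∈ calG L u, ∃ S ∈ SymL L P, S u = x)
    (hST : ∀ S ∈ SymL L P, ∀ w ∈ R.cSet l, S w ∈ R.tan l w) (hu : u ∈ R.cSet l) :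
    calG L u ≤ R.tan l u := by
  intro x hx
  obtain ⟨S, hS, rfl⟩ := hsec u hu.1 x hx
  exact hST S hS u hu

/-- The combinations of the constraint functions by the left kernel have differential
`∑ B dγ` on the constraint submanifold. -/
theorem diff_leftKernel (hP : IsOpen P) (hL : SmoothFun P L) {l : ℕ} (h1 : 1 ≤ l) (h2 : l < R.nF)
    (hu : u ∈ R.cSet l) (j : Fin (R.N (l + 1))) (v : T u) :
    diff (fun z => ∑ k, R.B l j k z * R.γ l k z) u v =
      ∑ k, R.B l j k u * diff (R.γ l k) u v := by
  rw [diff_sum_mul (fun k => (R.B_mem l h1 h2 j k).1.mdifferentiableAt hP hu.1)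
    (fun k => (smoothFun_γ hP hL h1 h2.le k).mdifferentiableAt hP hu.1)]
  refine Finset.sum_congr rfl fun k _ => ?_
  rw [γ_eq_zero h1 hu, zero_mul, add_zero]

/-- The undetermined directions are tangent to the zeros of the combinations of the constraint
functions by the left kernel of `Γ`. -/
theorem diff_leftKernel_eq_zero (hP : IsOpen P) (hL : SmoothFun P L) {l : ℕ} (h1 : 1 ≤ l)
    (h2 : l < R.nF) (hu : u ∈ R.cSet l) (hG : calG L u ≤ R.tan l u) (j : Fin (R.N (l + 1)))
    {v : T u} (hv : v ∈ Submodule.span ℝ (range fun m => R.frame l m u) ⊔ calG L u) :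
    diff (fun z => ∑ k, R.B l j k z * R.γ l k z) u v = 0 := by
  have hle : Submodule.span ℝ (range fun m => R.frame l m u) ⊔ calG L u ≤
      LinearMap.ker (diff (fun z => ∑ k, R.B l j k z * R.γ l k z) u : T u →ₗ[ℝ] ℝ) := by
    refine sup_le (Submodule.span_le.2 ?_) fun x hx => ?_
    · rintro _ ⟨m, rfl⟩
      exact (diff_leftKernel hP hL h1 h2 hu j _).trans (congrFun (R.B_ker l h1 h2 u hu j) m)
    · refine (diff_leftKernel hP hL h1 h2 hu j _).trans (Finset.sum_eq_zero fun k _ => ?_)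
      rw [hG hx l h1 le_rfl k, mul_zero]
  exact hle hv

/-- The undetermined directions of the next iteration are those tangent to the constraint
submanifold. -/
theorem span_frame_succ {l : ℕ} (h2 : l + 1 < R.nF) (hu : u ∈ R.cSet (l + 1))
    (hG : calG L u ≤ R.tan (l + 1) u)
    (hV : Submodule.span ℝ (range fun m => R.frame (l + 1) m u) ⊔ calG L u =
      kerOmega L u ⊓ R.tan l u) :
    Submodule.span ℝ (range fun m => R.frame (l + 1 + 1) m u) ⊔ calG L u =
      kerOmega L u ⊓ R.tan (l + 1) u := by
  have hframe := fun j => R.frame_succ (l + 1) (by omega) h2 j u hu.1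
  have hsum : ∀ (a : Fin (R.N (l + 1)) → ℝ) n,
      diff (R.γ (l + 1) n) u (∑ k, a k • R.frame (l + 1) k u) = (R.Gam (l + 1) u).mulVec a n := by
    intro a n
    rw [map_sum]
    refine Finset.sum_congr rfl fun k _ => ?_
    rw [map_smul, smul_eq_mul, mul_comm]
    rfl
  have hfm : ∀ m, R.frame (l + 1) m u ∈ kerOmega L u ⊓ R.tan l u := fun m => by
    rw [← hV]
    exact Submodule.mem_sup_left (Submodule.subset_span ⟨m, rfl⟩)
  refine le_antisymm (sup_le (Submodule.span_le.2 ?_) (le_inf calG_le_kerOmega hG)) ?_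
  · rintro _ ⟨j, rfl⟩
    have h : R.frame (l + 1 + 1) j u ∈ kerOmega L u ⊓ R.tan l u := by
      rw [hframe j]
      exact Submodule.sum_mem _ fun k _ => Submodule.smul_mem _ _ (hfm k)
    refine ⟨h.1, mem_tan_succ.2 ⟨h.2, fun n => ?_⟩⟩
    have h3 := hsum (fun k => R.A (l + 1) j k u) n
    rw [← hframe j] at h3
    exact h3.trans (congrFun (R.A_ker (l + 1) (by omega) h2 u hu j) n)
  · rintro x ⟨hx1, hx2⟩
    obtain ⟨hx3, hx4⟩ := mem_tan_succ.1 hx2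
    have hx5 : x ∈ Submodule.span ℝ (range fun m => R.frame (l + 1) m u) ⊔ calG L u := by
      rw [hV]; exact ⟨hx1, hx3⟩
    obtain ⟨y, hy, g, hg, rfl⟩ := Submodule.mem_sup.1 hx5
    obtain ⟨a, rfl⟩ := (Submodule.mem_span_range_iff_exists_fun ℝ).1 hy
    have ha : (R.Gam (l + 1) u).mulVec a = 0 := by
      funext n
      have h3 := hx4 n
      rw [map_add, hG hg (l + 1) (by omega) le_rfl n, add_zero, hsum] at h3
      exact h3
    obtain ⟨b, rfl⟩ := exists_eq_sum_of_mulVec_eq_zero (R.rank_eq (l + 1) (by omega) h2 u hu)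
      (R.A_indep (l + 1) (by omega) h2 u hu) (R.A_ker (l + 1) (by omega) h2 u hu) ha
    refine Submodule.add_mem_sup ?_ hg
    have h4 : ∑ k, (∑ j, b j • fun k => R.A (l + 1) j k u) k • R.frame (l + 1) k u =
        ∑ j, b j • R.frame (l + 1 + 1) j u := by
      simp only [hframe, Finset.smul_sum, Finset.sum_apply, Pi.smul_apply, Finset.sum_smul,
        smul_smul, smul_eq_mul]
      exact Finset.sum_comm
    rw [h4]
    exact Submodule.sum_mem _ fun j _ => Submodule.smul_mem _ _ (Submodule.subset_span ⟨j, rfl⟩)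

theorem X_mem_tan_succ {l : ℕ} (h2 : l + 1 < R.nF) (hu : u ∈ R.cSet (l + 1 + 1))
    (hX : R.X (l + 1) u ∈ R.tan l u) (hf : ∀ m, R.frame (l + 1) m u ∈ R.tan l u) :
    R.X (l + 1 + 1) u ∈ R.tan (l + 1) u := by
  rw [R.X_succ (l + 1) (by omega) h2 u hu.1]
  refine mem_tan_succ.2 ⟨add_mem hX (Submodule.sum_mem _ fun k _ =>
    Submodule.smul_mem _ _ (hf k)), fun n => ?_⟩
  have h := R.w_eq (l + 1) (by omega) h2 u hu n
  rw [map_add, map_sum]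
  have h3 : ∑ k, diff (R.γ (l + 1) n) u (R.w (l + 1) k u • R.frame (l + 1) k u) =
      (GammaMat (R.frame (l + 1)) (R.γ (l + 1)) u).mulVec (fun k => R.w (l + 1) k u) n := by
    refine Finset.sum_congr rfl fun k _ => ?_
    rw [map_smul, smul_eq_mul, mul_comm]
    rfl
  rw [h3, h]
  exact add_neg_cancel _

/-- If `S E = 0` on `P`, then `S γ_n = S (P_n E) = [S, P_n] E`, and `[S, P_n]` is in `ker Ω_L`, the
vectors of which annihilate `E` where the first-order constraints hold. -/
theorem symL_mem_tan_one (hP : IsOpen P) (hL : SmoothFun P L) {S : VField D Q}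
    (hS : S ∈ SymL L P) (hu : u ∈ R.cSet 1) : S u ∈ R.tan 1 u := by
  refine mem_tan_succ.2 ⟨mem_tan_zero _, fun n => ?_⟩
  have hE := smoothFun_energy hP hL
  have hf := R.frame_one_mem n
  have h := act_bracket hP hS.1.1 hf.1 hE hu.1
  have h1 : act (R.frame 1 n) (act S (energy L)) u = 0 := by
    rw [act, diff_congr hP hu.1 (g := fun _ => 0) hS.2, diff, mfderiv_const]
    rfl
  have h2 : act S (R.γ 1 n) u = act S (act (R.frame 1 n) (energy L)) u := by
    rw [act, diff_congr hP hu.1 (R.γ_one n)]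
    rfl
  have h3 := bracket_mem_kerOmega_of_mem_kerOmega hP hL hS.1.1 hf.1 hS.1.2.1 hf.2.1 hu.1
  rw [R.frame_one_span u hu.1] at h3
  have hle : Submodule.span ℝ (range fun m => R.frame 1 m u) ⊔ calG L u ≤
      LinearMap.ker (diff (energy L) u : T u →ₗ[ℝ] ℝ) := by
    refine sup_le (Submodule.span_le.2 ?_) fun x hx => diff_energy_of_mem_calG hP hL hu.1 hx
    rintro _ ⟨m, rfl⟩
    exact (R.γ_one m u hu.1).symm.trans (γ_eq_zero le_rfl hu m)
  have h4 : act (bracket S (R.frame 1 n)) (energy L) u = 0 := hle h3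
  rw [h4, h1, sub_zero] at h
  exact h2.trans h.symm

/-- The inductive step: a symmetry tangent to the constraint submanifold of one order is tangent to
that of the next. -/
theorem symL_mem_tan_succ (hP : IsOpen P) (hL : SmoothFun P L)
    (hsec : ∀ u ∈ P, ∀ x ∈ calG L u, ∃ S ∈ SymL L P, S u = x) {l : ℕ} (h2 : l + 1 < R.nF)
    (hV : ∀ u ∈ R.cSet l, Submodule.span ℝ (range fun m => R.frame (l + 1) m u) ⊔ calG L u =
      kerOmega L u ⊓ R.tan l u)
    (hX : ∀ u ∈ R.cSet (l + 1), R.X (l + 1) u ∈ R.tan l u)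
    (hST : ∀ S ∈ SymL L P, ∀ w ∈ R.cSet l, S w ∈ R.tan l w)
    (hST' : ∀ S ∈ SymL L P, ∀ w ∈ R.cSet (l + 1), S w ∈ R.tan (l + 1) w)
    {S : VField D Q} (hS : S ∈ SymL L P) (hu : u ∈ R.cSet (l + 1 + 1)) :
    S u ∈ R.tan (l + 1 + 1) u := by
  have hu1 : u ∈ R.cSet (l + 1) := cSet_anti (Nat.le_succ _) hu
  have hu0 : u ∈ R.cSet l := cSet_anti (Nat.le_succ _) hu1
  refine mem_tan_succ.2 ⟨hST' S hS u hu1, fun j => ?_⟩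
  have hSol := X_mem_SolBar (R := R) hP (l := l + 1) (by omega) h2.le
  have hfr := frame_mem_kerBar (R := R) hP (l := l + 1) (by omega) h2.le
  have hfV : ∀ w ∈ R.cSet l, ∀ m, R.frame (l + 1) m w ∈ kerOmega L w ⊓ R.tan l w :=
    fun w hw m => by
      rw [← hV w hw]
      exact Submodule.mem_sup_left (Submodule.subset_span ⟨m, rfl⟩)
  set g : TQ D Q → ℝ := fun z => ∑ k, R.B (l + 1) j k z * R.γ (l + 1) k z with hg
  have hgs : SmoothFun P g := SmoothFun.sum_mul (fun k => (R.B_mem (l + 1) (by omega) h2 j k).1)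
    (smoothFun_γ hP hL (by omega) h2.le)
  -- the undetermined directions are tangent to the zeros of `g`
  have hgV : ∀ w ∈ R.cSet (l + 1), ∀ v ∈ kerOmega L w ⊓ R.tan l w, diff g w v = 0 := by
    intro w hw v hv
    rw [← hV w (cSet_anti (Nat.le_succ _) hw)] at hv
    exact diff_leftKernel_eq_zero hP hL (by omega) h2 hw (calG_le_tan hsec hST' hw) j hv
  have hSX : bracket S (R.X (l + 1)) u ∈ kerOmega L u ⊓ R.tan l u := by
    refine ⟨bracket_mem_kerOmega hP hL hS.1.1 hSol.1 (smoothFun_energy hP hL) hS.1.2.1 hS.2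
      cSet_subset hSol.2.1 (cSet_anti (by omega) hu) fun f hf => ?_, ?_⟩
    · exact diff_eq_zero hP h2.le hu1 (fun w hw => hf w (cSet_anti (by omega) hw)) (hST' S hS u hu1)
    · exact bracket_mem_tan hP hL hS.1.1 hSol.1 (Nat.le_succ l) h2.le (hST S hS) hX hu1
        (hST' S hS u hu1)
  have hSf : ∀ m, bracket S (R.frame (l + 1) m) u ∈ kerOmega L u ⊓ R.tan l u := fun m =>
    ⟨bracket_mem_kerOmega_of_mem_kerOmega hP hL hS.1.1 (hfr m).1 hS.1.2.1 (hfr m).2.1 hu.1,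
      bracket_mem_tan hP hL hS.1.1 (hfr m).1 le_rfl (by omega) (hST S hS)
        (fun w hw => (hfV w hw m).2) hu0 (hST S hS u hu0)⟩
  have h0 : act S (R.γ (l + 1 + 1) j) u = act S (act (R.X (l + 1)) g) u := by
    rw [act, diff_congr hP hu.1 (R.γ_succ (l + 1) (by omega) h2 j)]
    rfl
  have h1 := act_bracket hP hS.1.1 hSol.1 hgs hu.1
  have h3 : act (bracket S (R.X (l + 1))) g u = 0 := hgV u hu1 _ hSX
  -- the function `S g` vanishes on the constraint submanifold of order `l + 1`
  have hSg : ∀ w ∈ R.cSet (l + 1), act S g w = 0 := by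
    intro w hw
    refine (diff_leftKernel hP hL (by omega) h2 hw j _).trans (Finset.sum_eq_zero fun k _ => ?_)
    rw [hST' S hS w hw (l + 1) (by omega) le_rfl k, mul_zero]
  have h4 : ∀ m, diff (act S g) u (R.frame (l + 1) m u) = 0 := by
    intro m
    have h5 := act_bracket hP hS.1.1 (hfr m).1 hgs hu.1
    have h6 : act (bracket S (R.frame (l + 1) m)) g u = 0 := hgV u hu1 _ (hSf m)
    have h7 : act S (act (R.frame (l + 1) m) g) u = 0 :=
      diff_eq_zero hP h2.le hu1 (fun w hw => hgV w hw _ (hfV w (cSet_anti (Nat.le_succ _) hw) m))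
        (hST' S hS u hu1)
    rw [h6, h7, zero_sub, eq_comm, neg_eq_zero] at h5
    exact h5
  -- the next field of the algorithm is tangent to it and differs by undetermined directions
  have h8 : diff (act S g) u (R.X (l + 1 + 1) u) = 0 :=
    diff_eq_zero hP h2.le hu1 hSg (X_mem_tan_succ h2 hu (hX u hu1) fun m => (hfV u hu0 m).2)
  rw [R.X_succ (l + 1) (by omega) h2 u hu.1, map_add, map_sum] at h8
  simp only [map_smul, h4, smul_zero, Finset.sum_const_zero, add_zero] at h8
  have h9 : act (R.X (l + 1)) (act S g) u = 0 := h8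
  rw [h3, h9, sub_zero] at h1
  exact h0.trans h1.symm

/-- The simultaneous induction on the order: the undetermined directions are the vectors of
`ker Ω_L` tangent to the preceding constraint submanifold, the determined field is tangent to the
preceding constraint submanifold, and the symmetries are tangent to all constraint submanifolds. -/
theorem tangency (hP : IsOpen P) (hL : SmoothFun P L)
    (hsec : ∀ u ∈ P, ∀ x ∈ calG L u, ∃ S ∈ SymL L P, S u = x) : ∀ {l : ℕ}, l + 1 ≤ R.nF →
    (∀ u ∈ R.cSet l, Submodule.span ℝ (range fun m => R.frame (l + 1) m u) ⊔ calG L u =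
      kerOmega L u ⊓ R.tan l u) ∧
    (∀ u ∈ R.cSet (l + 1), R.X (l + 1) u ∈ R.tan l u) ∧
    (∀ S ∈ SymL L P, ∀ w ∈ R.cSet l, S w ∈ R.tan l w) ∧
    (∀ S ∈ SymL L P, ∀ w ∈ R.cSet (l + 1), S w ∈ R.tan (l + 1) w) := by
  intro l
  induction l with
  | zero =>
    intro _
    refine ⟨fun u hu => ?_, fun u _ => mem_tan_zero _, fun S _ w _ => mem_tan_zero _,
      fun S hS w hw => symL_mem_tan_one hP hL hS hw⟩
    have h : R.tan 0 u = ⊤ := eq_top_iff.2 fun v _ => mem_tan_zero v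
    rw [h, inf_top_eq]
    exact (R.frame_one_span u hu.1).symm
  | succ l ih =>
    intro h2
    obtain ⟨hV, hX, hST, hST'⟩ := ih (by omega)
    refine ⟨fun u hu => ?_, fun u hu => ?_, hST', fun S hS w hw =>
      symL_mem_tan_succ hP hL hsec (by omega) hV hX hST hST' hS hw⟩
    · exact span_frame_succ (by omega) hu (calG_le_tan hsec hST' hu)
        (hV u (cSet_anti (Nat.le_succ _) hu))
    · have hu1 : u ∈ R.cSet (l + 1) := cSet_anti (Nat.le_succ _) hu
      refine X_mem_tan_succ (by omega) hu (hX u hu1) fun m => ?_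
      have hmem : R.frame (l + 1) m u ∈ kerOmega L u ⊓ R.tan l u := by
        rw [← hV u (cSet_anti (Nat.le_succ _) hu1)]
        exact Submodule.mem_sup_left (Submodule.subset_span ⟨m, rfl⟩)
      exact hmem.2

end ConstraintAlgorithm
end Algorithm

/-! ### Generators, stopping rule and final solutions -/

section Consequences

variable {D : ℕ} {Q : Type*} [TopologicalSpace Q] [ChartedSpace (Model D) Q]
  [IsManifold 𝓘(ℝ, Model D) ∞ Q]
variable {P : Set (TQ D Q)} {L : TQ D Q → ℝ} {u : TQ D Q}

/-- The condition `hsec`, here and below, is that `𝒢` is spanned by its sections; these are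
symmetries. -/
theorem calG_le_symSpace (hsec : ∀ u ∈ P, ∀ x ∈ calG L u, ∃ S ∈ SymL L P, S u = x) (hu : u ∈ P) :
    calG L u ≤ symSpace L P u := by
  intro x hx
  obtain ⟨S, hS, rfl⟩ := hsec u hu x hx
  exact mem_symSpace hS

theorem symSpace_le_kerOmega (hu : u ∈ P) : symSpace L P u ≤ kerOmega L u :=
  symSpace_le_iff.2 fun _ hS => hS.1.2.1 u hu

theorem eq_of_sum_sub_sum_mem {V : Type*} [AddCommGroup V] [Module ℝ V] {W : Submodule ℝ V} {N : ℕ}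
    {v : Fin N → V} (hv : LinearIndependent ℝ fun n => W.mkQ (v n)) {a b : Fin N → ℝ}
    (h : ∑ n, a n • v n - ∑ n, b n • v n ∈ W) : a = b := by
  rw [← Submodule.Quotient.mk_eq_zero, ← Submodule.mkQ_apply, map_sub, map_sum, map_sum,
    sub_eq_zero] at h
  simp only [map_smul] at h
  exact hv.fintypeLinearCombination_injective h

instance : FiniteDimensional ℝ (T u) := inferInstanceAs (FiniteDimensional ℝ (Model D × Model D))

theorem finrank_tangentSpace : Module.finrank ℝ (T u) = 2 * D := by
  have h : Module.finrank ℝ (T u) = Module.finrank ℝ (Model D × Model D) := rfl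
  rw [h, Module.finrank_prod, finrank_euclideanSpace_fin]
  ring

namespace ConstraintAlgorithm

variable {R : ConstraintAlgorithm L P}

/-! ### Generators of the constraint functions -/

/-- If symmetries have vanishing constraint functions on the constraint submanifold of one order,
the combinations of `dγ` which belong to them vanish on its tangent vectors. -/
theorem sum_mul_diff_γ_eq_zero (hP : IsOpen P) (hL : SmoothFun P L)
    (hsec : ∀ u ∈ P, ∀ x ∈ calG L u, ∃ S ∈ SymL L P, S u = x) {l : ℕ} (hl : l + 1 ≤ R.nF)
    (hG : ∀ u ∈ R.cSet l, symSpace L P u ≤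
        Submodule.span ℝ (range fun n => R.gen (l + 1) n u) ⊔ calG L u ∧
      ∀ c : Fin (R.N (l + 1)) → ℝ, ∑ n, c n • R.gen (l + 1) n u ∈ symSpace L P u →
        ∑ n, c n * R.γ (l + 1) n u = 0)
    (hu : u ∈ R.cSet (l + 1)) {c : Fin (R.N (l + 1)) → ℝ}
    (hc : ∑ n, c n • R.gen (l + 1) n u ∈ symSpace L P u) {v : T u} (hv : v ∈ R.tan l u) :
    ∑ n, c n * diff (R.γ (l + 1) n) u v = 0 := by
  have hu0 : u ∈ R.cSet l := cSet_anti (Nat.le_succ l) hu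
  have hgen := gen_regular (R := R) (l := l + 1) (by omega) hl
  have key : ∀ x ∈ symSpace L P u, ∃ a : Fin (R.N (l + 1)) → ℝ,
      x - ∑ n, a n • R.gen (l + 1) n u ∈ calG L u ∧
        ∑ n, a n * diff (R.γ (l + 1) n) u v = 0 := by
    intro x hx
    induction hx using Submodule.span_induction with
    | mem x hx =>
      obtain ⟨S, hS, rfl⟩ := hx
      obtain ⟨s, hs, hev⟩ := exists_coeff_modulo_calG hP (fun n => (hgen n).1) hS.1.1
        (fun n => (hgen n).2) hS.1.2.1 hu.1 (gen_indep hl hu0)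
      -- the constraint function of `S`, extended by `0` off the domain of the coefficients
      classical
      let f : TQ D Q → ℝ := fun w =>
        if S w ∈ Submodule.span ℝ (range fun n => R.gen (l + 1) n w) ⊔ calG L w →
          S w - ∑ n, s n w • R.gen (l + 1) n w ∈ calG L w
        then ∑ n, s n w * R.γ (l + 1) n w else 0
      have hf : ∀ w ∈ R.cSet l, f w = 0 := by
        intro w hw
        by_cases h : S w ∈ Submodule.span ℝ (range fun n => R.gen (l + 1) n w) ⊔ calG L w →
          S w - ∑ n, s n w • R.gen (l + 1) n w ∈ calG L w
        · have h1 := h ((hG w hw).1 (mem_symSpace hS))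
          have h2 := sub_mem (mem_symSpace (u := w) hS) (calG_le_symSpace hsec hw.1 h1)
          rw [sub_sub_cancel] at h2
          simp only [f, if_pos h]
          exact (hG w hw).2 _ h2
        · simp only [f, if_neg h]
      have hfe : f =ᶠ[𝓝 u] fun w => ∑ n, s n w * R.γ (l + 1) n w := by
        filter_upwards [hev] with w hw using if_pos hw
      have h3 := diff_eq_zero hP (by omega) hu0 hf hv
      rw [diff, hfe.mfderiv_eq] at h3
      refine ⟨fun n => s n u, hev.self_of_nhds ((hG u hu0).1 (mem_symSpace hS)), ?_⟩
      have h4 := diff_sum_mul hs (fun n => (smoothFun_γ (R := R) (l := l + 1) hP hL (by omega) hl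
        n).mdifferentiableAt hP hu.1) v
      refine Eq.trans ?_ (h4.symm.trans h3)
      refine Finset.sum_congr rfl fun n _ => ?_
      rw [γ_eq_zero (by omega) hu, zero_mul, add_zero]
    | zero => exact ⟨0, by simp, by simp⟩
    | add x y _ _ hx hy =>
      obtain ⟨a, ha, ha'⟩ := hx
      obtain ⟨b, hb, hb'⟩ := hy
      refine ⟨a + b, ?_, ?_⟩
      · simp only [Pi.add_apply, add_smul, Finset.sum_add_distrib]
        rw [add_sub_add_comm]
        exact add_mem ha hb
      · simp only [Pi.add_apply, add_mul, Finset.sum_add_distrib]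
        rw [ha', hb', add_zero]
    | smul r x _ hx =>
      obtain ⟨a, ha, ha'⟩ := hx
      refine ⟨r • a, ?_, ?_⟩
      · simp only [Pi.smul_apply, smul_assoc, ← Finset.smul_sum]
        rw [← smul_sub]
        exact Submodule.smul_mem _ _ ha
      · simp only [Pi.smul_apply, smul_eq_mul, mul_assoc, ← Finset.mul_sum]
        rw [ha', mul_zero]
  obtain ⟨a, ha, ha'⟩ := key _ hc
  rw [eq_of_sum_sub_sum_mem (gen_indep hl hu0) ha]
  exact ha'

theorem sum_gen_succ {l : ℕ} (h1 : 1 ≤ l) (h2 : l < R.nF) (hu : u ∈ P)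
    (b : Fin (R.N (l + 1)) → ℝ) :
    ∑ j, b j • R.gen (l + 1) j u = ∑ k, (∑ j, b j * R.B l j k u) • R.gen l k u := by
  simp only [R.gen_succ l h1 h2 _ u hu, Finset.smul_sum, Finset.sum_smul, smul_smul]
  exact Finset.sum_comm

/-- On the constraint submanifold of order `l`, the symmetries are among the generators of the
constraint functions of order `l + 1`, and their constraint functions vanish there. -/
theorem symSpace_le_span_gen (hP : IsOpen P) (hL : SmoothFun P L)
    (hsec : ∀ u ∈ P, ∀ x ∈ calG L u, ∃ S ∈ SymL L P, S u = x) : ∀ {l : ℕ}, l + 1 ≤ R.nF →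
    ∀ u ∈ R.cSet l, symSpace L P u ≤
        Submodule.span ℝ (range fun n => R.gen (l + 1) n u) ⊔ calG L u ∧
      ∀ c : Fin (R.N (l + 1)) → ℝ, ∑ n, c n • R.gen (l + 1) n u ∈ symSpace L P u →
        ∑ n, c n * R.γ (l + 1) n u = 0 := by
  intro l
  induction l with
  | zero =>
    intro _ u hu
    have hgen : ∀ n, R.gen (0 + 1) n u = R.frame (0 + 1) n u := fun n => R.gen_one n u hu.1
    constructor
    · simp only [hgen]
      exact (symSpace_le_kerOmega hu.1).trans (R.frame_one_span u hu.1).le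
    · intro c hc
      have h : symSpace L P u ≤ LinearMap.ker (diff (energy L) u : T u →ₗ[ℝ] ℝ) :=
        symSpace_le_iff.2 fun S hS => hS.2 u hu.1
      have h1 : diff (energy L) u (∑ n, c n • R.gen (0 + 1) n u) = 0 := h hc
      rw [map_sum] at h1
      refine Eq.trans (Finset.sum_congr rfl fun n _ => ?_) h1
      rw [map_smul, hgen, smul_eq_mul]
      exact congrArg _ (R.γ_one n u hu.1)
  | succ l ih =>
    intro h2 u hu
    have hu0 : u ∈ R.cSet l := cSet_anti (Nat.le_succ l) hu
    have ih' := ih (by omega)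
    have htan := tangency (R := R) hP hL hsec (l := l) (by omega)
    have hC := fun (c : Fin (R.N (l + 1)) → ℝ) hc (v : T u) hv =>
      sum_mul_diff_γ_eq_zero (c := c) (v := v) hP hL hsec (by omega) ih' hu hc hv
    constructor
    · intro x hx
      obtain ⟨y, hy, g, hg, rfl⟩ := Submodule.mem_sup.1 ((ih' u hu0).1 hx)
      obtain ⟨c, rfl⟩ := (Submodule.mem_span_range_iff_exists_fun ℝ).1 hy
      have hc : ∑ n, c n • R.gen (l + 1) n u ∈ symSpace L P u := by
        have := sub_mem hx (calG_le_symSpace hsec hu.1 hg)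
        rwa [add_sub_cancel_right] at this
      have hker : (R.Gam (l + 1) u).transpose.mulVec c = 0 := by
        rw [Matrix.mulVec_transpose]
        funext m
        refine hC c hc (R.frame (l + 1) m u) ?_
        have h3 : R.frame (l + 1) m u ∈ kerOmega L u ⊓ R.tan l u := by
          rw [← htan.1 u hu0]
          exact Submodule.mem_sup_left (Submodule.subset_span ⟨m, rfl⟩)
        exact h3.2
      obtain ⟨b, rfl⟩ := exists_eq_sum_of_mulVec_eq_zero
        (by rw [Matrix.rank_transpose]; exact R.rank_eq (l + 1) (by omega) h2 u hu)
        (R.B_indep (l + 1) (by omega) h2 u hu)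
        (fun j => by rw [Matrix.mulVec_transpose]; exact R.B_ker (l + 1) (by omega) h2 u hu j) hker
      refine Submodule.add_mem_sup ?_ hg
      refine (Submodule.mem_span_range_iff_exists_fun ℝ).2 ⟨b, ?_⟩
      rw [sum_gen_succ (by omega) h2 hu.1]
      refine Finset.sum_congr rfl fun k _ => ?_
      rw [Finset.sum_apply]
      rfl
    · intro b hb
      rw [sum_gen_succ (by omega) h2 hu.1] at hb
      have h3 := hC _ hb (R.X (l + 1) u) (htan.2.1 u hu)
      refine Eq.trans ?_ h3
      have h4 : ∀ j, R.γ (l + 1 + 1) j u =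
          ∑ k, R.B (l + 1) j k u * diff (R.γ (l + 1) k) u (R.X (l + 1) u) := fun j =>
        (R.γ_succ (l + 1) (by omega) h2 j u hu.1).trans
          (diff_leftKernel hP hL (by omega) h2 hu j _)
      simp only [h4, Finset.mul_sum, Finset.sum_mul, mul_assoc]
      exact Finset.sum_comm

/-! ### The end of the algorithm -/

/-- The span of the differentials of the constraint functions of orders `1, …, l`. -/
def conormal (R : ConstraintAlgorithm L P) (l : ℕ) (u : TQ D Q) : Submodule ℝ (T u →L[ℝ] ℝ) :=
  Submodule.span ℝ {α | ∃ k, 1 ≤ k ∧ k ≤ l ∧ ∃ n : Fin (R.N k), α = diff (R.γ k n) u}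

theorem apply_eq_zero_of_mem_conormal {l : ℕ} {α : T u →L[ℝ] ℝ} (hα : α ∈ R.conormal l u) {v : T u}
    (hv : v ∈ R.tan l u) : α v = 0 := by
  refine Submodule.span_induction (p := fun α _ => α v = 0) ?_ (by simp) ?_ ?_ hα
  · rintro _ ⟨k, h1, h2, n, rfl⟩
    exact hv k h1 h2 n
  · intro a b _ _ ha hb
    rw [add_apply, ha, hb, add_zero]
  · intro c a _ ha
    rw [smul_apply, ha, smul_zero]

theorem diff_mem_conormal {k l : ℕ} (h1 : 1 ≤ k) (h2 : k ≤ l) (n : Fin (R.N k)) :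
    diff (R.γ k n) u ∈ R.conormal l u :=
  Submodule.subset_span ⟨k, h1, h2, n, rfl⟩

theorem N_eq_zero_of_N_one_eq_zero (h : R.N 1 = 0) : ∀ {l : ℕ}, 1 ≤ l → l ≤ R.nF → R.N l = 0 := by
  intro l h1
  obtain ⟨u, hu⟩ := R.nonempty
  induction l, h1 using Nat.le_induction with
  | base => exact fun _ => h
  | succ l h1 ih =>
    intro h2
    have h3 := R.rank_eq l h1 (by omega) u (cSet_anti (R := R) (by omega) hu)
    have h4 := ih (by omega)
    omega

/-- By the stopping rule, the last iteration yields no condition on tangent vectors. -/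
theorem tan_pred_le_tan (hP : IsOpen P) (hL : SmoothFun P L)
    (hsec : ∀ u ∈ P, ∀ x ∈ calG L u, ∃ S ∈ SymL L P, S u = x) {l : ℕ} (hl : l + 1 = R.nF)
    (hu : u ∈ R.cSet R.nF) : R.tan l u ≤ R.tan R.nF u := by
  have h2 := R.two_le
  have hfin : FiniteDimensional ℝ (T u →L[ℝ] ℝ) :=
    inferInstanceAs (FiniteDimensional ℝ ((Model D × Model D) →L[ℝ] ℝ))
  have hr : Module.finrank ℝ (R.conormal R.nF u) = R.I R.nF := R.rank_I R.nF (by omega) le_rfl u hu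
  rcases R.stops with h | h
  · have hr' : Module.finrank ℝ (R.conormal l u) = R.I l :=
      R.rank_I l (by omega) (by omega) u (cSet_anti (R := R) (by omega) hu)
    have hle : R.conormal l u ≤ R.conormal R.nF u :=
      Submodule.span_mono fun α ⟨k, h3, h4, h5⟩ => ⟨k, h3, by omega, h5⟩
    have hl' : R.nF - 1 = l := by omega
    rw [hl'] at h
    have heq := Submodule.eq_of_le_of_finrank_eq hle (by rw [hr, hr', h])
    intro v hv k h3 h4 n
    refine apply_eq_zero_of_mem_conormal (l := l) ?_ hv
    rw [heq]
    exact diff_mem_conormal h3 h4 n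
  · -- the final constraint submanifold is discrete, so that `𝒢` and `ker Ω_L` are zero
    have : T2Space (T u) := inferInstanceAs (T2Space (Model D × Model D))
    let e : (T u →ₗ[ℝ] ℝ) ≃ₗ[ℝ] (T u →L[ℝ] ℝ) := LinearMap.toContinuousLinearMap
    have htop : R.conormal R.nF u = ⊤ := by
      refine Submodule.eq_top_of_finrank_eq ?_
      have h3 : Module.finrank ℝ (Module.Dual ℝ (T u)) = 2 * D :=
        Subspace.dual_finrank_eq.trans finrank_tangentSpace
      rw [hr, h, ← e.finrank_eq]
      exact h3.symm
    have hbot : R.tan R.nF u = ⊥ := by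
      refine (Submodule.eq_bot_iff _).2 fun v hv => ?_
      refine (Module.forall_dual_apply_eq_zero_iff ℝ v).1 fun α => ?_
      exact apply_eq_zero_of_mem_conormal (R := R) (l := R.nF) (α := e α)
        (by rw [htop]; trivial) hv
    have hST := (tangency (R := R) hP hL hsec (l := l) hl.le).2.2.2
    rw [hl] at hST
    have hG : calG L u = ⊥ := eq_bot_iff.2 (hbot ▸ calG_le_tan hsec hST hu)
    have hK := kerOmega_eq_bot_of_calG_eq_bot hP hL hu.1 hG
    have hN1 : R.N 1 = 0 := by
      by_contra hne
      have n : Fin (R.N 1) := ⟨0, Nat.pos_of_ne_zero hne⟩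
      refine (R.frame_one_indep u hu.1).ne_zero n ?_
      have h3 : R.frame 1 n u ∈ kerOmega L u := (R.frame_one_mem n).2.1 u hu.1
      rw [hK, Submodule.mem_bot] at h3
      rw [h3, map_zero]
    have hN : R.N R.nF = 0 := N_eq_zero_of_N_one_eq_zero hN1 (by omega) le_rfl
    intro v hv
    rw [← hl]
    refine mem_tan_succ.2 ⟨hv, fun n => ?_⟩
    rw [← hl] at hN
    exact absurd n.2 (by omega)

theorem span_frame_nF (hP : IsOpen P) (hL : SmoothFun P L)
    (hsec : ∀ u ∈ P, ∀ x ∈ calG L u, ∃ S ∈ SymL L P, S u = x) (hu : u ∈ R.cSet R.nF) :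
    Submodule.span ℝ (range fun m => R.frame R.nF m u) ⊔ calG L u =
      kerOmega L u ⊓ R.tan R.nF u := by
  obtain ⟨l, hl⟩ : ∃ l, l + 1 = R.nF := ⟨R.nF - 1, by have := R.two_le; omega⟩
  have h := (tangency (R := R) hP hL hsec (l := l) hl.le).1 u (cSet_anti (by omega) hu)
  rw [hl] at h
  rw [h, le_antisymm (tan_pred_le_tan hP hL hsec hl hu) (tan_anti (by omega))]

theorem X_nF_mem_tan (hP : IsOpen P) (hL : SmoothFun P L)
    (hsec : ∀ u ∈ P, ∀ x ∈ calG L u, ∃ S ∈ SymL L P, S u = x) (hu : u ∈ R.cSet R.nF) :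
    R.X R.nF u ∈ R.tan R.nF u := by
  obtain ⟨l, hl⟩ : ∃ l, l + 1 = R.nF := ⟨R.nF - 1, by have := R.two_le; omega⟩
  refine tan_pred_le_tan hP hL hsec hl hu ?_
  have h := (tangency (R := R) hP hL hsec (l := l) hl.le).2.1 u (by rwa [hl])
  rwa [hl] at h

theorem symL_mem_tan_nF (hP : IsOpen P) (hL : SmoothFun P L)
    (hsec : ∀ u ∈ P, ∀ x ∈ calG L u, ∃ S ∈ SymL L P, S u = x) {S : VField D Q} (hS : S ∈ SymL L P)
    (hu : u ∈ R.cSet R.nF) : S u ∈ R.tan R.nF u := by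
  obtain ⟨l, hl⟩ : ∃ l, l + 1 = R.nF := ⟨R.nF - 1, by have := R.two_le; omega⟩
  have h := (tangency (R := R) hP hL hsec (l := l) hl.le).2.2.2 S hS u (by rwa [hl])
  rwa [hl] at h

/-! ### The final solutions -/

/-- The condition `𝔏_X β[X] = 0` follows from tangency, as `β[X]` vanishes on the constraint
submanifold. -/
theorem mem_finalSol_iff (hP : IsOpen P) {X : VField D Q} :
    X ∈ R.finalSol ↔ X ∈ SolBar L P (R.cSet 1) ∧ ∀ u ∈ R.cSet R.nF, X u ∈ R.tan R.nF u := by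
  have h2 := R.two_le
  constructor
  · exact fun h => ⟨h.1, fun u hu k h3 h4 n => h.2.2 k h3 h4 n u hu⟩
  · rintro ⟨hX, hT⟩
    refine ⟨hX, fun Z _ u hu => ?_, fun k h3 h4 n u hu => hT u hu k h3 h4 n⟩
    have hβ : ∀ w ∈ R.cSet R.nF, ∀ y, beta L X w y = 0 := fun w hw y => by
      rw [beta, hX.2.1 w (cSet_anti (by omega) hw) y, sub_self]
    have h3 : act X (fun w => beta L X w (Z w)) u = 0 :=
      diff_eq_zero hP le_rfl hu (fun w hw => hβ w hw _) (hT u hu)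
    rw [lieDeriv, h3, hβ u hu, sub_zero]

theorem add_sum_smul_mem_finalSol (hP : IsOpen P) {X : VField D Q} (hX : X ∈ R.finalSol) {N : ℕ}
    {Y : Fin N → VField D Q} {f : Fin N → TQ D Q → ℝ} (hY : ∀ n, Y n ∈ kerBar L P)
    (hYT : ∀ n, ∀ u ∈ R.cSet R.nF, Y n u ∈ R.tan R.nF u) (hf : ∀ n, f n ∈ Fbar L P) :
    (fun w => X w + ∑ n, f n w • Y n w) ∈ R.finalSol := by
  obtain ⟨h1, h2⟩ := (mem_finalSol_iff hP).1 hX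
  exact (mem_finalSol_iff hP).2 ⟨add_sum_smul_mem_SolBar hP cSet_subset h1 hY hf, fun u hu =>
    add_mem (h2 u hu) (Submodule.sum_mem _ fun n _ => Submodule.smul_mem _ _ (hYT n u hu))⟩

theorem add_sum_frame_mem_finalSol (hP : IsOpen P) (hL : SmoothFun P L)
    (hsec : ∀ u ∈ P, ∀ x ∈ calG L u, ∃ S ∈ SymL L P, S u = x)
    {f : Fin (R.N R.nF) → TQ D Q → ℝ} (hf : ∀ m, f m ∈ Fbar L P) :
    (fun u => R.X R.nF u + ∑ m, f m u • R.frame R.nF m u) ∈ R.finalSol := by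
  have h2 := R.two_le
  refine add_sum_smul_mem_finalSol hP ((mem_finalSol_iff hP).2
    ⟨X_mem_SolBar hP (by omega) le_rfl, fun u hu => X_nF_mem_tan hP hL hsec hu⟩)
    (frame_mem_kerBar hP (by omega) le_rfl) (fun m u hu => ?_) hf
  have h : R.frame R.nF m u ∈ kerOmega L u ⊓ R.tan R.nF u := by
    rw [← span_frame_nF hP hL hsec hu]
    exact Submodule.mem_sup_left (Submodule.subset_span ⟨m, rfl⟩)
  exact h.2

/-- The differences of final solutions are, at `u`, the vectors of `ker Ω_L` tangent to the final
constraint submanifold, and these are spanned by the last undetermined directions and `𝒢`. -/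
theorem finalSolDim_eq (hP : IsOpen P) (hL : SmoothFun P L)
    (hsec : ∀ u ∈ P, ∀ x ∈ calG L u, ∃ S ∈ SymL L P, S u = x) (hu : u ∈ R.cSet R.nF) :
    R.finalSolDim u = R.N R.nF := by
  have h2 := R.two_le
  obtain ⟨l, hl⟩ : ∃ l, l + 1 = R.nF := ⟨R.nF - 1, by omega⟩
  have hind : LinearIndependent ℝ fun m => (calG L u).mkQ (R.frame R.nF m u) := by
    have h := frame_indep (R := R) (l := l) hl.le (u := u) (cSet_anti (by omega) hu)
    rwa [hl] at h
  have hspan : Submodule.span ℝ {x : T u ⧸ calG L u | ∃ X ∈ R.finalSol, ∃ Y ∈ R.finalSol,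
      x = (calG L u).mkQ (X u - Y u)} =
      Submodule.span ℝ (range fun m => (calG L u).mkQ (R.frame R.nF m u)) := by
    refine le_antisymm (Submodule.span_le.2 ?_) (Submodule.span_le.2 ?_)
    · rintro _ ⟨X, hX, Y, hY, rfl⟩
      obtain ⟨hX1, hX2⟩ := (mem_finalSol_iff hP).1 hX
      obtain ⟨hY1, hY2⟩ := (mem_finalSol_iff hP).1 hY
      have hu1 : u ∈ R.cSet 1 := cSet_anti (by omega) hu
      have hk : X u - Y u ∈ kerOmega L u := fun y => by
        have h3 := Omega_add_left L u (X u - Y u) (Y u) y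
        rw [sub_add_cancel, hX1.2.1 u hu1 y, hY1.2.1 u hu1 y] at h3
        linarith
      have h3 : X u - Y u ∈ kerOmega L u ⊓ R.tan R.nF u := ⟨hk, sub_mem (hX2 u hu) (hY2 u hu)⟩
      rw [← span_frame_nF hP hL hsec hu] at h3
      obtain ⟨y, hy, g, hg, hyg⟩ := Submodule.mem_sup.1 h3
      obtain ⟨c, rfl⟩ := (Submodule.mem_span_range_iff_exists_fun ℝ).1 hy
      have hg0 : (calG L u).mkQ g = 0 := (Submodule.Quotient.mk_eq_zero _).2 hg
      rw [← hyg, map_add, hg0, add_zero, map_sum]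
      simp only [map_smul]
      exact Submodule.sum_mem _ fun m _ => Submodule.smul_mem _ _ (Submodule.subset_span ⟨m, rfl⟩)
    · rintro _ ⟨m, rfl⟩
      refine Submodule.subset_span ⟨_, add_sum_frame_mem_finalSol hP hL hsec
        (f := fun n _ => (Pi.single m 1 : Fin (R.N R.nF) → ℝ) n) fun n => const_mem_Fbar _,
        _, add_sum_frame_mem_finalSol hP hL hsec (f := fun _ _ => 0) fun n => const_mem_Fbar _, ?_⟩
      simp [Pi.single_apply]
  rw [finalSolDim, hspan, finrank_span_eq_card hind, Fintype.card_fin]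

/-- Symmetries are tangent, hence among the directions that are still undetermined. -/
theorem symSpace_le_span_frame (hP : IsOpen P) (hL : SmoothFun P L)
    (hsec : ∀ u ∈ P, ∀ x ∈ calG L u, ∃ S ∈ SymL L P, S u = x) {l : ℕ} (hl : l + 1 ≤ R.nF)
    (hu : u ∈ R.cSet (l + 1)) : symSpace L P u ≤
      Submodule.span ℝ (range fun m => R.frame (l + 1) m u) ⊔ calG L u := by
  obtain ⟨hV, -, hST, -⟩ := tangency (R := R) hP hL hsec hl
  have hu0 : u ∈ R.cSet l := cSet_anti (Nat.le_succ l) hu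
  rw [hV u hu0]
  exact le_inf (symSpace_le_kerOmega hu.1) (symSpace_le_iff.2 fun S hS => hST S hS u hu0)

theorem Gam_mulVec_eq_zero (hP : IsOpen P) (hL : SmoothFun P L)
    (hsec : ∀ u ∈ P, ∀ x ∈ calG L u, ∃ S ∈ SymL L P, S u = x) {l : ℕ} (hl : l + 1 ≤ R.nF)
    (hu : u ∈ R.cSet (l + 1)) {a : Fin (R.N (l + 1)) → ℝ}
    (ha : ∑ m, a m • R.frame (l + 1) m u ∈ symSpace L P u) : (R.Gam (l + 1) u).mulVec a = 0 := by
  have hT : symSpace L P u ≤ R.tan (l + 1) u :=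
    symSpace_le_iff.2 fun S hS => (tangency (R := R) hP hL hsec hl).2.2.2 S hS u hu
  funext n
  have h := hT ha (l + 1) (by omega) le_rfl n
  rw [map_sum] at h
  have h1 : ∑ m, diff (R.γ (l + 1) n) u (a m • R.frame (l + 1) m u) =
      (R.Gam (l + 1) u).mulVec a n := by
    refine Finset.sum_congr rfl fun m _ => ?_
    rw [map_smul, smul_eq_mul, mul_comm]
    rfl
  exact h1.symm.trans h

theorem symDim_le_of_symSpace_le {N : ℕ} {v : Fin N → T u}
    (h : symSpace L P u ≤ Submodule.span ℝ (range v) ⊔ calG L u) : symDim L P u ≤ N := by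
  have h1 : (symSpace L P u).map (calG L u).mkQ ≤
      Submodule.span ℝ (range fun n => (calG L u).mkQ (v n)) := by
    refine (Submodule.map_mono h).trans ?_
    rw [Submodule.map_sup, Submodule.map_span, Submodule.mkQ_map_self, sup_bot_eq,
      ← range_comp]
    rfl
  refine (Submodule.finrank_mono h1).trans ?_
  have h2 := finrank_range_le_card (R := ℝ) fun n => (calG L u).mkQ (v n)
  rwa [Fintype.card_fin] at h2

end ConstraintAlgorithm
end Consequences

end LagMech

end

theorem mainTheorem5 {D : ℕ} {Q : Type*} [TopologicalSpace Q] [T2Space Q]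
    [ChartedSpace (LagMech.Model D) Q] [IsManifold 𝓘(ℝ, LagMech.Model D) ∞ Q]
    (P : Set (LagMech.TQ D Q)) (hP : IsOpen P)
    (L : LagMech.TQ D Q → ℝ) (hL : LagMech.SmoothFun P L)
    (r : ℕ) (hM : ∀ u ∈ P, Module.finrank ℝ (LinearMap.range
      (LagMech.fibreHessian L u : LagMech.Model D →ₗ[ℝ] (LagMech.Model D →L[ℝ] ℝ))) = r)
    (κ : ℕ) (hΩ : ∀ u ∈ P, Module.finrank ℝ (LagMech.kerOmega L u) = κ)
    (R : LagMech.ConstraintAlgorithm L P) :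
    -- at every iteration the equations for the undetermined functions do not involve those which
    -- multiply generators in `Sym𝓛`, and all of the latter are still undetermined
    (∀ l, 1 ≤ l → l ≤ R.nF → ∀ u ∈ R.cSet l,
      LagMech.symSpace L P u ≤
        Submodule.span ℝ (range fun m => R.frame l m u) ⊔ LagMech.calG L u ∧
      (∀ a : Fin (R.N l) → ℝ, ∑ m, a m • R.frame l m u ∈ LagMech.symSpace L P u →
        (R.Gam l u).mulVec a = 0) ∧
      (∀ c : Fin (R.N l) → ℝ, ∑ n, c n • R.gen l n u ∈ LagMech.symSpace L P u →
        Matrix.vecMul c (R.Gam l u) = 0 ∧ ∑ n, c n * LagMech.act (R.X l) (R.γ l n) u = 0) ∧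
      LagMech.symDim L P u ≤ R.N l) ∧
    -- the functions left over by the algorithm are arbitrary
    (∀ f : Fin (R.N R.nF) → LagMech.TQ D Q → ℝ, (∀ m, f m ∈ LagMech.Fbar L P) →
      (fun u => R.X R.nF u + ∑ m, f m u • R.frame R.nF m u) ∈ R.finalSol) ∧
    -- each generator in `Sym𝓛` contributes an arbitrary function to the final SOELVFs
    (∀ X ∈ R.finalSol, ∀ (k : ℕ) (S : Fin k → LagMech.VField D Q)
      (f : Fin k → LagMech.TQ D Q → ℝ),
      (∀ i, S i ∈ LagMech.SymL L P) → (∀ i, f i ∈ LagMech.Fbar L P) →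
      (fun u => X u + ∑ i, f i u • S i u) ∈ R.finalSol) ∧
    -- the dimension of the space of final SOELVFs
    (∀ u ∈ R.cSet R.nF, R.finalSolDim u = R.N R.nF ∧
      LagMech.symDim L P u ≤ R.finalSolDim u) ∧
    (∀ N : ℕ, (∀ u ∈ P, LagMech.symDim L P u = N) →
      N ≤ R.N R.nF ∧ ∀ u ∈ R.cSet R.nF, N ≤ R.finalSolDim u) ∧
    -- no constraint of any order is due to `Sym𝓛`: among the generators of the constraint functions
    -- of order `l` are those in `Sym𝓛`, and their constraint functions vanish identically on the
    -- preceding constraint submanifold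
    (∀ l, 1 ≤ l → l ≤ R.nF → ∀ u ∈ R.cSet (l - 1),
      LagMech.symSpace L P u ≤
        Submodule.span ℝ (range fun n => R.gen l n u) ⊔ LagMech.calG L u ∧
      ∀ c : Fin (R.N l) → ℝ, ∑ n, c n • R.gen l n u ∈ LagMech.symSpace L P u →
        ∑ n, c n * R.γ l n u = 0) := by
  have hsec : ∀ u ∈ P, ∀ x ∈ LagMech.calG L u, ∃ S ∈ LagMech.SymL L P, S u = x := by
    intro u hu x hx
    obtain ⟨G, hG, hGx⟩ := LagMech.exists_isSectionG hP hL hM hu hx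
    exact ⟨G, hG.mem_SymL hP hL, hGx⟩
  have hdim : ∀ l, 1 ≤ l → l ≤ R.nF → ∀ u ∈ R.cSet l, LagMech.symDim L P u ≤ R.N l := by
    intro l h1 h2 u hu
    obtain ⟨l, rfl⟩ := Nat.exists_eq_add_of_le' h1
    exact LagMech.ConstraintAlgorithm.symDim_le_of_symSpace_le
      (LagMech.ConstraintAlgorithm.symSpace_le_span_frame hP hL hsec h2 hu)
  have hnF : 1 ≤ R.nF := le_trans one_le_two R.two_le
  have hsol := fun u (hu : u ∈ R.cSet R.nF) =>
    LagMech.ConstraintAlgorithm.finalSolDim_eq hP hL hsec hu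
  refine ⟨fun l h1 h2 u hu => ?_, fun f hf =>
    LagMech.ConstraintAlgorithm.add_sum_frame_mem_finalSol hP hL hsec hf,
    fun X hX k S f hS hf => LagMech.ConstraintAlgorithm.add_sum_smul_mem_finalSol hP hX
      (fun i => (hS i).1)
      (fun i u hu => LagMech.ConstraintAlgorithm.symL_mem_tan_nF hP hL hsec (hS i) hu) hf,
    fun u hu => ⟨hsol u hu, (hdim _ hnF le_rfl u hu).trans (hsol u hu).ge⟩,
    fun N hN => ?_, fun l h1 h2 u hu => ?_⟩
  · have hd := hdim l h1 h2 u hu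
    obtain ⟨l, rfl⟩ := Nat.exists_eq_add_of_le' h1
    refine ⟨LagMech.ConstraintAlgorithm.symSpace_le_span_frame hP hL hsec h2 hu,
      fun a ha => LagMech.ConstraintAlgorithm.Gam_mulVec_eq_zero hP hL hsec h2 hu ha,
      fun c hc => ?_, hd⟩
    have hu0 := LagMech.ConstraintAlgorithm.cSet_anti (R := R) (Nat.le_succ l) hu
    obtain ⟨hV, hX, -⟩ := LagMech.ConstraintAlgorithm.tangency (R := R) hP hL hsec h2
    have hC := fun v hv => LagMech.ConstraintAlgorithm.sum_mul_diff_γ_eq_zero (v := v) hP hL hsec h2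
      (LagMech.ConstraintAlgorithm.symSpace_le_span_gen hP hL hsec h2) hu hc hv
    refine ⟨funext fun m => hC _ ?_, hC _ (hX u hu)⟩
    have h : R.frame (l + 1) m u ∈ LagMech.kerOmega L u ⊓ R.tan l u := by
      rw [← hV u hu0]
      exact Submodule.mem_sup_left (Submodule.subset_span ⟨m, rfl⟩)
    exact h.2
  · obtain ⟨u₀, hu₀⟩ := R.nonempty
    have hle : N ≤ R.N R.nF :=
      (hN u₀ (LagMech.ConstraintAlgorithm.cSet_subset (R := R) hu₀)).ge.trans
        (hdim _ hnF le_rfl u₀ hu₀)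
    exact ⟨hle, fun u hu => hle.trans (hsol u hu).ge⟩
  · obtain ⟨l, rfl⟩ := Nat.exists_eq_add_of_le' h1
    exact LagMech.ConstraintAlgorithm.symSpace_le_span_gen hP hL hsec h2 u hu
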